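/- **Theorem 3.3.** Let $n\ge 2$, let $E_{i,j}$ be the matrix units of $gl(n)$ over $\mathbb C$, and let $\lambda=(\lambda_1,\dots,\lambda_n)\in\mathbb C^n$ be a weight such that, for some $\mu\in\mathbb C$, $$\lambda_i-\lambda_{i+1}=\mu\quad(1\le i\le n-2),\qquad \sigma:=\lambda_{n-1}-\lambda_n\notin\mathbb N=\{0,1,2,\dots\}.$$ Let $M_\lambda$ be the Verma module of highest weight $\lambda$ with highest weight vector $v_\lambda$ (positive root vectors $E_{i,j}$, $i<j$). Let $\tilde M$ be the space of all formal series $\sum_{e\in\mathbb Z^n}w_e\,x_1^{e_1+\mu}\cdots x_n^{e_n+\mu}$ with $w_e\in M_\lambda$, on which $E_{j,k}$ acts by its action on the coefficients $w_e$ plus the operator $x_j\partial_{x_k}-\mu\delta_{j,k}$ on the monomials. (This is the completed tensor product $M_\lambda\hat\otimes V_\mu$.) Write $\langle c\rangle_k=c(c-1)\cdots(c-k+1)$ and $(c)_k=c(c+1)\cdots(c+k-1)$, and put $$u_\lambda=(x_1\cdots x_n)^\mu\sum_{i_1,\dots,i_{n-1}\ge0}\frac{(-1)^{i_1+\cdots+i_{n-1}}\langle\mu\rangle_{i_{n-1}}}{i_1!\cdots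 i_{n-1}!\,\langle\sigma\rangle_{i_{n-1}}}\,E_{2,1}^{i_1}E_{3,2}^{i_2}\cdots E_{n,n-1}^{i_{n-1}}v_\lambda\; x_1^{i_1}x_2^{i_2-i_1}\cdots x_{n-1}^{i_{n-1}-i_{n-2}}x_n^{-i_{n-1}} .$$ Then there is exactly one $gl(n)$-module homomorphism $\Phi:M_\lambda\to\tilde M$ with $\Phi(v_\lambda)=u_\lambda$. Define its Etingof trace function by $$E(z_1,\dots,z_n)=(x_1\cdots x_n)^{-\mu}\,\mathrm{tr}_{M_\lambda}\,\Phi\, z_1^{E_{1,1}}\cdots z_n^{E_{n,n}},$$ where $\Phi=\sum_e\Phi_e\,x_1^{e_1+\mu}\cdots x_n^{e_n+\mu}$ is viewed as a series in $x_1,\dots,x_n$ with coefficients $\Phi_e\in\mathrm{End}\,M_\lambda$, the operator $z_1^{E_{1,1}}\cdots z_n^{E_{n,n}}$ is multiplication by $z_1^{\nu_1}\cdots z_n^{\nu_n}$ on the weight space $M_\lambda[\nu]$, the trace over $M_\lambda$ of a coefficient is the sum over all weights $\nu$ of the traces of its diagonal blocks on the weight spaces $M_\lambda[\nu]$, and complex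 powers are taken with the principal branch. Thus $E(z_1,\dots,z_n)$ is a priori a series in $x_1,\dots,x_n$. For complex $\tau_1,\dots,\tau_n,\vartheta$ with $-\vartheta\notin\mathbb N$ and variables $y_{j,k}$ ($1\le k<j\le n$) let $$\mathcal X_A(\tau_1,\dots,\tau_n;\vartheta)\{y_{j,k}\}=\sum_{\beta}\frac{\Big[\prod_{s=1}^{n-1}\big(\tau_s-\sum_{r<s}\beta_{s,r}\big)_{\sum_{r>s}\beta_{r,s}}\Big](\tau_n)_{\sum_{r<n}\beta_{n,r}}}{\prod_{k<j}\beta_{j,k}!\;(\vartheta)_{\sum_{r<n}\beta_{n,r}}}\prod_{k<j}y_{j,k}^{\beta_{j,k}},$$ the sum being over all families $\beta=(\beta_{j,k})_{1\le k<j\le n}$ of nonnegative integers, and let $$\xi^A_{r_2,r_1}=\prod_{s=r_1}^{r_2-1}\frac{z_{r_2}}{z_{r_2}-z_s}\qquad(1\le r_1<r_2\le n).$$ Then there is $\varepsilon>0$ such that for all $z\in(\mathbb C\setminus\{0\})^n$ with $|z_{k+1}|<\varepsilon|z_k|$ for $1\le k\le n-1$ the following hold: the $z_k$ are pairwise distinct,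 the series over $\nu$ defining the trace of each coefficient and the series $\mathcal X_A$ below converge absolutely, and $E(z_1,\dots,z_n)$ is independent of $x_1,\dots,x_n$ (the coefficients of $x^e$ with $e\neq0$ vanish) and equals $$E(z_1,\dots,z_n)=\frac{\prod_{r=1}^n z_r^{\lambda_r+n-r}}{\prod_{1\le k<j\le n}(z_k-z_j)}\;\mathcal X_A(\mu+1,\dots,\mu+1,-\mu;-\sigma)\{\xi^A_{r_2,r_1}\}.$$ -/

import Mathlib

open scoped BigOperators

attribute [local instance 100] LieRing.ofAssociativeRing

namespace EtingofTrace

/-! ### The Lie algebra `gl(n)` over `ℂ` and its Verma modules -/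

/-- `gl(n)`: complex `n × n` matrices with the commutator bracket. -/
abbrev gl (n : ℕ) : Type := Matrix (Fin n) (Fin n) ℂ

/-- The universal enveloping algebra `U(gl(n))`. -/
abbrev Ugl (n : ℕ) : Type := UniversalEnvelopingAlgebra ℂ (gl n)

/-- The matrix unit `E_{i,j}` in `gl(n)`. -/
def E {n : ℕ} (i j : Fin n) : gl n := Matrix.single i j 1

/-- The matrix unit `E_{i,j}`, seen in `U(gl(n))`. -/
noncomputable def uE {n : ℕ} (i j : Fin n) : Ugl n := UniversalEnvelopingAlgebra.ι ℂ (E i j)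

/-- The left ideal of `U(gl(n))` generated by the positive root vectors `E_{i,j}` (`i < j`)
and by the elements `E_{i,i} - lam_i`. -/
noncomputable def vermaIdeal {n : ℕ} (lam : Fin n → ℂ) : Submodule (Ugl n) (Ugl n) :=
  Submodule.span (Ugl n)
    ({a | ∃ i j : Fin n, i < j ∧ a = uE i j} ∪
      {a | ∃ i : Fin n, a = uE i i - algebraMap ℂ (Ugl n) (lam i)})

/-- The Verma module `M_lam` of highest weight `lam`. -/
def Verma {n : ℕ} (lam : Fin n → ℂ) : Type := Ugl n ⧸ vermaIdeal lam

section Verma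

variable {n : ℕ} (lam : Fin n → ℂ)

noncomputable instance : AddCommGroup (Verma lam) :=
  inferInstanceAs (AddCommGroup (Ugl n ⧸ vermaIdeal lam))

noncomputable instance : Module (Ugl n) (Verma lam) :=
  inferInstanceAs (Module (Ugl n) (Ugl n ⧸ vermaIdeal lam))

noncomputable instance : Module ℂ (Verma lam) :=
  inferInstanceAs (Module ℂ (Ugl n ⧸ vermaIdeal lam))

instance : IsScalarTower ℂ (Ugl n) (Verma lam) :=
  inferInstanceAs (IsScalarTower ℂ (Ugl n) (Ugl n ⧸ vermaIdeal lam))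

/-- `gl(n)` acts on the Verma module through `gl(n) → U(gl(n))`. -/
noncomputable instance : LieRingModule (gl n) (Verma lam) where
  bracket A m := UniversalEnvelopingAlgebra.ι ℂ A • m
  add_lie A B m := by simp only [map_add, add_smul]
  lie_add A m m' := by simp only [smul_add]
  leibniz_lie A B m := by
    have h : UniversalEnvelopingAlgebra.ι ℂ ⁅A, B⁆ =
        UniversalEnvelopingAlgebra.ι ℂ A * UniversalEnvelopingAlgebra.ι ℂ B -
          UniversalEnvelopingAlgebra.ι ℂ B * UniversalEnvelopingAlgebra.ι ℂ A := by
      rw [LieHom.map_lie, LieRing.of_associative_ring_bracket]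
    rw [h, sub_smul, mul_smul, mul_smul, sub_add_cancel]

theorem lie_verma (A : gl n) (m : Verma lam) :
    ⁅A, m⁆ = UniversalEnvelopingAlgebra.ι ℂ A • m := rfl

noncomputable instance : LieModule ℂ (gl n) (Verma lam) where
  smul_lie t A m := by simp only [lie_verma, map_smul, smul_assoc]
  lie_smul t A m := by
    simp only [lie_verma]
    rw [← algebraMap_smul (Ugl n) t m, ← algebraMap_smul (Ugl n) t (_ • m), smul_smul, smul_smul,
      Algebra.commutes]

/-- The highest weight vector `v_lam`. -/
noncomputable def hwVector : Verma lam := (vermaIdeal lam).mkQ 1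

/-- The weight space of weight `nu`: all `m` with `E_{k,k} m = nu_k m` for every `k`. -/
noncomputable def weightSpace (nu : Fin n → ℂ) : Submodule ℂ (Verma lam) :=
  ⨅ k, Module.End.eigenspace (LieModule.toEnd ℂ (gl n) (Verma lam) (E k k)) (nu k)

theorem mem_weightSpace (nu : Fin n → ℂ) (m : Verma lam) :
    m ∈ weightSpace lam nu ↔ ∀ k, ⁅E k k, m⁆ = nu k • m := by
  simp [weightSpace]

theorem E_lie_E (i j k l : Fin n) :
    ⁅E i j, E k l⁆ = (if j = k then E i l else 0) - (if l = i then E k j else 0) := by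
  simp only [LieRing.of_associative_ring_bracket, E]
  congr 1
  · split_ifs with h
    · subst h; simp
    · simp [h]
  · split_ifs with h
    · subst h; simp
    · simp [h]

theorem hwVector_mem : hwVector lam ∈ weightSpace lam lam := by
  rw [mem_weightSpace]
  intro k
  have h : (vermaIdeal lam).mkQ (uE k k - algebraMap ℂ (Ugl n) (lam k)) = 0 := by
    rw [Submodule.mkQ_apply, Submodule.Quotient.mk_eq_zero]
    exact Submodule.subset_span (Or.inr ⟨k, rfl⟩)
  rw [map_sub, sub_eq_zero] at h
  have h1 : ⁅E k k, hwVector lam⁆ = (vermaIdeal lam).mkQ (uE k k) := by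
    rw [lie_verma, hwVector]
    exact ((vermaIdeal lam).mkQ.map_smul (uE k k) 1).symm.trans (by simp)
  have h2 : lam k • hwVector lam = (vermaIdeal lam).mkQ (algebraMap ℂ (Ugl n) (lam k)) := by
    rw [← algebraMap_smul (Ugl n) (lam k) (hwVector lam), hwVector]
    exact ((vermaIdeal lam).mkQ.map_smul (algebraMap ℂ (Ugl n) (lam k)) 1).symm.trans (by simp)
  rw [h1, h2, h]

theorem lie_mem_weightSpace {nu : Fin n → ℂ} {m : Verma lam} (hm : m ∈ weightSpace lam nu)
    (i j : Fin n) :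
    ⁅E i j, m⁆ ∈ weightSpace lam (nu + Pi.single i 1 - Pi.single j 1) := by
  rw [mem_weightSpace] at hm ⊢
  intro k
  rw [leibniz_lie, hm k, E_lie_E, lie_smul, sub_lie]
  have h1 : ⁅(if k = i then E k j else 0 : gl n), m⁆ = (Pi.single i (1 : ℂ) : Fin n → ℂ) k • ⁅E i j, m⁆ := by
    by_cases h : k = i
    · subst h; simp
    · simp [h]
  have h2 : ⁅(if j = k then E i k else 0 : gl n), m⁆ = (Pi.single j (1 : ℂ) : Fin n → ℂ) k • ⁅E i j, m⁆ := by
    by_cases h : j = k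
    · subst h; simp
    · simp [h, Ne.symm h]
  rw [h1, h2]
  simp only [Pi.add_apply, Pi.sub_apply, add_smul, sub_smul]
  abel

theorem iSup_weightSpace : ⨆ nu, weightSpace lam nu = ⊤ := by
  set S := ⨆ nu, weightSpace lam nu with hS
  have hE : ∀ (i j : Fin n) (m : Verma lam), m ∈ S → ⁅E i j, m⁆ ∈ S := by
    intro i j m hm
    refine Submodule.iSup_induction (weightSpace lam)
      (motive := fun m => ⁅E i j, m⁆ ∈ S) hm ?_ ?_ ?_
    · intro nu m hm
      exact Submodule.mem_iSup_of_mem _ (lie_mem_weightSpace lam hm i j)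
    · simp
    · intro a b ha hb
      rw [lie_add]
      exact S.add_mem ha hb
  have hA : ∀ (A : gl n) (m : Verma lam), m ∈ S → ⁅A, m⁆ ∈ S := by
    intro A m hm
    rw [Matrix.matrix_eq_sum_single A, sum_lie ]
    refine S.sum_mem fun i _ => ?_
    rw [sum_lie]
    refine S.sum_mem fun j _ => ?_
    have : Matrix.single i j (A i j) = A i j • E i j := by simp [E, Matrix.smul_single]
    rw [this, smul_lie]
    exact S.smul_mem _ (hE i j m hm)
  have hU : ∀ (a : Ugl n) (m : Verma lam), m ∈ S → a • m ∈ S := by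
    let B : Subalgebra ℂ (Ugl n) :=
      { carrier := {a | ∀ m ∈ S, a • m ∈ S}
        mul_mem' := fun {a b} ha hb m hm => by rw [mul_smul]; exact ha _ (hb _ hm)
        add_mem' := fun {a b} ha hb m hm => by
          rw [add_smul]; exact S.add_mem (ha _ hm) (hb _ hm)
        algebraMap_mem' := fun r m hm => by rw [algebraMap_smul]; exact S.smul_mem _ hm }
    let f : gl n →ₗ⁅ℂ⁆ B :=
      { toFun := fun A => ⟨UniversalEnvelopingAlgebra.ι ℂ A, fun m hm => hA A m hm⟩
        map_add' := fun A A' => Subtype.ext (map_add _ _ _)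
        map_smul' := fun r A => Subtype.ext (map_smul _ _ _)
        map_lie' := fun {A A'} => Subtype.ext (LieHom.map_lie _ _ _) }
    have hid : B.val.comp (UniversalEnvelopingAlgebra.lift ℂ f) = AlgHom.id ℂ (Ugl n) := by
      apply UniversalEnvelopingAlgebra.hom_ext
      ext A
      simp [f]
    intro a m hm
    have := (UniversalEnvelopingAlgebra.lift ℂ f a).2 m hm
    have h2 : ((UniversalEnvelopingAlgebra.lift ℂ f a : B) : Ugl n) = a :=
      DFunLike.congr_fun hid a
    rwa [h2] at this
  rw [eq_top_iff]
  intro m _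
  obtain ⟨a, rfl⟩ := Submodule.mkQ_surjective (vermaIdeal lam) m
  have h : (vermaIdeal lam).mkQ a = a • hwVector lam := by
    rw [hwVector]
    exact Eq.trans (by simp) ((vermaIdeal lam).mkQ.map_smul a 1)
  have := hU a _ (Submodule.mem_iSup_of_mem lam (hwVector_mem lam))
  rw [← h] at this
  exact this

theorem commute_diag (i j : Fin n) :
    Commute (LieModule.toEnd ℂ (gl n) (Verma lam) (E i i))
      (LieModule.toEnd ℂ (gl n) (Verma lam) (E j j)) := by
  have h0 : ⁅E i i, E j j⁆ = 0 := by
    rw [E_lie_E]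
    by_cases h : i = j
    · subst h; simp
    · simp [h, Ne.symm h]
  refine LinearMap.ext fun m => ?_
  have h := leibniz_lie (E i i) (E j j) m
  rw [h0, zero_lie, zero_add] at h
  exact h

theorem iSupIndep_weightSpace : iSupIndep (weightSpace lam) := by
  have h := Module.End.independent_iInf_maxGenEigenspace_of_forall_mapsTo
    (fun k : Fin n => LieModule.toEnd ℂ (gl n) (Verma lam) (E k k))
    (fun i j φ => Module.End.mapsTo_maxGenEigenspace_of_comm (commute_diag lam j i) φ)
  refine iSupIndep.mono h fun nu => ?_
  refine iInf_mono fun k => ?_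
  intro m hm
  rw [Module.End.mem_maxGenEigenspace]
  rw [Module.End.mem_eigenspace_iff] at hm
  exact ⟨1, by rw [pow_one, LinearMap.sub_apply, hm]; simp⟩

open Classical in
theorem isInternal_weightSpace : DirectSum.IsInternal (weightSpace lam) :=
  DirectSum.isInternal_submodule_of_iSupIndep_of_iSup_eq_top
    (iSupIndep_weightSpace lam) (iSup_weightSpace lam)

open Classical in
/-- The weight space decomposition `M_lam ≃ ⨁ M_lam[nu]`. -/
noncomputable def weightDecomp :
    Verma lam ≃ₗ[ℂ] DirectSum (Fin n → ℂ) (fun nu => weightSpace lam nu) :=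
  (LinearEquiv.ofBijective (DirectSum.coeLinearMap (weightSpace lam))
    (isInternal_weightSpace lam)).symm

open Classical in
/-- The projection of `M_lam` onto its weight space of weight `nu`. -/
noncomputable def weightProj (nu : Fin n → ℂ) : Verma lam →ₗ[ℂ] weightSpace lam nu :=
  DirectSum.component ℂ (Fin n → ℂ) (fun nu => weightSpace lam nu) nu ∘ₗ
    (weightDecomp lam).toLinearMap

open Classical in
/-- The operator `z_1^{E_{1,1}} ⋯ z_n^{E_{n,n}}` on `M_lam`: it is multiplication by
`z_1^{nu_1} ⋯ z_n^{nu_n}` on the weight space of weight `nu`. -/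
noncomputable def torusOp (z : Fin n → ℂ) : Verma lam →ₗ[ℂ] Verma lam :=
  DirectSum.toModule ℂ (Fin n → ℂ) (Verma lam)
      (fun nu => (∏ k, z k ^ nu k) • (weightSpace lam nu).subtype) ∘ₗ
    (weightDecomp lam).toLinearMap

/-- The trace of the diagonal block of `T : M_lam → M_lam` at the (finite-dimensional) weight
space of weight `nu`. The trace of `T` over `M_lam` is the sum of these over all `nu`. -/
noncomputable def blockTrace (T : Verma lam →ₗ[ℂ] Verma lam) (nu : Fin n → ℂ) : ℂ :=
  LinearMap.trace ℂ (weightSpace lam nu)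
    (weightProj lam nu ∘ₗ T ∘ₗ (weightSpace lam nu).subtype)

end Verma

/-! ### The completed tensor product of the Verma module with the point representation -/

/-- The space of Laurent series `∑_e f_e x_1^{e_1 + mu} ⋯ x_n^{e_n + mu}` (`e ∈ ℤ^n`) with
arbitrary coefficients `f_e` in `M_lam`. -/
@[nolint unusedArguments]
def Laurent {n : ℕ} (lam : Fin n → ℂ) (_mu : ℂ) : Type := (Fin n → ℤ) → Verma lam

section Laurent

variable {n : ℕ} (lam : Fin n → ℂ) (mu : ℂ)

noncomputable instance : AddCommGroup (Laurent lam mu) :=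
  inferInstanceAs (AddCommGroup ((Fin n → ℤ) → Verma lam))

noncomputable instance : Module ℂ (Laurent lam mu) :=
  inferInstanceAs (Module ℂ ((Fin n → ℤ) → Verma lam))

/-- The coefficient `f_e` of `x_1^{e_1 + mu} ⋯ x_n^{e_n + mu}`. -/
noncomputable def coeff (e : Fin n → ℤ) : Laurent lam mu →ₗ[ℂ] Verma lam where
  toFun f := f e
  map_add' _ _ := rfl
  map_smul' _ _ := rfl

theorem Laurent.ext {f g : Laurent lam mu} (h : ∀ e, coeff lam mu e f = coeff lam mu e g) :
    f = g := funext h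

/-- The operator `x_j ∂_{x_k} - mu δ_{j,k}` on Laurent series. As
`x_j ∂_{x_k} x^{d + mu} = (d_k + mu) x^{d + ε_j - ε_k + mu}`, the coefficient at `e` of the first
part comes from `d = e - ε_j + ε_k`. -/
noncomputable def pointOp (j k : Fin n) : Laurent lam mu →ₗ[ℂ] Laurent lam mu :=
  LinearMap.pi fun e : Fin n → ℤ =>
    (((e - Pi.single j 1 + Pi.single k 1 : Fin n → ℤ) k : ℂ) + mu) •
        coeff lam mu (e - Pi.single j 1 + Pi.single k 1)
      - (if j = k then mu else 0) • coeff lam mu e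

theorem coeff_pointOp (j k : Fin n) (f : Laurent lam mu) (e : Fin n → ℤ) :
    coeff lam mu e (pointOp lam mu j k f) =
      (((e - Pi.single j 1 + Pi.single k 1 : Fin n → ℤ) k : ℂ) + mu) •
        coeff lam mu (e - Pi.single j 1 + Pi.single k 1) f
      - (if j = k then mu else 0) • coeff lam mu e f := rfl

/-- The action of `gl(n)` on the exponents: `E_{j,k} ↦ x_j ∂_{x_k} - mu δ_{j,k}`. -/
noncomputable def pointAct : gl n →ₗ[ℂ] Module.End ℂ (Laurent lam mu) where
  toFun A := ∑ j, ∑ k, A j k • pointOp lam mu j k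
  map_add' A B := by simp [add_smul, Finset.sum_add_distrib]
  map_smul' c A := by simp [mul_smul, Finset.smul_sum]

/-- The action of `gl(n)` on the coefficients. -/
noncomputable def coeffAct : gl n →ₗ[ℂ] Module.End ℂ (Laurent lam mu) where
  toFun A :=
    { toFun := fun f e => ⁅A, f e⁆
      map_add' := fun f g => funext fun e => lie_add A (f e) (g e)
      map_smul' := fun c f => funext fun e => lie_smul c A (f e) }
  map_add' A B := LinearMap.ext fun f => funext fun e => add_lie A B (f e)
  map_smul' c A := LinearMap.ext fun f => funext fun e => smul_lie c A (f e)

theorem coeff_coeffAct (A : gl n) (f : Laurent lam mu) (e : Fin n → ℤ) :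
    coeff lam mu e (coeffAct lam mu A f) = ⁅A, coeff lam mu e f⁆ := rfl

theorem pointAct_E (j k : Fin n) : pointAct lam mu (E j k) = pointOp lam mu j k := by
  simp only [pointAct, E, LinearMap.coe_mk, AddHom.coe_mk, Matrix.single_apply]
  rw [Finset.sum_eq_single j, Finset.sum_eq_single k]
  · simp
  · intro b _ hb; simp [Ne.symm hb]
  · simp
  · intro b _ hb; simp [Ne.symm hb]
  · simp

theorem pointOp_lie (j k l m : Fin n) :
    ⁅pointOp lam mu j k, pointOp lam mu l m⁆ =
      (if k = l then pointOp lam mu j m else 0) - (if m = j then pointOp lam mu l k else 0) := by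
  refine LinearMap.ext fun f => Laurent.ext lam mu fun e => ?_
  rw [LieRing.of_associative_ring_bracket]
  simp only [LinearMap.sub_apply, Module.End.mul_apply, map_sub]
  have h1 : coeff lam mu e ((if k = l then pointOp lam mu j m else 0 : Module.End ℂ _) f) =
      (if k = l then (1 : ℂ) else 0) • coeff lam mu e (pointOp lam mu j m f) := by
    split_ifs <;> simp
  have h2 : coeff lam mu e ((if m = j then pointOp lam mu l k else 0 : Module.End ℂ _) f) =
      (if m = j then (1 : ℂ) else 0) • coeff lam mu e (pointOp lam mu l k f) := by
    split_ifs <;> simp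
  rw [h1, h2]
  simp only [coeff_pointOp]
  have hd : e - Pi.single l 1 + Pi.single m 1 - Pi.single j 1 + Pi.single k 1
      = e - Pi.single j 1 + Pi.single k 1 - Pi.single l 1 + (Pi.single m 1 : Fin n → ℤ) := by abel
  rw [hd]
  set d : Fin n → ℤ := e - Pi.single j 1 + Pi.single k 1 - Pi.single l 1 + Pi.single m 1 with hdd
  have hk : e - Pi.single j 1 + Pi.single k 1 = d + Pi.single l 1 - Pi.single m 1 := by
    rw [hdd]; abel
  have hm : e - Pi.single l 1 + Pi.single m 1 = d + Pi.single j 1 - Pi.single k 1 := by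
    rw [hdd]; abel
  have h3 : (if k = l then (1 : ℂ) else 0) • coeff lam mu (e - Pi.single j 1 + Pi.single m 1) f =
      (if k = l then (1 : ℂ) else 0) • coeff lam mu d f := by
    split_ifs with h
    · subst h; rw [hdd]; congr 3; abel
    · simp
  have h4 : (if m = j then (1 : ℂ) else 0) • coeff lam mu (e - Pi.single l 1 + Pi.single k 1) f =
      (if m = j then (1 : ℂ) else 0) • coeff lam mu d f := by
    split_ifs with h
    · subst h; rw [hdd]; congr 3; abel
    · simp
  have h5 : (if k = l then (1 : ℂ) else 0) *
        (((e - Pi.single j 1 + Pi.single m 1 : Fin n → ℤ) m : ℂ) + mu) =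
      (if k = l then (1 : ℂ) else 0) * ((d m : ℂ) + mu) := by
    split_ifs with h
    · subst h
      have : e - Pi.single j 1 + Pi.single m 1 = d := by rw [hdd]; abel
      rw [this]
    · simp
  have h6 : (if m = j then (1 : ℂ) else 0) *
        (((e - Pi.single l 1 + Pi.single k 1 : Fin n → ℤ) k : ℂ) + mu) =
      (if m = j then (1 : ℂ) else 0) * ((d k : ℂ) + mu) := by
    split_ifs with h
    · subst h
      have : e - Pi.single l 1 + Pi.single k 1 = d := by rw [hdd]; abel
      rw [this]
    · simp
  have h7 : (if k = m then (1 : ℂ) else 0) * (d k - d m) = 0 := by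
    split_ifs with h
    · subst h; simp
    · simp
  have hkk : ((e - Pi.single j 1 + Pi.single k 1 : Fin n → ℤ) k : ℂ) =
      d k + (if k = l then 1 else 0) - (if k = m then 1 else 0) := by
    rw [hk]; simp [Pi.single_apply]
  have hmm : ((e - Pi.single l 1 + Pi.single m 1 : Fin n → ℤ) m : ℂ) =
      d m + (if m = j then 1 else 0) - (if k = m then 1 else 0) := by
    rw [hm]; simp [Pi.single_apply, eq_comm]
  rw [hkk, hmm]
  have h8 : (if k = l then (1 : ℂ) else 0) * (if j = m then mu else 0) =
      (if m = j then (1 : ℂ) else 0) * (if l = k then mu else 0) := by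
    simp only [eq_comm (a := m), eq_comm (a := l)]
    split_ifs <;> simp
  simp only [smul_sub, smul_smul]
  have h9 : ((if k = l then (1 : ℂ) else 0) * ((d m : ℂ) + mu)) •
      coeff lam mu (e - Pi.single j 1 + Pi.single m 1) f =
        (((d m : ℂ) + mu) * (if k = l then (1 : ℂ) else 0)) • coeff lam mu d f := by
    rw [mul_comm, mul_smul, h3, ← mul_smul]
  have h10 : ((if m = j then (1 : ℂ) else 0) * ((d k : ℂ) + mu)) •
      coeff lam mu (e - Pi.single l 1 + Pi.single k 1) f =
        (((d k : ℂ) + mu) * (if m = j then (1 : ℂ) else 0)) • coeff lam mu d f := by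
    rw [mul_comm, mul_smul, h4, ← mul_smul]
  rw [h5, h6, h8, h9, h10]
  have h11 := congrArg (fun t : ℂ => t • coeff lam mu d f) h7
  simp only [zero_smul] at h11
  linear_combination (norm := module) h11

/-- The `gl(n)`-action on Laurent series:
`E_{j,k}` acts on coefficients plus `x_j ∂_{x_k} - mu δ_{j,k}` on monomials. -/
noncomputable def laurentAct : gl n →ₗ[ℂ] Module.End ℂ (Laurent lam mu) :=
  coeffAct lam mu + pointAct lam mu

theorem coeffAct_pointOp (A : gl n) (j k : Fin n) :
    coeffAct lam mu A * pointOp lam mu j k = pointOp lam mu j k * coeffAct lam mu A := by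
  refine LinearMap.ext fun f => Laurent.ext lam mu fun e => ?_
  simp only [Module.End.mul_apply, coeff_coeffAct, coeff_pointOp, lie_sub, lie_smul]

theorem laurentAct_lie (A B : gl n) :
    laurentAct lam mu ⁅A, B⁆ = ⁅laurentAct lam mu A, laurentAct lam mu B⁆ := by
  have hE : ∀ j k l m : Fin n, laurentAct lam mu ⁅E j k, E l m⁆ =
      ⁅laurentAct lam mu (E j k), laurentAct lam mu (E l m)⁆ := by
    intro j k l m
    have hp : pointAct lam mu ⁅E j k, E l m⁆ = ⁅pointOp lam mu j k, pointOp lam mu l m⁆ := by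
      rw [pointOp_lie, E_lie_E, map_sub, apply_ite (pointAct lam mu), apply_ite (pointAct lam mu),
        pointAct_E, pointAct_E, map_zero]
    have hc : coeffAct lam mu ⁅E j k, E l m⁆ =
        ⁅coeffAct lam mu (E j k), coeffAct lam mu (E l m)⁆ := by
      refine LinearMap.ext fun f => Laurent.ext lam mu fun e => ?_
      exact lie_lie (E j k) (E l m) (coeff lam mu e f)
    simp only [laurentAct, LinearMap.add_apply, pointAct_E, hp, hc]
    simp only [LieRing.of_associative_ring_bracket, mul_add, add_mul, coeffAct_pointOp]
    abel
  have hs : ∀ A : gl n, A = ∑ i, ∑ j, A i j • E i j := by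
    intro A
    conv_lhs => rw [Matrix.matrix_eq_sum_single A]
    simp [E, Matrix.smul_single]
  rw [hs A, hs B]
  simp only [sum_lie, lie_sum, smul_lie, lie_smul, map_sum, map_smul, hE]

noncomputable instance : LieRingModule (gl n) (Laurent lam mu) where
  bracket A f := laurentAct lam mu A f
  add_lie A B f := by simp only [map_add, LinearMap.add_apply]
  lie_add A f g := map_add _ _ _
  leibniz_lie A B f := by
    have h := DFunLike.congr_fun (laurentAct_lie lam mu A B) f
    change laurentAct lam mu A (laurentAct lam mu B f) = laurentAct lam mu ⁅A, B⁆ f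
      + laurentAct lam mu B (laurentAct lam mu A f)
    rw [h, LieRing.of_associative_ring_bracket]
    simp only [LinearMap.sub_apply, Module.End.mul_apply, sub_add_cancel]

noncomputable instance : LieModule ℂ (gl n) (Laurent lam mu) where
  smul_lie t A f := by
    change laurentAct lam mu (t • A) f = t • laurentAct lam mu A f
    rw [map_smul, LinearMap.smul_apply]
  lie_smul t A f := map_smul (laurentAct lam mu A) t f

/-- The defining formula of the action: for the monomial coefficient at `e`,
`E_{j,k} f` has coefficient `E_{j,k} f_e + (d_k + mu) f_d - mu δ_{j,k} f_e`,
where `d = e - ε_j + ε_k`. -/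
theorem coeff_lie_E (j k : Fin n) (f : Laurent lam mu) (e : Fin n → ℤ) :
    coeff lam mu e ⁅E j k, f⁆ = ⁅E j k, coeff lam mu e f⁆ +
      ((((e - Pi.single j 1 + Pi.single k 1 : Fin n → ℤ) k : ℂ) + mu) •
          coeff lam mu (e - Pi.single j 1 + Pi.single k 1) f
        - (if j = k then mu else 0) • coeff lam mu e f) := by
  change coeff lam mu e (coeffAct lam mu (E j k) f + pointAct lam mu (E j k) f) = _
  rw [map_add, pointAct_E, coeff_coeffAct, coeff_pointOp]

end Laurent

/-! ### The singular vector -/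

/-- `E^{ε(i)} = E_{2,1}^{i_1} E_{3,2}^{i_2} ⋯ E_{n,n-1}^{i_{n-1}}` in `U(gl(n))`, `n = N + 1`. -/
noncomputable def ePow {N : ℕ} (i : Fin N → ℕ) : Ugl (N + 1) :=
  (List.ofFn fun p : Fin N => uE p.succ p.castSucc ^ i p).prod

/-- The exponent vector of
`x^{(i)} = x_1^{i_1} x_2^{i_2 - i_1} ⋯ x_{n-1}^{i_{n-1} - i_{n-2}} x_n^{-i_{n-1}}`, `n = N + 1`. -/
def xExp {N : ℕ} (i : Fin N → ℕ) : Fin (N + 1) → ℤ :=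
  ∑ p : Fin N, (i p : ℤ) • (Pi.single p.castSucc 1 - Pi.single p.succ 1)

/-- The vector, with `n = m + 2` and `sigma = lam_{n-1} - lam_n`,
`u_lam = (x_1 ⋯ x_n)^mu ∑_i (-1)^{i_1 + ⋯ + i_{n-1}} ⟨mu⟩_{i_{n-1}} /
  (i_1! ⋯ i_{n-1}! ⟨sigma⟩_{i_{n-1}}) E^{ε(i)} v_lam x^{(i)}`,
where `⟨c⟩_k = c (c - 1) ⋯ (c - k + 1)`. The coefficient at the exponent `e` collects the indices
`i` with `x^{(i)} = x^e` (there is at most one). -/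
noncomputable def singularVector {m : ℕ} (lam : Fin (m + 2) → ℂ) (mu : ℂ) : Laurent lam mu :=
  fun e => ∑ᶠ (i : Fin (m + 1) → ℕ) (_ : xExp i = e),
    (((-1) ^ (∑ p, i p) * (descPochhammer ℂ (i (Fin.last m))).eval mu /
      ((∏ p, ((i p).factorial : ℂ)) * (descPochhammer ℂ (i (Fin.last m))).eval
        (lam (Fin.last m).castSucc - lam (Fin.last (m + 1)))) : ℂ)) •
      (ePow i • hwVector lam)

/-! ### The Etingof trace function -/

/-- For a linear map `Phi = ∑_e Phi_e x^{e + mu}` from `M_lam` to Laurent series, the contribution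
of the weight space of weight `nu` to the trace over `M_lam` of the `x^{e + mu}`-coefficient
`Phi_e z_1^{E_{1,1}} ⋯ z_n^{E_{n,n}}` of `Phi z_1^{E_{1,1}} ⋯ z_n^{E_{n,n}}`. -/
noncomputable def traceTerm {n : ℕ} {lam : Fin n → ℂ} {mu : ℂ}
    (Phi : Verma lam →ₗ[ℂ] Laurent lam mu) (z : Fin n → ℂ) (e : Fin n → ℤ) (nu : Fin n → ℂ) : ℂ :=
  blockTrace lam (coeff lam mu e ∘ₗ Phi ∘ₗ torusOp lam z) nu

/-- The Etingof trace function
`E(z_1, …, z_n) = (x_1 ⋯ x_n)^{-mu} tr_{M_lam} Phi z_1^{E_{1,1}} ⋯ z_n^{E_{n,n}}`, a Laurent series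
in `x_1, …, x_n`, given by its coefficients of `x^e`, `e ∈ ℤ^n`. -/
noncomputable def etingofTrace {n : ℕ} {lam : Fin n → ℂ} {mu : ℂ}
    (Phi : Verma lam →ₗ[ℂ] Laurent lam mu) (z : Fin n → ℂ) : (Fin n → ℤ) → ℂ :=
  fun e => ∑' nu : Fin n → ℂ, traceTerm Phi z e nu

/-! ### The path hypergeometric function of type A -/

/-- The pairs `(j, k)` with `1 ≤ k < j ≤ n`. -/
abbrev NegRoot (n : ℕ) : Type := {p : Fin n × Fin n // p.2 < p.1}

/-- `∑_{r < i} beta_{i,r}` -/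
def lowerSum {n : ℕ} (beta : NegRoot n → ℕ) (i : Fin n) : ℕ :=
  ∑ p : NegRoot n with p.1.1 = i, beta p

/-- `∑_{s > j} beta_{s,j}` -/
def upperSum {n : ℕ} (beta : NegRoot n → ℕ) (j : Fin n) : ℕ :=
  ∑ p : NegRoot n with p.1.2 = j, beta p

/-- The term of index `beta` of the series `X_A`, for `n = N + 1`; `(c)_k` is the rising factorial
`c (c + 1) ⋯ (c + k - 1)`. -/
noncomputable def pathTerm {N : ℕ} (tau : Fin (N + 1) → ℂ) (theta : ℂ)
    (x : NegRoot (N + 1) → ℂ) (beta : NegRoot (N + 1) → ℕ) : ℂ :=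
  (∏ s : Fin N, (ascPochhammer ℂ (upperSum beta s.castSucc)).eval
      (tau s.castSucc - lowerSum beta s.castSucc)) *
    (ascPochhammer ℂ (lowerSum beta (Fin.last N))).eval (tau (Fin.last N)) /
    ((∏ p, ((beta p).factorial : ℂ)) * (ascPochhammer ℂ (lowerSum beta (Fin.last N))).eval theta) *
    ∏ p, x p ^ beta p

/-- The path hypergeometric function `X_A(tau_1, …, tau_n; theta){x_{j,k}}` of type A. -/
noncomputable def pathX {N : ℕ} (tau : Fin (N + 1) → ℂ) (theta : ℂ)
    (x : NegRoot (N + 1) → ℂ) : ℂ :=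
  ∑' beta : NegRoot (N + 1) → ℕ, pathTerm tau theta x beta

/-- `xi_{j,k} = ∏_{s = k}^{j - 1} z_j / (z_j - z_s)`. -/
noncomputable def xi {n : ℕ} (z : Fin n → ℂ) (p : NegRoot n) : ℂ :=
  ∏ s ∈ Finset.Ico p.1.2 p.1.1, z p.1.1 / (z p.1.1 - z s)

end EtingofTrace

open EtingofTrace

/-!
Write `F_p = E_{p+1,p}` for the simple negative root vectors and `E^β` for the product of the
`E_{j,k} ^ β_{j,k}` over the negative roots, in a fixed order (`pbw`).

*Existence and uniqueness of the homomorphism.* The vector `u_λ` is killed by the positive root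
vectors and has weight `λ`; for the simple ones this is the recursion `singCoeff_recursion` of its
coefficients. The universal property of the Verma module (`exists_verma_lift`) gives
`exists_singular_hom`, and `hom_ext_hwVector` gives uniqueness, since `v_λ` generates `M_λ`.

*A basis of the Verma module.* The vectors `E^β v_λ` span because the monomials in the `F_p` do and
these can be straightened (`pbw_mul_simpleRoot`). For independence, `gl(n)` acts on the polynomial
functions on the lower unitriangular group by first order differential operators (`flagRep`). In
the dual module evaluation at the identity is a singular vector of weight `λ`, and `E^β` sends it to
a nonzero multiple of the `β`-th Taylor coefficient (`dualRep_listPbw`); these are independent. The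
traces over the weight spaces become sums of diagonal matrix coefficients in this basis
(`hasSum_traceTerm`), and a weight count kills the coefficients of `x^e` with `e ≠ 0`
(`traceTerm_eq_zero`).

*The diagonal coefficients.* Apply `E^β` to `u_λ = ∑_i c_i F^i v_λ x^{(i)}`. The action on monomials
commutes with the action on coefficients, so the result is a sum over the families `γ ≤ β` of
exponents which act on the monomials (`coeff_laurentRep_pbw`). The coefficient of `x^0` receives
`E^{β-γ} F^i v_λ` for one `i` only, and repeated right multiplication by the `F_p`
(`pbw_mul_ePow`) gives the coefficient of `E^β v_λ` in it: with `a_{j,k} = ∑_{k' ≤ k} γ_{j,k'}`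
(`cumSum`), the total contribution of `γ` is the coefficient of index `γ` of the path
hypergeometric series times `(-1) ^ ∑ a_y * ∏_y binom(β_y, a_y)` (`repr_diagonal`).

*Summation.* With `q_{j,k} = z_j / z_k` the sum over `β` of `binom(β_y, a_y) q_y ^ β_y` is
`q_y ^ a_y / (1 - q_y) ^ (a_y + 1)`. Since `-q_{j,k} / (1 - q_{j,k}) = z_j / (z_j - z_k)`, the product
over `y` of the powers with exponents `a_y` regroups to `∏ ξ ^ γ` (`prod_pow_cumSum`), while the
remaining factors `1 / (1 - q_y)` make up the prefactor (`prod_cpow_mul_prod_inv`). The interchange of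
the sums over `β` and `γ` is justified, for small `q`, by the exponential bound `exists_pathTerm_le`
on the coefficients of the path hypergeometric series.
-/

namespace EtingofTrace

/-! ### Universal property of the Verma module -/

theorem smul_hwVector_eq_mkQ {n : ℕ} (lam : Fin n → ℂ) (a : Ugl n) :
    a • hwVector lam = (vermaIdeal lam).mkQ a :=
  ((vermaIdeal lam).mkQ.map_smul a 1).symm.trans (by simp)

theorem exists_smul_hwVector {n : ℕ} (lam : Fin n → ℂ) (w : Verma lam) :
    ∃ a : Ugl n, w = a • hwVector lam := by
  obtain ⟨a, rfl⟩ := Submodule.mkQ_surjective (vermaIdeal lam) w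
  exact ⟨a, (smul_hwVector_eq_mkQ lam a).symm⟩

/-- A singular vector `v` of weight `lam` in a `U(gl(n))`-module receives the Verma module. The
module structure is given as an algebra homomorphism `θ` into the endomorphisms. -/
theorem exists_verma_lift {n : ℕ} (lam : Fin n → ℂ) {V : Type*} [AddCommGroup V] [Module ℂ V]
    (θ : Ugl n →ₐ[ℂ] Module.End ℂ V) (v : V) (h1 : ∀ i j : Fin n, i < j → θ (uE i j) v = 0)
    (h2 : ∀ i : Fin n, θ (uE i i) v = lam i • v) :
    ∃ g : Verma lam →ₗ[ℂ] V, ∀ a : Ugl n, g (a • hwVector lam) = θ a v := by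
  let g0 : Ugl n →ₗ[ℂ] V := (LinearMap.applyₗ v).comp θ.toLinearMap
  have hker : (vermaIdeal lam).restrictScalars ℂ ≤ LinearMap.ker g0 := by
    intro a ha
    rw [Submodule.restrictScalars_mem, vermaIdeal] at ha
    rw [LinearMap.mem_ker]
    change θ a v = 0
    induction ha using Submodule.span_induction with
    | mem x hx =>
      rcases hx with ⟨i, j, hij, rfl⟩ | ⟨i, rfl⟩
      · exact h1 i j hij
      · rw [map_sub, LinearMap.sub_apply, h2, AlgHom.commutes, Module.algebraMap_end_apply, sub_self]
    | zero => simp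
    | add x y _ _ hx hy => rw [map_add, LinearMap.add_apply, hx, hy, add_zero]
    | smul c x _ hx => rw [smul_eq_mul, map_mul, Module.End.mul_apply, hx, map_zero]
  refine ⟨Submodule.liftQ ((vermaIdeal lam).restrictScalars ℂ) g0 hker, fun a => ?_⟩
  rw [smul_hwVector_eq_mkQ]
  exact Submodule.liftQ_apply _ _ _

/-! ### A module of polynomial functions on the lower unitriangular group -/

section Triangular

variable {n : ℕ} {R : Type*} [CommRing R]

/-- The strictly lower triangular part of a matrix. -/
def strictLower (A : Matrix (Fin n) (Fin n) R) : Matrix (Fin n) (Fin n) R :=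
  Matrix.of fun i j => if j < i then A i j else 0

theorem strictLower_apply (A : Matrix (Fin n) (Fin n) R) (i j : Fin n) :
    strictLower A i j = if j < i then A i j else 0 := rfl

theorem strictLower_sub (A B : Matrix (Fin n) (Fin n) R) :
    strictLower (A - B) = strictLower A - strictLower B := by
  ext i j; simp only [strictLower_apply, Matrix.sub_apply]; split_ifs <;> simp

theorem strictLower_add (A B : Matrix (Fin n) (Fin n) R) :
    strictLower (A + B) = strictLower A + strictLower B := by
  ext i j; simp only [strictLower_apply, Matrix.add_apply]; split_ifs <;> simp

theorem strictLower_strictLower (A : Matrix (Fin n) (Fin n) R) :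
    strictLower (strictLower A) = strictLower A := by
  ext i j; simp only [strictLower_apply]; split_ifs <;> simp

theorem strictLower_mul (A B : Matrix (Fin n) (Fin n) R) :
    strictLower (strictLower A * strictLower B) = strictLower A * strictLower B := by
  ext i j
  simp only [strictLower_apply, Matrix.mul_apply]
  split_ifs with h
  · rfl
  · symm
    refine Finset.sum_eq_zero fun k _ => ?_
    split_ifs with h1 h2
    · exact absurd (h2.trans h1) h
    all_goals simp

theorem strictLower_mul_diag (A B : Matrix (Fin n) (Fin n) R) (i : Fin n) :
    (strictLower A * strictLower B) i i = 0 := by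
  rw [← strictLower_mul, strictLower_apply, if_neg (lt_irrefl i)]

theorem strictLower_upper_mul {A B : Matrix (Fin n) (Fin n) R} (hA : strictLower A = 0)
    (hB : strictLower B = 0) : strictLower (A * B) = 0 := by
  have hA' : ∀ i j, j < i → A i j = 0 := fun i j h => by
    have := congrFun (congrFun hA i) j
    rwa [strictLower_apply, if_pos h] at this
  have hB' : ∀ i j, j < i → B i j = 0 := fun i j h => by
    have := congrFun (congrFun hB i) j
    rwa [strictLower_apply, if_pos h] at this
  ext i j
  rw [strictLower_apply]
  split_ifs with h
  · rw [Matrix.mul_apply]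
    refine Finset.sum_eq_zero fun k _ => ?_
    rcases lt_or_ge k i with h1 | h1
    · rw [hA' i k h1, zero_mul]
    · rw [hB' k j (h.trans_le h1), mul_zero]
  · rfl

theorem upper_mul_diag {A B : Matrix (Fin n) (Fin n) R} (hA : strictLower A = 0)
    (hB : strictLower B = 0) (i : Fin n) : (A * B) i i = A i i * B i i := by
  have hA' : ∀ i j, j < i → A i j = 0 := fun i j h => by
    have := congrFun (congrFun hA i) j
    rwa [strictLower_apply, if_pos h] at this
  have hB' : ∀ i j, j < i → B i j = 0 := fun i j h => by
    have := congrFun (congrFun hB i) j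
    rwa [strictLower_apply, if_pos h] at this
  rw [Matrix.mul_apply, Finset.sum_eq_single i]
  · intro k _ hk
    rcases lt_or_gt_of_ne hk with h1 | h1
    · rw [hA' i k h1, zero_mul]
    · rw [hB' k i h1, mul_zero]
  · simp

/-- The strictly lower triangular part of a commutator, in terms of the parts of its entries: the
upper triangular parts do not contribute on their own. -/
theorem strictLower_commutator (A B : Matrix (Fin n) (Fin n) R) :
    strictLower (A * B - B * A) =
      strictLower (strictLower A * B - B * strictLower A)
        - strictLower (strictLower B * A - A * strictLower B)
        - (strictLower A * strictLower B - strictLower B * strictLower A) := by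
  have h : strictLower ((A - strictLower A) * (B - strictLower B)
      - (B - strictLower B) * (A - strictLower A)) = 0 := by
    rw [strictLower_sub, strictLower_upper_mul, strictLower_upper_mul, sub_zero] <;>
      rw [strictLower_sub, strictLower_strictLower, sub_self]
  have h2 : A * B - B * A = (strictLower A * B - B * strictLower A)
      - (strictLower B * A - A * strictLower B)
      - (strictLower A * strictLower B - strictLower B * strictLower A)
      + ((A - strictLower A) * (B - strictLower B)
      - (B - strictLower B) * (A - strictLower A)) := by noncomm_ring
  rw [h2, strictLower_add, h, add_zero, strictLower_sub, strictLower_sub,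
    strictLower_sub (strictLower A * strictLower B), strictLower_mul, strictLower_mul]

/-- The diagonal of a commutator: the upper triangular parts commute on the diagonal, and strictly lower
triangular parts multiply to strictly lower triangular matrices. -/
theorem commutator_diag (A B : Matrix (Fin n) (Fin n) R) (i : Fin n) :
    (A * B - B * A) i i =
      (strictLower A * B - B * strictLower A) i i
        - (strictLower B * A - A * strictLower B) i i := by
  have h : ((A - strictLower A) * (B - strictLower B)
      - (B - strictLower B) * (A - strictLower A)) i i = 0 := by
    rw [Matrix.sub_apply, upper_mul_diag, upper_mul_diag, mul_comm, sub_self] <;>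
      rw [strictLower_sub, strictLower_strictLower, sub_self]
  have h2 : A * B - B * A = (strictLower A * B - B * strictLower A)
      - (strictLower B * A - A * strictLower B)
      - (strictLower A * strictLower B - strictLower B * strictLower A)
      + ((A - strictLower A) * (B - strictLower B)
      - (B - strictLower B) * (A - strictLower A)) := by noncomm_ring
  rw [h2, Matrix.add_apply, h, add_zero, Matrix.sub_apply, Matrix.sub_apply,
    Matrix.sub_apply (strictLower A * strictLower B), strictLower_mul_diag, strictLower_mul_diag,
    sub_zero, sub_zero]

end Triangular

section Derivation

variable {n : ℕ} {R : Type*} [CommRing R] [Algebra ℂ R] (D : Derivation ℂ R R)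

theorem derivation_map_mul (A B : Matrix (Fin n) (Fin n) R) :
    (A * B).map D = A.map D * B + A * B.map D := by
  ext i j
  simp only [Matrix.map_apply, Matrix.mul_apply, Matrix.add_apply, map_sum, Derivation.leibniz,
    smul_eq_mul, Finset.sum_add_distrib]
  rw [add_comm]
  simp only [mul_comm]

end Derivation

/-- Polynomials in the entries `X (j, k)`, `k < j`, of a lower unitriangular matrix. -/
abbrev UniPoly (n : ℕ) : Type := MvPolynomial (NegRoot n) ℂ

/-- The generic lower unitriangular matrix. -/
noncomputable def uniMat (n : ℕ) : Matrix (Fin n) (Fin n) (UniPoly n) :=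
  Matrix.of fun i j => if h : j < i then MvPolynomial.X ⟨(i, j), h⟩ else if i = j then 1 else 0

section PolyRep

variable {n : ℕ}

theorem uniMat_root (x : NegRoot n) : uniMat n x.1.1 x.1.2 = MvPolynomial.X x := by
  simp [uniMat, x.2]

theorem uniMat_diag (i : Fin n) : uniMat n i i = 1 := by simp [uniMat]

theorem uniMat_upper {i j : Fin n} (h : i < j) : uniMat n i j = 0 := by
  simp [uniMat, h.not_gt, h.ne]

theorem det_uniMat : (uniMat n).det = 1 := by
  rw [Matrix.det_of_isLowerTriangular]
  · simp [uniMat_diag]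
  · intro i j h
    exact uniMat_upper h

theorem uniMat_mul_inv : uniMat n * (uniMat n)⁻¹ = 1 :=
  Matrix.mul_nonsing_inv _ (by rw [det_uniMat]; exact isUnit_one)

theorem uniMat_inv_mul : (uniMat n)⁻¹ * uniMat n = 1 :=
  Matrix.nonsing_inv_mul _ (by rw [det_uniMat]; exact isUnit_one)

theorem uniMat_inv_upper {i j : Fin n} (h : i < j) : (uniMat n)⁻¹ i j = 0 := by
  have : Invertible (uniMat n) := ⟨(uniMat n)⁻¹, uniMat_inv_mul, uniMat_mul_inv⟩
  have : Matrix.BlockTriangular (uniMat n) OrderDual.toDual := fun i j h => uniMat_upper h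
  exact Matrix.blockTriangular_inv_of_blockTriangular this h

/-- The matrix `N⁻¹ A N`, where `N` is the generic lower unitriangular matrix. -/
noncomputable def conjMat (A : gl n) : Matrix (Fin n) (Fin n) (UniPoly n) :=
  (uniMat n)⁻¹ * A.map MvPolynomial.C * uniMat n

theorem conjMat_add (A B : gl n) : conjMat (A + B) = conjMat A + conjMat B := by
  simp only [conjMat]
  rw [Matrix.map_add _ (map_add _), mul_add, add_mul]

theorem conjMat_smul (c : ℂ) (A : gl n) : conjMat (c • A) = c • conjMat A := by
  simp only [conjMat]
  have : (c • A).map MvPolynomial.C = c • A.map (MvPolynomial.C (σ := NegRoot n)) := by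
    ext i j; simp [MvPolynomial.smul_eq_C_mul]
  rw [this, Matrix.mul_smul, Matrix.smul_mul]

theorem conjMat_lie (A B : gl n) :
    conjMat ⁅A, B⁆ = conjMat A * conjMat B - conjMat B * conjMat A := by
  have h : ∀ A B : gl n, conjMat (A * B) = conjMat A * conjMat B := by
    intro A B
    simp only [conjMat]
    calc _ = (uniMat n)⁻¹ * A.map MvPolynomial.C * 1 * B.map MvPolynomial.C * uniMat n := by
            rw [Matrix.map_mul]; simp [mul_assoc]
      _ = _ := by rw [← uniMat_mul_inv]; simp only [mul_assoc]
  rw [LieRing.of_associative_ring_bracket, ← h, ← h, sub_eq_add_neg, conjMat_add,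
    ← neg_one_smul ℂ (B * A), conjMat_smul, neg_one_smul, ← sub_eq_add_neg]

/-- The vector field by which `A` acts infinitesimally on lower unitriangular matrices modulo
upper triangular ones: `N ↦ - N (N⁻¹ A N)_-`. -/
noncomputable def flagDer (A : gl n) : Derivation ℂ (UniPoly n) (UniPoly n) :=
  MvPolynomial.mkDerivation ℂ fun x => -(uniMat n * strictLower (conjMat A)) x.1.1 x.1.2

theorem flagDer_uniMat (A : gl n) :
    (uniMat n).map (flagDer A) = -(uniMat n * strictLower (conjMat A)) := by
  have hz : ∀ i j : Fin n, ¬ j < i → (uniMat n * strictLower (conjMat A)) i j = 0 := by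
    intro i j h
    rw [Matrix.mul_apply]
    refine Finset.sum_eq_zero fun k _ => ?_
    rcases lt_or_ge j k with h1 | h1
    · rw [uniMat_upper (lt_of_le_of_lt (not_lt.mp h) h1), zero_mul]
    · rw [strictLower_apply, if_neg h1.not_gt, mul_zero]
  ext1 i j
  rw [Matrix.map_apply, Matrix.neg_apply]
  rcases lt_trichotomy j i with h | h | h
  · have := uniMat_root ⟨(i, j), h⟩
    simp only at this
    rw [this, flagDer, MvPolynomial.mkDerivation_X]
  · subst h
    rw [uniMat_diag, hz j j (lt_irrefl _), Derivation.map_one_eq_zero, neg_zero]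
  · rw [uniMat_upper h, hz i j h.not_gt, map_zero, neg_zero]

theorem flagDer_conjMat (A B : gl n) :
    (conjMat B).map (flagDer A) =
      strictLower (conjMat A) * conjMat B - conjMat B * strictLower (conjMat A) := by
  have hinv : ((uniMat n)⁻¹).map (flagDer A) = strictLower (conjMat A) * (uniMat n)⁻¹ := by
    have h := derivation_map_mul (flagDer A) ((uniMat n)⁻¹) (uniMat n)
    rw [uniMat_inv_mul, flagDer_uniMat] at h
    have h1 : (1 : Matrix (Fin n) (Fin n) (UniPoly n)).map (flagDer A) = 0 := by
      ext1 i j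
      by_cases hij : i = j
      · subst hij; simp
      · simp [hij]
    rw [h1, mul_neg, ← mul_assoc, uniMat_inv_mul, one_mul, ← sub_eq_add_neg, eq_comm,
      sub_eq_zero] at h
    rw [← h, mul_assoc, uniMat_mul_inv, mul_one]
  have hC : (B.map (MvPolynomial.C (σ := NegRoot n))).map (flagDer A) = 0 := by
    ext1 i j
    simp only [Matrix.map_apply, Matrix.zero_apply]
    exact (flagDer A).map_algebraMap _
  conv_lhs => rw [conjMat]
  rw [derivation_map_mul, derivation_map_mul, hC, hinv, flagDer_uniMat]
  simp only [conjMat]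
  noncomm_ring

/-- It suffices to compare both derivations on the generic matrix, where the identity is
`strictLower_commutator`. -/
theorem flagDer_lie (A B : gl n) : flagDer ⁅A, B⁆ = ⁅flagDer A, flagDer B⁆ := by
  have hN : ∀ A B : gl n, ((uniMat n).map (flagDer B)).map (flagDer A) =
      uniMat n * strictLower (conjMat A) * strictLower (conjMat B) - uniMat n *
        strictLower (strictLower (conjMat A) * conjMat B - conjMat B * strictLower (conjMat A)) := by
    intro A B
    have h1 : (strictLower (conjMat B)).map (flagDer A) =
        strictLower ((conjMat B).map (flagDer A)) := by
      ext1 i j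
      simp only [Matrix.map_apply, strictLower_apply]
      split_ifs <;> simp
    have h2 : (-(uniMat n * strictLower (conjMat B))).map (flagDer A) =
        -((uniMat n * strictLower (conjMat B)).map (flagDer A)) := by
      ext1 i j; simp only [Matrix.map_apply, Matrix.neg_apply, map_neg]
    rw [flagDer_uniMat, h2, derivation_map_mul, h1, flagDer_uniMat, flagDer_conjMat]
    noncomm_ring
  have key : (uniMat n).map (flagDer ⁅A, B⁆) =
      ((uniMat n).map (flagDer B)).map (flagDer A)
        - ((uniMat n).map (flagDer A)).map (flagDer B) := by
    rw [flagDer_uniMat, conjMat_lie, strictLower_commutator, hN, hN]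
    noncomm_ring
  refine MvPolynomial.derivation_ext fun x => ?_
  have h := congrFun (congrFun key x.1.1) x.1.2
  simp only [Matrix.map_apply, Matrix.sub_apply, uniMat_root] at h
  rw [h, Derivation.commutator_apply]

/-- The multiplier through which the character `chi` of the diagonal matrices enters. -/
noncomputable def flagMult (chi : Fin n → ℂ) (A : gl n) : UniPoly n := ∑ i, chi i • conjMat A i i

theorem flagMult_lie (chi : Fin n → ℂ) (A B : gl n) :
    flagMult chi ⁅A, B⁆ = flagDer A (flagMult chi B) - flagDer B (flagMult chi A) := by
  have h : ∀ A B : gl n, flagDer A (flagMult chi B) = ∑ i, chi i •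
      (strictLower (conjMat A) * conjMat B - conjMat B * strictLower (conjMat A)) i i := by
    intro A B
    rw [flagMult, map_sum, ← flagDer_conjMat]
    simp only [Derivation.map_smul, Matrix.map_apply]
  rw [h, h, flagMult, conjMat_lie, ← Finset.sum_sub_distrib]
  refine Finset.sum_congr rfl fun i _ => ?_
  rw [commutator_diag, smul_sub]

theorem flagDer_add (A B : gl n) : flagDer (A + B) = flagDer A + flagDer B := by
  refine MvPolynomial.derivation_ext fun x => ?_
  rw [Derivation.add_apply, ← uniMat_root]
  have h := fun A => congrFun (congrFun (flagDer_uniMat (n := n) A) x.1.1) x.1.2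
  simp only [Matrix.map_apply] at h
  rw [h, h, h, conjMat_add, strictLower_add, mul_add, neg_add, Matrix.add_apply]

theorem flagDer_smul (c : ℂ) (A : gl n) : flagDer (c • A) = c • flagDer A := by
  refine MvPolynomial.derivation_ext fun x => ?_
  rw [Derivation.smul_apply, ← uniMat_root]
  have h := fun A => congrFun (congrFun (flagDer_uniMat (n := n) A) x.1.1) x.1.2
  simp only [Matrix.map_apply] at h
  have hs : strictLower (c • conjMat A) = c • strictLower (conjMat A) := by
    ext1 i j; simp only [strictLower_apply, Matrix.smul_apply]; split_ifs <;> simp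
  rw [h, h, conjMat_smul, hs, Matrix.mul_smul, ← smul_neg, Matrix.smul_apply]

/-- The representation of `gl(n)` on polynomial functions of a lower unitriangular matrix, viewed
as sections of the line bundle with character `chi` over the big cell of the flag variety. -/
noncomputable def flagRep (chi : Fin n → ℂ) : gl n →ₗ⁅ℂ⁆ Module.End ℂ (UniPoly n) where
  toFun A := (flagDer A : UniPoly n →ₗ[ℂ] UniPoly n) + LinearMap.mulLeft ℂ (flagMult chi A)
  map_add' A B := by
    have : flagMult chi (A + B) = flagMult chi A + flagMult chi B := by
      simp only [flagMult, conjMat_add, Matrix.add_apply, smul_add, Finset.sum_add_distrib]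
    refine LinearMap.ext fun f => ?_
    simp only [LinearMap.add_apply, Derivation.coeFn_coe, LinearMap.mulLeft_apply, this,
      flagDer_add, Derivation.add_apply]
    ring
  map_smul' c A := by
    have : flagMult chi (c • A) = c • flagMult chi A := by
      simp only [flagMult, conjMat_smul, Matrix.smul_apply, Finset.smul_sum, smul_comm c]
    refine LinearMap.ext fun f => ?_
    simp only [LinearMap.add_apply, Derivation.coeFn_coe, LinearMap.mulLeft_apply, this,
      flagDer_smul, Derivation.smul_apply, LinearMap.smul_apply, RingHom.id_apply, smul_add,
      smul_mul_assoc]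
  map_lie' := by
    intro A B
    refine LinearMap.ext fun f => ?_
    change flagDer ⁅A, B⁆ f + flagMult chi ⁅A, B⁆ * f =
      (flagDer A (flagDer B f + flagMult chi B * f)
        + flagMult chi A * (flagDer B f + flagMult chi B * f))
      - (flagDer B (flagDer A f + flagMult chi A * f)
        + flagMult chi B * (flagDer A f + flagMult chi A * f))
    simp only [flagMult_lie, flagDer_lie, Derivation.commutator_apply, map_add,
      Derivation.leibniz, smul_eq_mul]
    ring

theorem flagRep_apply (chi : Fin n → ℂ) (A : gl n) (f : UniPoly n) :
    flagRep chi A f = flagDer A f + flagMult chi A * f := rfl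

theorem flagDer_eq_sum (A : gl n) (f : UniPoly n) :
    flagDer A f = ∑ x : NegRoot n, flagDer A (MvPolynomial.X x) * MvPolynomial.pderiv x f := by
  have hsum : ∀ (F : NegRoot n → Derivation ℂ (UniPoly n) (UniPoly n)) (g : UniPoly n),
      (∑ x, F x) g = ∑ x, F x g := fun F g => by
    rw [← Derivation.coeFnAddMonoidHom_apply, map_sum, Finset.sum_apply]
    rfl
  have h : flagDer A = ∑ x : NegRoot n, flagDer A (MvPolynomial.X x) •
      (MvPolynomial.pderiv x : Derivation ℂ (UniPoly n) (UniPoly n)) := by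
    refine MvPolynomial.derivation_ext fun y => ?_
    rw [hsum, Finset.sum_eq_single y]
    · simp
    · intro b _ hb
      simp [MvPolynomial.pderiv_X_of_ne hb.symm]
    · simp
  conv_lhs => rw [h]
  rw [hsum]
  simp

theorem uniMat_eval_zero :
    (uniMat n).map (MvPolynomial.eval (0 : NegRoot n → ℂ)) = 1 := by
  ext i j
  rw [Matrix.map_apply]
  rcases lt_trichotomy j i with h | h | h
  · have := uniMat_root ⟨(i, j), h⟩
    simp only at this
    rw [this]
    simp [h.ne']
  · subst h; simp [uniMat_diag]
  · simp [uniMat_upper h, h.ne]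

theorem conjMat_eval_zero (A : gl n) :
    (conjMat A).map (MvPolynomial.eval (0 : NegRoot n → ℂ)) = A := by
  have h1 : ((uniMat n)⁻¹).map (MvPolynomial.eval (0 : NegRoot n → ℂ)) = 1 := by
    have := congrArg (fun M => M.map (MvPolynomial.eval (0 : NegRoot n → ℂ)))
      (uniMat_inv_mul (n := n))
    simp only [Matrix.map_mul, uniMat_eval_zero, mul_one] at this
    rw [this]
    simp
  rw [conjMat, Matrix.map_mul, Matrix.map_mul, h1, uniMat_eval_zero, one_mul, mul_one]
  ext i j
  simp

/-- At the identity matrix an upper triangular matrix acts through its diagonal only. -/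
theorem flagRep_eval_zero (chi : Fin n → ℂ) {i j : Fin n} (hij : i ≤ j) (f : UniPoly n) :
    MvPolynomial.eval 0 (flagRep chi (E i j) f) =
      (if i = j then chi i else 0) * MvPolynomial.eval 0 f := by
  have hz : ∀ a b, MvPolynomial.eval 0 (conjMat (E i j) a b) = E i j a b := fun a b =>
    congrFun (congrFun (conjMat_eval_zero (E i j)) a) b
  have h1 : MvPolynomial.eval 0 (flagDer (E i j) f) = 0 := by
    rw [flagDer_eq_sum, map_sum]
    refine Finset.sum_eq_zero fun x _ => ?_
    have hs : (strictLower (conjMat (E i j))).map (MvPolynomial.eval (0 : NegRoot n → ℂ)) = 0 := by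
      ext a b
      rw [Matrix.map_apply, strictLower_apply]
      split_ifs with h
      · rw [hz, E, Matrix.single_apply, if_neg, Matrix.zero_apply]
        rintro ⟨rfl, rfl⟩
        exact absurd hij h.not_ge
      · simp
    have := congrFun (congrFun (congrArg
      (fun M => M.map (MvPolynomial.eval (0 : NegRoot n → ℂ))) (flagDer_uniMat (E i j))) x.1.1) x.1.2
    simp only [Matrix.map_apply, uniMat_root] at this
    rw [map_mul, this, Matrix.neg_apply, map_neg, ← Matrix.map_apply (f := MvPolynomial.eval _),
      Matrix.map_mul, hs]
    simp
  rw [flagRep_apply, map_add, h1, zero_add, map_mul, flagMult, map_sum]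
  congr 1
  simp only [MvPolynomial.smul_eval, hz]
  simp only [E, Matrix.single_apply]
  by_cases h : i = j
  · subst h; simp
  · rw [if_neg h]
    refine Finset.sum_eq_zero fun k _ => ?_
    rw [if_neg, mul_zero]
    rintro ⟨rfl, rfl⟩
    exact h rfl

/-- A lowering operator acts by the vector field of left translations, without multiplier. -/
theorem flagRep_lower (chi : Fin n → ℂ) (x : NegRoot n) (f : UniPoly n) :
    flagRep chi (E x.1.1 x.1.2) f = -∑ y : NegRoot n,
      (if y.1.1 = x.1.1 then uniMat n x.1.2 y.1.2 else 0) * MvPolynomial.pderiv y f := by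
  obtain ⟨⟨j, k⟩, hx⟩ := x
  simp only at hx ⊢
  have hE : ∀ a b, ((E j k).map (MvPolynomial.C (σ := NegRoot n)) * uniMat n) a b =
      if a = j then uniMat n k b else 0 := by
    intro a b
    rw [Matrix.mul_apply]
    simp only [E, Matrix.map_apply, Matrix.single_apply]
    by_cases h : a = j
    · subst h
      rw [Finset.sum_eq_single k]
      · simp
      · intro c _ hc; simp [hc.symm]
      · simp
    · simp [h, Ne.symm h]
  have hlow : ∀ a b, ¬ b < a → conjMat (E j k) a b = 0 := by
    intro a b h
    rw [conjMat, mul_assoc, Matrix.mul_apply]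
    refine Finset.sum_eq_zero fun c _ => ?_
    rw [hE]
    split_ifs with hc
    · subst hc
      rcases lt_or_ge a c with h1 | h1
      · rw [uniMat_inv_upper h1, zero_mul]
      · rw [uniMat_upper (lt_of_lt_of_le hx (h1.trans (not_lt.mp h))), mul_zero]
    · rw [mul_zero]
  have hsl : strictLower (conjMat (E j k)) = conjMat (E j k) := by
    ext1 a b
    rw [strictLower_apply]
    split_ifs with h
    · rfl
    · rw [hlow a b h]
  have hmult : flagMult chi (E j k) = 0 := by
    rw [flagMult]
    refine Finset.sum_eq_zero fun i _ => ?_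
    rw [hlow i i (lt_irrefl i), smul_zero]
  rw [flagRep_apply, hmult, zero_mul, add_zero, flagDer_eq_sum, ← Finset.sum_neg_distrib]
  refine Finset.sum_congr rfl fun y _ => ?_
  have := congrFun (congrFun (flagDer_uniMat (E j k)) y.1.1) y.1.2
  rw [Matrix.map_apply, uniMat_root, hsl, conjMat, mul_assoc, ← mul_assoc, uniMat_mul_inv, one_mul,
    Matrix.neg_apply, hE] at this
  rw [this, neg_mul]

end PolyRep

/-! ### Poincaré–Birkhoff–Witt monomials -/

section Roots

variable {n : ℕ}

/-- The order of the factors in a PBW monomial: rows increase, and inside a row columns decrease.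
Inside a row the factors commute; the decreasing order makes the root `(j, k)`, which arises when
`E_{k+1,k}` is moved past `E_{j,k+1}`, come after `(j, k+1)`. -/
def RootLE (x y : NegRoot n) : Prop := x.1.1 < y.1.1 ∨ (x.1.1 = y.1.1 ∧ y.1.2 ≤ x.1.2)

theorem RootLE.row_le {x y : NegRoot n} (h : RootLE x y) : x.1.1 ≤ y.1.1 := by
  rcases h with h | h
  · exact h.le
  · exact h.1.le

theorem RootLE.antisymm {x y : NegRoot n} (h : RootLE x y) (h' : RootLE y x) : x = y := by
  obtain ⟨⟨a, b⟩, hx⟩ := x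
  obtain ⟨⟨c, d⟩, hy⟩ := y
  simp only [RootLE, Fin.lt_def, Fin.le_def, Fin.ext_iff, Subtype.mk.injEq, Prod.mk.injEq] at *
  omega

instance : Std.Total (RootLE (n := n)) := ⟨fun x y => by
  simp only [RootLE, Fin.lt_def, Fin.le_def, Fin.ext_iff]; omega⟩

instance : IsTrans (NegRoot n) RootLE := ⟨fun x y z => by
  simp only [RootLE, Fin.lt_def, Fin.le_def, Fin.ext_iff]; omega⟩

open Classical in
/-- All negative roots, in the order `RootLE`. -/
noncomputable def rootList (n : ℕ) : List (NegRoot n) :=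
  (Finset.univ : Finset (NegRoot n)).toList.insertionSort RootLE

/-- A list of negative roots that is a final segment of `rootList`. -/
structure IsFinalSegment (l : List (NegRoot n)) : Prop where
  nodup : l.Nodup
  sorted : l.Pairwise RootLE
  upper : ∀ x ∈ l, ∀ y, RootLE x y → y ∈ l

theorem mem_rootList (x : NegRoot n) : x ∈ rootList n := by
  classical
  rw [rootList, List.mem_insertionSort]
  simp

theorem isFinalSegment_rootList : IsFinalSegment (rootList n) where
  nodup := by
    classical
    exact (List.perm_insertionSort RootLE _).nodup_iff.mpr (Finset.nodup_toList _)
  sorted := by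
    classical
    exact List.pairwise_insertionSort RootLE _
  upper _ _ y _ := mem_rootList y

theorem IsFinalSegment.notMem {a : NegRoot n} {l : List (NegRoot n)}
    (h : IsFinalSegment (a :: l)) : a ∉ l := (List.nodup_cons.mp h.nodup).1

theorem IsFinalSegment.le {a : NegRoot n} {l : List (NegRoot n)}
    (h : IsFinalSegment (a :: l)) : ∀ b ∈ l, RootLE a b := (List.pairwise_cons.mp h.sorted).1

theorem IsFinalSegment.tail {a : NegRoot n} {l : List (NegRoot n)}
    (h : IsFinalSegment (a :: l)) : IsFinalSegment l where
  nodup := (List.nodup_cons.mp h.nodup).2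
  sorted := (List.pairwise_cons.mp h.sorted).2
  upper x hx y hxy := by
    rcases List.mem_cons.mp (h.upper x (List.mem_cons_of_mem _ hx) y hxy) with rfl | h1
    · exact absurd ((h.le x hx).antisymm hxy ▸ hx) h.notMem
    · exact h1

end Roots

section Pbw

variable {n : ℕ}

theorem uE_mul_uE (i j k l : Fin n) :
    uE i j * uE k l =
      uE k l * uE i j + ((if j = k then uE i l else 0) - (if l = i then uE k j else 0)) := by
  have h : UniversalEnvelopingAlgebra.ι ℂ ⁅E i j, E k l⁆ = uE i j * uE k l - uE k l * uE i j := by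
    rw [LieHom.map_lie, LieRing.of_associative_ring_bracket]
    rfl
  rw [E_lie_E, map_sub, apply_ite (UniversalEnvelopingAlgebra.ι ℂ),
    apply_ite (UniversalEnvelopingAlgebra.ι ℂ), map_zero] at h
  exact (sub_eq_iff_eq_add'.mp h.symm)

theorem commute_uE {i j k l : Fin n} (h1 : j ≠ k) (h2 : l ≠ i) : Commute (uE i j) (uE k l) := by
  have := uE_mul_uE i j k l
  rwa [if_neg h1, if_neg h2, sub_zero, add_zero] at this

/-- The root vector `E_{j,k}` of a negative root `(j, k)`, in `U(gl(n))`. -/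
noncomputable def rootVec (x : NegRoot n) : Ugl n := uE x.1.1 x.1.2

/-- The ordered product of the powers `E_x ^ β x` over the list `l`. -/
noncomputable def listPbw (l : List (NegRoot n)) (β : NegRoot n → ℕ) : Ugl n :=
  (l.map fun x => rootVec x ^ β x).prod

/-- The PBW monomial with exponents `β`. -/
noncomputable def pbw (β : NegRoot n → ℕ) : Ugl n := listPbw (rootList n) β

theorem listPbw_cons (a : NegRoot n) (l : List (NegRoot n)) (β : NegRoot n → ℕ) :
    listPbw (a :: l) β = rootVec a ^ β a * listPbw l β := by simp [listPbw]

theorem listPbw_congr {l : List (NegRoot n)} {β γ : NegRoot n → ℕ} (h : ∀ x ∈ l, β x = γ x) :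
    listPbw l β = listPbw l γ := by
  rw [listPbw, listPbw]
  congr 1
  exact List.map_congr_left fun x hx => by rw [h x hx]

theorem pbw_zero : pbw (0 : NegRoot n → ℕ) = 1 := by
  rw [pbw, listPbw]
  exact List.prod_eq_one fun x hx => by
    obtain ⟨y, _, rfl⟩ := List.mem_map.mp hx
    simp

theorem commute_rootVec_row {x y : NegRoot n} (h : x.1.1 = y.1.1) :
    Commute (rootVec x) (rootVec y) :=
  commute_uE (h ▸ x.2).ne (h ▸ y.2 : y.1.2 < x.1.1).ne

/-- A root vector multiplying from the left is absorbed if all roots of the list have at least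
its row. -/
theorem rootVec_mul_listPbw {l : List (NegRoot n)} (hl : IsFinalSegment l) (δ : NegRoot n → ℕ)
    {x : NegRoot n} (hx : x ∈ l) (hrow : ∀ y ∈ l, x.1.1 ≤ y.1.1) :
    rootVec x * listPbw l δ = listPbw l (δ + Pi.single x 1) := by
  induction l with
  | nil => simp at hx
  | cons a l ih =>
    rw [listPbw_cons, listPbw_cons]
    by_cases h : x = a
    · subst h
      rw [← mul_assoc, ← pow_succ']
      congr 1
      · simp
      · refine listPbw_congr fun y hy => ?_
        rw [Pi.add_apply, Pi.single_eq_of_ne, add_zero]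
        rintro rfl
        exact hl.notMem hy
    · have hxl : x ∈ l := (List.mem_cons.mp hx).resolve_left h
      have hc : Commute (rootVec x) (rootVec a) :=
        commute_rootVec_row (le_antisymm (hrow a List.mem_cons_self) (hl.le x hxl).row_le)
      rw [← mul_assoc, (hc.pow_right _).eq, mul_assoc,
        ih hl.tail hxl fun y hy => hrow y (List.mem_cons_of_mem _ hy)]
      simp [Ne.symm h]

/-- The root `(j, k - 1)` for `(j, k)` (with `(j, 0)` sent to itself). -/
def leftRoot (x : NegRoot n) : NegRoot n :=
  ⟨(x.1.1, ⟨(x.1.2 : ℕ) - 1, by omega⟩), by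
    have := x.2
    simp only [Fin.lt_def] at this ⊢
    omega⟩

theorem leftRoot_rootLE (x : NegRoot n) : RootLE x (leftRoot x) :=
  Or.inr ⟨rfl, by simp [leftRoot, Fin.le_def]⟩

/-- If the commutator `b` of `e` and `f` commutes with `e`, it acts like a derivative on the powers of
`e`. -/
theorem pow_mul_comm_of_commutator {A : Type*} [Ring A] {e f b : A} (h : e * f = f * e + b)
    (hb : Commute b e) (c : ℕ) : e ^ c * f = f * e ^ c + c • (e ^ (c - 1) * b) := by
  induction c with
  | zero => simp
  | succ c ih =>
    rw [pow_succ, mul_assoc, h, mul_add, ← mul_assoc, ih, add_mul, Nat.add_sub_cancel, succ_nsmul,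
      smul_mul_assoc, mul_assoc (e ^ (c - 1)), hb.eq, ← mul_assoc (e ^ (c - 1)), mul_assoc f]
    rcases c with _ | c
    · simp
    · rw [Nat.add_sub_cancel, add_assoc, pow_succ e c]

end Pbw

section RightMul

variable {N : ℕ}

/-- The simple negative root `(p + 1, p)`. -/
def simpleRoot (p : Fin N) : NegRoot (N + 1) := ⟨(p.succ, p.castSucc), Fin.castSucc_lt_succ⟩

theorem leftRoot_eq {q : Fin N} {x : NegRoot (N + 1)} (hx : x.1.2 = q.succ) :
    (leftRoot x).1 = (x.1.1, q.castSucc) := by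
  simp only [leftRoot, hx]
  ext <;> simp

theorem leftRoot_ne {q : Fin N} {x : NegRoot (N + 1)} (hx : x.1.2 = q.succ) : leftRoot x ≠ x := by
  intro h
  have := congrArg (fun y : NegRoot (N + 1) => (y.1.2 : ℕ)) h
  rw [leftRoot_eq hx] at this
  simp [hx] at this

/-- Moving `E_{q+1,q}` from the right end to the left end of a product over roots in rows at least
`q + 1`. It commutes with `E_{j,k}` unless `k = q + 1`, when the commutator is `E_{j,q}`, the root
vector of `leftRoot (j, q + 1)`. -/
theorem listPbw_mul_simpleRoot {l : List (NegRoot (N + 1))} (hl : IsFinalSegment l) (q : Fin N)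
    (hrow : ∀ y ∈ l, q.succ ≤ y.1.1) (δ : NegRoot (N + 1) → ℕ) :
    listPbw l δ * rootVec (simpleRoot q) = rootVec (simpleRoot q) * listPbw l δ +
      (l.map fun y => if y.1.2 = q.succ then
        δ y • listPbw l (δ + Pi.single (leftRoot y) 1 - Pi.single y 1) else 0).sum := by
  induction l with
  | nil => simp [listPbw]
  | cons a l ih =>
    have hrl : ∀ y ∈ l, q.succ ≤ y.1.1 := fun y hy => hrow y (List.mem_cons_of_mem _ hy)
    have hsum : (l.map fun y => if y.1.2 = q.succ then
        δ y • listPbw (a :: l) (δ + Pi.single (leftRoot y) 1 - Pi.single y 1) else 0).sum =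
        rootVec a ^ δ a * (l.map fun y => if y.1.2 = q.succ then
          δ y • listPbw l (δ + Pi.single (leftRoot y) 1 - Pi.single y 1) else 0).sum := by
      rw [← List.sum_map_mul_left]
      congr 1
      refine List.map_congr_left fun y hy => ?_
      split_ifs with h
      · have h1 : y ≠ a := by rintro rfl; exact hl.notMem hy
        have h2 : leftRoot y ≠ a := by
          rintro rfl
          exact hl.notMem (hl.tail.upper y hy _ (leftRoot_rootLE y))
        rw [listPbw_cons, mul_smul_comm]
        simp [h1.symm, h2.symm]
      · rw [mul_zero]
    rw [List.map_cons, List.sum_cons, hsum, listPbw_cons, mul_assoc, ih hl.tail hrl, mul_add,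
      ← mul_assoc, ← mul_assoc, ← add_assoc]
    congr 1
    by_cases ha : a.1.2 = q.succ
    · have hlt : q.succ < a.1.1 := ha ▸ a.2
      have hmem : leftRoot a ∈ l := by
        have := hl.upper a List.mem_cons_self _ (leftRoot_rootLE a)
        exact (List.mem_cons.mp this).resolve_left (leftRoot_ne ha)
      have hb : rootVec a * rootVec (simpleRoot q) =
          rootVec (simpleRoot q) * rootVec a + rootVec (leftRoot a) := by
        have := uE_mul_uE a.1.1 a.1.2 q.succ q.castSucc
        rw [if_pos ha, if_neg (Fin.castSucc_lt_succ.trans hlt).ne, sub_zero] at this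
        rw [rootVec, rootVec, rootVec, leftRoot_eq ha]
        exact this
      rw [pow_mul_comm_of_commutator hb (commute_rootVec_row rfl), add_mul, if_pos ha]
      congr 1
      have hval : (δ + Pi.single (leftRoot a) 1 - Pi.single a 1 : NegRoot (N + 1) → ℕ) a = δ a - 1 := by
        simp [(leftRoot_ne ha).symm]
      rw [listPbw_cons, smul_mul_assoc, mul_assoc,
        rootVec_mul_listPbw hl.tail δ hmem fun y hy => (hl.le y hy).row_le, hval]
      congr 2
      refine listPbw_congr fun y hy => ?_
      have : y ≠ a := by rintro rfl; exact hl.notMem hy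
      simp [this]
    · rw [if_neg ha, add_zero]
      have hlt : q.succ ≤ a.1.1 := hrow a List.mem_cons_self
      have hc : Commute (rootVec a) (rootVec (simpleRoot q)) :=
        commute_uE ha (Fin.castSucc_lt_succ.trans_le hlt).ne
      rw [(hc.pow_left _).eq]

/-- The factors in rows before `q + 1` stay in front of `E_{q+1,q}`; at the beginning of the row `q + 1`
it is absorbed by `rootVec_mul_listPbw`. -/
theorem listPbw_mul_simpleRoot' {l : List (NegRoot (N + 1))} (hl : IsFinalSegment l) (q : Fin N)
    (hq : simpleRoot q ∈ l) (δ : NegRoot (N + 1) → ℕ) :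
    listPbw l δ * rootVec (simpleRoot q) = listPbw l (δ + Pi.single (simpleRoot q) 1) +
      (l.map fun y => if y.1.2 = q.succ then
        δ y • listPbw l (δ + Pi.single (leftRoot y) 1 - Pi.single y 1) else 0).sum := by
  induction l with
  | nil => simp at hq
  | cons a l ih =>
    rcases lt_or_ge a.1.1 q.succ with ha | ha
    · have hql : simpleRoot q ∈ l := by
        refine (List.mem_cons.mp hq).resolve_left ?_
        rintro rfl
        exact lt_irrefl _ ha
      have hsum : (l.map fun y => if y.1.2 = q.succ then
          δ y • listPbw (a :: l) (δ + Pi.single (leftRoot y) 1 - Pi.single y 1) else 0).sum =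
          rootVec a ^ δ a * (l.map fun y => if y.1.2 = q.succ then
            δ y • listPbw l (δ + Pi.single (leftRoot y) 1 - Pi.single y 1) else 0).sum := by
        rw [← List.sum_map_mul_left]
        congr 1
        refine List.map_congr_left fun y hy => ?_
        split_ifs with h
        · have h1 : y ≠ a := by rintro rfl; exact hl.notMem hy
          have h2 : leftRoot y ≠ a := by
            rintro rfl
            exact hl.notMem (hl.tail.upper y hy _ (leftRoot_rootLE y))
          rw [listPbw_cons, mul_smul_comm]
          simp [h1.symm, h2.symm]
        · rw [mul_zero]
      have hane : a.1.2 ≠ q.succ := (a.2.trans ha).ne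
      have hsa : simpleRoot q ≠ a := by rintro rfl; exact hl.notMem hql
      rw [List.map_cons, List.sum_cons, if_neg hane, zero_add, hsum, listPbw_cons, mul_assoc,
        ih hl.tail hql, mul_add, listPbw_cons]
      simp [hsa.symm]
    · have hrow : ∀ y ∈ a :: l, q.succ ≤ y.1.1 := by
        intro y hy
        rcases List.mem_cons.mp hy with rfl | h
        · exact ha
        · exact ha.trans (hl.le y h).row_le
      rw [listPbw_mul_simpleRoot hl q hrow, rootVec_mul_listPbw hl δ hq hrow]

/-- Right multiplication of a PBW monomial by a simple root vector. -/
theorem pbw_mul_simpleRoot (δ : NegRoot (N + 1) → ℕ) (q : Fin N) :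
    pbw δ * rootVec (simpleRoot q) = pbw (δ + Pi.single (simpleRoot q) 1) +
      ∑ y : NegRoot (N + 1) with y.1.2 = q.succ,
        δ y • pbw (δ + Pi.single (leftRoot y) 1 - Pi.single y 1) := by
  classical
  rw [pbw, listPbw_mul_simpleRoot' isFinalSegment_rootList q (mem_rootList _)]
  congr 1
  have huniv : (Finset.univ : Finset (NegRoot (N + 1))) = (rootList (N + 1)).toFinset := by
    ext x; simp [mem_rootList]
  rw [Finset.sum_filter, huniv, List.sum_toFinset _ isFinalSegment_rootList.nodup]
  rfl

end RightMul

/-! ### The PBW basis of a Verma module -/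

section Independence

variable {n : ℕ}

/-- The action of `U(gl(n))` on linear functionals on `UniPoly n`, contragredient to `flagRep`. -/
noncomputable def dualRep (chi : Fin n → ℂ) :
    Ugl n →ₐ[ℂ] Module.End ℂ (UniPoly n →ₗ[ℂ] ℂ) :=
  UniversalEnvelopingAlgebra.lift ℂ
    { toFun := fun A => -LinearMap.lcomp ℂ ℂ (flagRep chi A)
      map_add' := fun A B => by
        refine LinearMap.ext fun φ => LinearMap.ext fun f => ?_
        simp; ring
      map_smul' := fun c A => by
        refine LinearMap.ext fun φ => LinearMap.ext fun f => ?_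
        simp
      map_lie' := fun {A B} => by
        refine LinearMap.ext fun φ => LinearMap.ext fun f => ?_
        change -φ (flagRep chi ⁅A, B⁆ f) =
          -(-φ (flagRep chi B (flagRep chi A f))) - -(-φ (flagRep chi A (flagRep chi B f)))
        rw [LieHom.map_lie]
        change -φ (flagRep chi A (flagRep chi B f) - flagRep chi B (flagRep chi A f)) = _
        rw [map_sub]
        ring }

theorem dualRep_uE (chi : Fin n → ℂ) (i j : Fin n) (φ : UniPoly n →ₗ[ℂ] ℂ) (f : UniPoly n) :
    dualRep chi (uE i j) φ f = -φ (flagRep chi (E i j) f) := by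
  rw [dualRep, uE, UniversalEnvelopingAlgebra.lift_ι_apply]
  rfl

/-- The iterated derivative at the identity, `f ↦ β! · coeff_β f`. -/
noncomputable def taylorCoeff (β : NegRoot n → ℕ) : UniPoly n →ₗ[ℂ] ℂ :=
  (∏ x, ((β x).factorial : ℂ)) • MvPolynomial.lcoeff ℂ (Finsupp.equivFunOnFinite.symm β)

theorem taylorCoeff_apply (β : NegRoot n → ℕ) (f : UniPoly n) :
    taylorCoeff β f = (∏ x, ((β x).factorial : ℂ)) *
      MvPolynomial.coeff (Finsupp.equivFunOnFinite.symm β) f := rfl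

/-- A root vector raises the Taylor coefficient `β`, provided `β` vanishes in the rows above: the vector
field of left translations by `E_{j,k}` is `∂_{j,k}` plus terms `X_{k,l} ∂_{j,l}`, which do
not contribute because `β` vanishes in the row `k < j`. -/
theorem dualRep_rootVec (chi : Fin n → ℂ) (x : NegRoot n) (β : NegRoot n → ℕ)
    (hβ : ∀ y : NegRoot n, y.1.1 < x.1.1 → β y = 0) :
    dualRep chi (rootVec x) (taylorCoeff β) = taylorCoeff (β + Pi.single x 1) := by
  classical
  refine LinearMap.ext fun f => ?_
  rw [rootVec, dualRep_uE, flagRep_lower, map_neg, neg_neg, map_sum, Finset.sum_eq_single x]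
  · rw [if_pos rfl, uniMat_diag, one_mul, taylorCoeff_apply, taylorCoeff_apply,
      MvPolynomial.coeff_pderiv]
    have h1 : Finsupp.equivFunOnFinite.symm (β + Pi.single x 1) =
        Finsupp.equivFunOnFinite.symm β + Finsupp.single x 1 := by
      ext y
      simp [Finsupp.single_apply, Pi.single_apply, eq_comm]
    have h2 : (∏ y, (((β + Pi.single x 1 : NegRoot n → ℕ) y).factorial : ℂ)) =
        (∏ y, ((β y).factorial : ℂ)) * (β x + 1) := by
      rw [← Finset.mul_prod_erase Finset.univ _ (Finset.mem_univ x),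
        ← Finset.mul_prod_erase Finset.univ (fun y => ((β y).factorial : ℂ)) (Finset.mem_univ x)]
      have : ∏ y ∈ Finset.univ.erase x, (((β + Pi.single x 1 : NegRoot n → ℕ) y).factorial : ℂ) =
          ∏ y ∈ Finset.univ.erase x, ((β y).factorial : ℂ) := by
        refine Finset.prod_congr rfl fun y hy => ?_
        simp [Finset.ne_of_mem_erase hy]
      rw [this]
      simp only [Pi.add_apply, Pi.single_eq_same, Nat.factorial_succ]
      push_cast
      ring
    rw [h1, h2]
    simp only [Finsupp.equivFunOnFinite_symm_apply_apply]
    ring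
  · intro y _ hy
    split_ifs with hr
    · rcases lt_trichotomy y.1.2 x.1.2 with h | h | h
      · have := uniMat_root ⟨(x.1.2, y.1.2), h⟩
        simp only at this
        rw [this, taylorCoeff_apply, MvPolynomial.coeff_X_mul', if_neg, mul_zero]
        simp [hβ ⟨(x.1.2, y.1.2), h⟩ x.2]
      · exact absurd (Subtype.ext (Prod.ext hr h)) hy
      · rw [uniMat_upper h, zero_mul, map_zero]
    · rw [zero_mul, map_zero]
  · simp

open Classical in
/-- The factors of a PBW monomial act on evaluation at the identity in the order of decreasing rows, so
that `dualRep_rootVec` applies to each of them. -/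
theorem dualRep_listPbw (chi : Fin n → ℂ) {l : List (NegRoot n)} (hl : IsFinalSegment l)
    (β : NegRoot n → ℕ) :
    dualRep chi (listPbw l β) (taylorCoeff 0) = taylorCoeff (fun x => if x ∈ l then β x else 0) := by
  induction l with
  | nil => simp [listPbw]; rfl
  | cons a l ih =>
    rw [listPbw_cons, map_mul, Module.End.mul_apply, ih hl.tail, map_pow]
    have key : ∀ c : ℕ, (dualRep chi (rootVec a) ^ c)
        (taylorCoeff (fun x => if x ∈ l then β x else 0)) =
          taylorCoeff ((fun x => if x ∈ l then β x else 0) + Pi.single a c) := by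
      intro c
      induction c with
      | zero => simp
      | succ c ihc =>
        rw [pow_succ', Module.End.mul_apply, ihc, dualRep_rootVec]
        · rw [add_assoc, ← Pi.single_add]
        · intro y hy
          have h1 : y ≠ a := by rintro rfl; exact lt_irrefl _ hy
          have h2 : y ∉ l := fun h => (hl.le y h).row_le.not_gt hy
          simp [h1, h2]
    rw [key]
    congr 1
    funext x
    by_cases hx : x = a
    · subst hx; simp [hl.notMem]
    · simp [hx]

theorem linearIndependent_taylorCoeff : LinearIndependent ℂ (taylorCoeff (n := n)) := by
  classical
  rw [linearIndependent_iff]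
  intro c hc
  ext β
  have h := LinearMap.congr_fun hc (MvPolynomial.monomial (Finsupp.equivFunOnFinite.symm β) 1)
  rw [Finsupp.linearCombination_apply, Finsupp.sum, LinearMap.sum_apply,
    Finset.sum_eq_single β] at h
  · rw [LinearMap.smul_apply, taylorCoeff_apply, MvPolynomial.coeff_monomial, if_pos rfl, mul_one,
      smul_eq_mul, LinearMap.zero_apply, mul_eq_zero] at h
    refine h.resolve_right (Finset.prod_ne_zero_iff.mpr fun x _ => ?_)
    exact_mod_cast Nat.factorial_ne_zero _
  · intro γ _ hγ
    rw [LinearMap.smul_apply, taylorCoeff_apply, MvPolynomial.coeff_monomial, if_neg, mul_zero,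
      smul_zero]
    intro h
    exact hγ (Finsupp.equivFunOnFinite.symm.injective h).symm
  · intro h
    rw [Finsupp.notMem_support_iff.mp h, zero_smul, LinearMap.zero_apply]

/-- The vectors `E^β v_lam` are linearly independent: under the homomorphism from the Verma module
to the functionals on `UniPoly n` they become the Taylor coefficients at the identity. -/
theorem linearIndependent_pbw (lam : Fin n → ℂ) :
    LinearIndependent ℂ fun β : NegRoot n → ℕ => pbw β • hwVector lam := by
  have heval : ∀ f : UniPoly n, taylorCoeff 0 f = MvPolynomial.eval 0 f := by
    intro f
    rw [taylorCoeff_apply]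
    simp only [Pi.zero_apply, Nat.factorial_zero, Nat.cast_one, Finset.prod_const_one, one_mul]
    rw [MvPolynomial.eval_zero, MvPolynomial.constantCoeff_eq]
    congr 1
    ext x
    rfl
  obtain ⟨g, hg⟩ := exists_verma_lift lam (dualRep fun i => -lam i) (taylorCoeff 0)
    (fun i j hij => by
      refine LinearMap.ext fun f => ?_
      rw [dualRep_uE, heval, flagRep_eval_zero _ hij.le, if_neg hij.ne]
      simp)
    (fun i => by
      refine LinearMap.ext fun f => ?_
      rw [dualRep_uE, heval, flagRep_eval_zero _ le_rfl, if_pos rfl, LinearMap.smul_apply, heval,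
        smul_eq_mul, neg_mul, neg_neg])
  refine LinearIndependent.of_comp g ?_
  have : (g ∘ fun β : NegRoot n → ℕ => pbw β • hwVector lam) = taylorCoeff := by
    funext β
    rw [Function.comp_apply, hg, pbw, dualRep_listPbw _ isFinalSegment_rootList]
    simp [mem_rootList]
  rw [this]
  exact linearIndependent_taylorCoeff

end Independence

section Spanning

variable {N : ℕ}

theorem uE_mem_adjoin (j k : Fin (N + 1)) (h : k < j) :
    uE j k ∈ Algebra.adjoin ℂ (Set.range fun p : Fin N => rootVec (simpleRoot p)) := by
  obtain ⟨k, hk⟩ := k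
  obtain ⟨j, hj⟩ := j
  simp only [Fin.mk_lt_mk] at h
  induction j, h using Nat.le_induction with
  | base => exact Algebra.subset_adjoin ⟨⟨k, by omega⟩, rfl⟩
  | succ j hkj ih =>
    have hj' : j < N + 1 := by omega
    have h := uE_mul_uE ⟨j + 1, hj⟩ ⟨j, hj'⟩ ⟨j, hj'⟩ (⟨k, hk⟩ : Fin (N + 1))
    rw [if_pos rfl, if_neg (by simp; omega), sub_zero] at h
    rw [← sub_eq_iff_eq_add'.mpr h]
    have h1 : uE (⟨j + 1, hj⟩ : Fin (N + 1)) ⟨j, hj'⟩ ∈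
        Algebra.adjoin ℂ (Set.range fun p : Fin N => rootVec (simpleRoot p)) :=
      Algebra.subset_adjoin ⟨⟨j, by omega⟩, rfl⟩
    exact sub_mem (mul_mem h1 (ih hj')) (mul_mem (ih hj') h1)

/-- Monomials in the simple root vectors are combinations of PBW monomials. -/
theorem closure_subset_span_pbw {a : Ugl (N + 1)}
    (ha : a ∈ Submonoid.closure (Set.range fun p : Fin N => rootVec (simpleRoot p))) :
    a ∈ Submodule.span ℂ (Set.range (pbw (n := N + 1))) := by
  induction ha using Submonoid.closure_induction_right with
  | one => exact Submodule.subset_span ⟨0, pbw_zero⟩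
  | mul_right x _ y hy ih =>
    obtain ⟨q, rfl⟩ := hy
    clear * - ih
    induction ih using Submodule.span_induction with
    | mem x hx =>
      obtain ⟨δ, rfl⟩ := hx
      change pbw δ * rootVec (simpleRoot q) ∈ _
      rw [pbw_mul_simpleRoot]
      refine add_mem (Submodule.subset_span ⟨_, rfl⟩)
        (sum_mem fun y _ => nsmul_mem (Submodule.subset_span (Set.mem_range_self _)) _)
    | zero => simp
    | add x y _ _ hx hy =>
      rw [add_mul]
      exact add_mem hx hy
    | smul c x _ hx =>
      rw [smul_mul_assoc]
      exact Submodule.smul_mem _ _ hx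

/-- The span `S` of the vectors `F v_lam`, for monomials `F` in the simple root vectors, is stable under
`gl(n)`: commute a matrix unit to the right through `F`, one factor at a time. -/
theorem span_pbw_eq_top (lam : Fin (N + 1) → ℂ) :
    Submodule.span ℂ (Set.range fun β : NegRoot (N + 1) → ℕ => pbw β • hwVector lam) = ⊤ := by
  set F : Set (Ugl (N + 1)) := Set.range fun p : Fin N => rootVec (simpleRoot p) with hF
  set S : Submodule ℂ (Verma lam) := Submodule.span ℂ
    ((fun a : Ugl (N + 1) => a • hwVector lam) '' (Submonoid.closure F : Set (Ugl (N + 1)))) with hS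
  have hFS : ∀ q : Fin N, ∀ w ∈ S, rootVec (simpleRoot q) • w ∈ S := by
    intro q w hw
    induction hw using Submodule.span_induction with
    | mem x hx =>
      obtain ⟨a, ha, rfl⟩ := hx
      rw [← mul_smul]
      exact Submodule.subset_span ⟨_, mul_mem (Submonoid.subset_closure ⟨q, rfl⟩) ha, rfl⟩
    | zero => simp
    | add x y _ _ hx hy => rw [smul_add]; exact add_mem hx hy
    | smul c x _ hx => rw [smul_comm]; exact S.smul_mem _ hx
  have hAS : ∀ a ∈ Algebra.adjoin ℂ F, ∀ w ∈ S, a • w ∈ S := by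
    intro a ha
    induction ha using Algebra.adjoin_induction with
    | mem x hx => obtain ⟨q, rfl⟩ := hx; exact hFS q
    | algebraMap r => intro w hw; rw [algebraMap_smul]; exact S.smul_mem _ hw
    | add x y _ _ hx hy => intro w hw; rw [add_smul]; exact add_mem (hx w hw) (hy w hw)
    | mul x y _ _ hx hy => intro w hw; rw [mul_smul]; exact hx _ (hy w hw)
  have hv : hwVector lam ∈ S := Submodule.subset_span ⟨1, one_mem _, one_smul _ _⟩
  have hES : ∀ a ∈ Submonoid.closure F, ∀ i j : Fin (N + 1), uE i j • a • hwVector lam ∈ S := by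
    intro a ha
    induction ha using Submonoid.closure_induction_left with
    | one =>
      intro i j
      rw [one_smul]
      rcases lt_trichotomy i j with h | h | h
      · have : uE i j • hwVector lam = 0 := by
          rw [smul_hwVector_eq_mkQ]
          exact (Submodule.Quotient.mk_eq_zero _).mpr
            (Submodule.subset_span (Or.inl ⟨i, j, h, rfl⟩))
        rw [this]; exact zero_mem _
      · subst h
        have := (mem_weightSpace lam lam _).mp (hwVector_mem lam) i
        rw [lie_verma] at this
        rw [uE, this]
        exact S.smul_mem _ hv
      · exact hAS _ (uE_mem_adjoin i j h) _ hv
    | mul_left x hx y hy ih =>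
      obtain ⟨q, rfl⟩ := hx
      intro i j
      have h := uE_mul_uE i j q.succ q.castSucc
      rw [← mul_smul, ← mul_assoc]
      change (uE i j * uE q.succ q.castSucc * y) • hwVector lam ∈ S
      rw [h, add_mul, add_smul, sub_mul, sub_smul, mul_assoc, mul_smul, mul_smul]
      refine add_mem (hFS q _ (ih i j)) (sub_mem ?_ ?_)
      · split_ifs
        · rw [mul_smul]; exact ih _ _
        · rw [zero_mul, zero_smul]; exact zero_mem _
      · split_ifs
        · rw [mul_smul]; exact ih _ _
        · rw [zero_mul, zero_smul]; exact zero_mem _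
  have hES' : ∀ i j : Fin (N + 1), ∀ w ∈ S, uE i j • w ∈ S := by
    intro i j w hw
    induction hw using Submodule.span_induction with
    | mem x hx => obtain ⟨a, ha, rfl⟩ := hx; exact hES a ha i j
    | zero => simp
    | add x y _ _ hx hy => rw [smul_add]; exact add_mem hx hy
    | smul c x _ hx => rw [smul_comm]; exact S.smul_mem _ hx
  have hιS : ∀ A : gl (N + 1), ∀ w ∈ S, UniversalEnvelopingAlgebra.ι ℂ A • w ∈ S := by
    intro A w hw
    rw [Matrix.matrix_eq_sum_single A, map_sum, Finset.sum_smul]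
    refine sum_mem fun i _ => ?_
    rw [map_sum, Finset.sum_smul]
    refine sum_mem fun j _ => ?_
    have : Matrix.single i j (A i j) = A i j • E i j := by simp [E, Matrix.smul_single]
    rw [this, map_smul, smul_assoc]
    exact S.smul_mem _ (hES' i j w hw)
  have htop : S = ⊤ := by
    rw [eq_top_iff]
    intro w _
    obtain ⟨a, rfl⟩ := exists_smul_hwVector lam w
    have h : ∀ a : Ugl (N + 1), ∀ w ∈ S, a • w ∈ S := by
      intro a
      let B : Subalgebra ℂ (Ugl (N + 1)) :=
        { carrier := {a | ∀ m ∈ S, a • m ∈ S}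
          mul_mem' := fun {a b} ha hb m hm => by rw [mul_smul]; exact ha _ (hb _ hm)
          add_mem' := fun {a b} ha hb m hm => by
            rw [add_smul]; exact S.add_mem (ha _ hm) (hb _ hm)
          algebraMap_mem' := fun r m hm => by rw [algebraMap_smul]; exact S.smul_mem _ hm }
      let f : gl (N + 1) →ₗ⁅ℂ⁆ B :=
        { toFun := fun A => ⟨UniversalEnvelopingAlgebra.ι ℂ A, fun m hm => hιS A m hm⟩
          map_add' := fun A A' => Subtype.ext (map_add _ _ _)
          map_smul' := fun r A => Subtype.ext (map_smul _ _ _)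
          map_lie' := fun {A A'} => Subtype.ext (LieHom.map_lie _ _ _) }
      have hid : B.val.comp (UniversalEnvelopingAlgebra.lift ℂ f) = AlgHom.id ℂ _ := by
        apply UniversalEnvelopingAlgebra.hom_ext
        ext A
        simp [f]
      have := (UniversalEnvelopingAlgebra.lift ℂ f a).2
      have h2 : ((UniversalEnvelopingAlgebra.lift ℂ f a : B) : Ugl (N + 1)) = a :=
        DFunLike.congr_fun hid a
      rwa [h2] at this
    exact h a _ hv
  rw [eq_top_iff, ← htop, hS, Submodule.span_le]
  rintro _ ⟨a, ha, rfl⟩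
  have := Submodule.mem_map_of_mem
    (f := (LinearMap.toSpanSingleton (Ugl (N + 1)) (Verma lam) (hwVector lam)).restrictScalars ℂ)
    (closure_subset_span_pbw ha)
  rw [Submodule.map_span, ← Set.range_comp] at this
  exact this

/-- The PBW basis `E^β v_lam` of the Verma module. -/
noncomputable def pbwBasis (lam : Fin (N + 1) → ℂ) :
    Module.Basis (NegRoot (N + 1) → ℕ) ℂ (Verma lam) :=
  Module.Basis.mk (linearIndependent_pbw lam) (span_pbw_eq_top lam).ge

theorem pbwBasis_apply (lam : Fin (N + 1) → ℂ) (β : NegRoot (N + 1) → ℕ) :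
    pbwBasis lam β = pbw β • hwVector lam := Module.Basis.mk_apply _ _ β

end Spanning

/-! ### Right multiplication of PBW monomials by products of simple root vectors -/

section Expansion

variable {N : ℕ}

/-- The value of `a` at the left neighbour `(j, k - 1)` of `(j, k)`, and `0` if there is none. -/
def prevVal {n : ℕ} (a : NegRoot n → ℕ) (y : NegRoot n) : ℕ :=
  if (y.1.2 : ℕ) = 0 then 0 else a (leftRoot y)

/-- The exponent of the PBW monomial obtained from `E^δ` when, for every root `(j, k)`, `a (j, k)`
factors `E_{k+1,k}` are absorbed in row `j`: each of them raises the exponent at `(j, k)` and, if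
`k + 1 < j`, lowers the one at `(j, k + 1)`. -/
def shiftExp {n : ℕ} (δ a : NegRoot n → ℕ) : NegRoot n → ℕ := fun y => δ y + a y - prevVal a y

/-- The coefficient with which `shiftExp δ a` occurs in the product of `E^δ` with divided powers of
the simple root vectors. -/
noncomputable def expCoeff {n : ℕ} (δ a : NegRoot n → ℕ) : ℂ :=
  (∏ y, ((δ y).descFactorial (prevVal a y) : ℂ)) / ∏ y, ((a y).factorial : ℂ)

/-- The families `a` with column sums `i`. -/
def colSet (i : Fin N → ℕ) : Finset (NegRoot (N + 1) → ℕ) :=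
  (Fintype.piFinset fun _ => Finset.range (∑ p, i p + 1)).filter
    fun a => ∀ p : Fin N, upperSum a p.castSucc = i p

theorem le_upperSum {n : ℕ} (a : NegRoot n → ℕ) (x : NegRoot n) : a x ≤ upperSum a x.1.2 :=
  Finset.single_le_sum (f := a) (fun _ _ => Nat.zero_le _) (by simp)

theorem le_upperSum' (a : NegRoot (N + 1) → ℕ) {x : NegRoot (N + 1)} {q : Fin N}
    (h : x.1.2 = q.castSucc) : a x ≤ upperSum a q.castSucc := h ▸ le_upperSum a x

theorem exists_castSucc_eq_col (x : NegRoot (N + 1)) : ∃ p : Fin N, x.1.2 = p.castSucc :=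
  ⟨x.1.2.castPred (x.2.trans_le (Fin.le_last _)).ne, by simp⟩

theorem mem_colSet {i : Fin N → ℕ} {a : NegRoot (N + 1) → ℕ} :
    a ∈ colSet i ↔ ∀ p : Fin N, upperSum a p.castSucc = i p := by
  rw [colSet, Finset.mem_filter, and_iff_right_iff_imp]
  intro h
  rw [Fintype.mem_piFinset]
  intro x
  obtain ⟨p, hp⟩ := exists_castSucc_eq_col x
  have h1 := le_upperSum' a hp
  rw [h p] at h1
  have h2 : i p ≤ ∑ p, i p := Finset.single_le_sum (fun _ _ => Nat.zero_le _) (Finset.mem_univ p)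
  exact Finset.mem_range.mpr (by omega)

theorem upperSum_add {n : ℕ} (a b : NegRoot n → ℕ) (s : Fin n) :
    upperSum (a + b) s = upperSum a s + upperSum b s := by
  simp [upperSum, Finset.sum_add_distrib]

theorem lowerSum_add {n : ℕ} (a b : NegRoot n → ℕ) (s : Fin n) :
    lowerSum (a + b) s = lowerSum a s + lowerSum b s := by
  simp [lowerSum, Finset.sum_add_distrib]

theorem upperSum_single {n : ℕ} (x : NegRoot n) (c : ℕ) (s : Fin n) :
    upperSum (Pi.single x c) s = if x.1.2 = s then c else 0 := by
  rw [upperSum, Finset.sum_filter, Finset.sum_eq_single x (fun y _ hy => by simp [hy]) (by simp)]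
  simp

theorem lowerSum_single {n : ℕ} (x : NegRoot n) (c : ℕ) (s : Fin n) :
    lowerSum (Pi.single x c) s = if x.1.1 = s then c else 0 := by
  rw [lowerSum, Finset.sum_filter, Finset.sum_eq_single x (fun y _ hy => by simp [hy]) (by simp)]
  simp

theorem add_single_mem_colSet {i : Fin N → ℕ} {a : NegRoot (N + 1) → ℕ} {q : Fin N}
    {x : NegRoot (N + 1)} (hx : x.1.2 = q.castSucc) :
    a + Pi.single x 1 ∈ colSet (i + Pi.single q 1) ↔ a ∈ colSet i := by
  rw [mem_colSet, mem_colSet]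
  refine forall_congr' fun p => ?_
  rw [upperSum_add, upperSum_single, hx, Pi.add_apply, Pi.single_apply]
  by_cases h : p = q
  · subst h; simp
  · rw [if_neg h, if_neg (by simpa [eq_comm] using h), add_zero, add_zero]

theorem prod_eq_mul_prod {ι : Type*} [Fintype ι] {f g : ι → ℂ} (y : ι) (c : ℂ)
    (hy : f y = c * g y) (h : ∀ z, z ≠ y → f z = g z) : ∏ z, f z = c * ∏ z, g z := by
  classical
  rw [← Finset.mul_prod_erase Finset.univ f (Finset.mem_univ y),
    ← Finset.mul_prod_erase Finset.univ g (Finset.mem_univ y), hy, mul_assoc]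
  congr 2
  exact Finset.prod_congr rfl fun z hz => h z (Finset.ne_of_mem_erase hz)

theorem prod_factorial_add_single {ι : Type*} [Fintype ι] [DecidableEq ι] (a : ι → ℕ) (x : ι) :
    ∏ z, (((a + Pi.single x 1 : ι → ℕ) z).factorial : ℂ) =
      (a x + 1) * ∏ z, ((a z).factorial : ℂ) := by
  refine prod_eq_mul_prod x _ ?_ fun z hz => by simp [hz]
  simp [Nat.factorial_succ]

theorem prod_factorial_ne_zero {ι : Type*} [Fintype ι] (a : ι → ℕ) :
    ∏ z, ((a z).factorial : ℂ) ≠ 0 :=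
  Finset.prod_ne_zero_iff.mpr fun z _ => by exact_mod_cast Nat.factorial_ne_zero _

theorem leftRoot_injOn {n : ℕ} {y z : NegRoot n} (hy : (y.1.2 : ℕ) ≠ 0) (hz : (z.1.2 : ℕ) ≠ 0)
    (h : leftRoot y = leftRoot z) : y = z := by
  obtain ⟨⟨a, b⟩, h1⟩ := y
  obtain ⟨⟨c, d⟩, h2⟩ := z
  simp only [leftRoot, Subtype.mk.injEq, Prod.mk.injEq, Fin.ext_iff] at *
  omega

theorem prevVal_add_leftRoot {n : ℕ} (a : NegRoot n → ℕ) {y : NegRoot n} (hy : (y.1.2 : ℕ) ≠ 0)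
    (z : NegRoot n) : prevVal (a + Pi.single (leftRoot y) 1) z =
      prevVal a z + (Pi.single y 1 : NegRoot n → ℕ) z := by
  rw [prevVal, prevVal]
  by_cases hzy : z = y
  · subst hzy
    simp [hy]
  · rw [Pi.single_eq_of_ne hzy, add_zero]
    split_ifs with hz
    · rfl
    · rw [Pi.add_apply, Pi.single_eq_of_ne, add_zero]
      exact fun h => hzy (leftRoot_injOn hz hy h)

theorem prevVal_add_simpleRoot (a : NegRoot (N + 1) → ℕ) (q : Fin N) (z : NegRoot (N + 1)) :
    prevVal (a + Pi.single (simpleRoot q) 1) z = prevVal a z := by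
  rw [prevVal, prevVal]
  split_ifs with hz
  · rfl
  · rw [Pi.add_apply, Pi.single_eq_of_ne, add_zero]
    intro h
    have h1 := z.2
    have h2 := congrArg (fun x : NegRoot (N + 1) => (x.1.1 : ℕ)) h
    have h3 := congrArg (fun x : NegRoot (N + 1) => (x.1.2 : ℕ)) h
    simp only [leftRoot, simpleRoot, Fin.val_succ, Fin.val_castSucc, Fin.lt_def] at h1 h2 h3
    omega

theorem expCoeff_add_leftRoot {n : ℕ} (δ a : NegRoot n → ℕ) {y : NegRoot n}
    (hy : (y.1.2 : ℕ) ≠ 0) :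
    ((a (leftRoot y) : ℂ) + 1) * expCoeff δ (a + Pi.single (leftRoot y) 1) =
      ((δ y - prevVal a y : ℕ) : ℂ) * expCoeff δ a := by
  have h1 : ∏ z, ((δ z).descFactorial (prevVal (a + Pi.single (leftRoot y) 1) z) : ℂ) =
      ((δ y - prevVal a y : ℕ) : ℂ) * ∏ z, ((δ z).descFactorial (prevVal a z) : ℂ) := by
    refine prod_eq_mul_prod y _ ?_ fun z hz => ?_
    · rw [prevVal_add_leftRoot a hy, Pi.single_eq_same, Nat.descFactorial_succ]
      push_cast
      rfl
    · rw [prevVal_add_leftRoot a hy, Pi.single_eq_of_ne hz, add_zero]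
  have h2 : ((a (leftRoot y) : ℂ) + 1) ≠ 0 := Nat.cast_add_one_ne_zero _
  have h3 := prod_factorial_ne_zero a
  rw [expCoeff, expCoeff, h1, prod_factorial_add_single]
  field_simp

theorem expCoeff_add_simpleRoot (δ a : NegRoot (N + 1) → ℕ) (q : Fin N) :
    ((a (simpleRoot q) : ℂ) + 1) * expCoeff δ (a + Pi.single (simpleRoot q) 1) =
      expCoeff δ a := by
  have h2 : ((a (simpleRoot q) : ℂ) + 1) ≠ 0 := Nat.cast_add_one_ne_zero _
  have h3 := prod_factorial_ne_zero a
  rw [expCoeff, expCoeff, prod_factorial_add_single]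
  simp only [prevVal_add_simpleRoot]
  field_simp

theorem prevVal_le_of_expCoeff_ne_zero {n : ℕ} {δ a : NegRoot n → ℕ} (h : expCoeff δ a ≠ 0)
    (y : NegRoot n) : prevVal a y ≤ δ y := by
  by_contra! hlt
  refine h ?_
  rw [expCoeff, Finset.prod_eq_zero (Finset.mem_univ y), zero_div]
  exact_mod_cast Nat.descFactorial_eq_zero_iff_lt.mpr hlt

/-- The expansion of `E^δ E_{2,1}^{(i_1)} E_{3,2}^{(i_2)} ⋯`, a product with divided powers, into
PBW monomials. -/
noncomputable def pbwExpansion (δ : NegRoot (N + 1) → ℕ) (i : Fin N → ℕ) : Ugl (N + 1) :=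
  ∑ a ∈ colSet i, expCoeff δ a • pbw (shiftExp δ a)

theorem sum_filter_col_eq {M : Type*} [AddCommMonoid M] (q : Fin N) (g : NegRoot (N + 1) → M) :
    ∑ x : NegRoot (N + 1) with x.1.2 = q.castSucc, g x =
      g (simpleRoot q) + ∑ y : NegRoot (N + 1) with y.1.2 = q.succ, g (leftRoot y) := by
  rw [← Finset.add_sum_erase (a := simpleRoot q) _ _ (by simp [simpleRoot])]
  congr 1
  symm
  refine Finset.sum_bij (fun y _ => leftRoot y) ?_ ?_ ?_ (fun _ _ => rfl)
  · intro y hy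
    have hy' : y.1.2 = q.succ := by simpa using hy
    have hlt : q.succ < y.1.1 := hy' ▸ y.2
    rw [Finset.mem_erase, Finset.mem_filter, leftRoot_eq hy']
    refine ⟨fun h => ?_, Finset.mem_univ _, rfl⟩
    have := congrArg (fun x : NegRoot (N + 1) => x.1.1) h
    rw [leftRoot_eq hy'] at this
    exact hlt.ne' this
  · intro y hy z hz h
    have hy' : y.1.2 = q.succ := by simpa using hy
    have hz' : z.1.2 = q.succ := by simpa using hz
    exact leftRoot_injOn (by simp [hy']) (by simp [hz']) h
  · intro x hx
    rw [Finset.mem_erase, Finset.mem_filter] at hx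
    obtain ⟨hne, -, hx⟩ := hx
    have hlt : q.succ < x.1.1 := by
      have h1 := x.2
      rw [hx] at h1
      refine lt_of_le_of_ne (Fin.castSucc_lt_iff_succ_le.mp h1) fun h => hne ?_
      exact Subtype.ext (Prod.ext h.symm hx)
    refine ⟨⟨(x.1.1, q.succ), hlt⟩, by simp, ?_⟩
    exact Subtype.ext (by rw [leftRoot_eq rfl, ← hx])

/-- Multiplying by `E_{q+1,q}` is allowed when no later simple root vector has been used. Both sides are
sums over a family `a` and a root in the column `q` at which `a` is raised by one. -/
theorem pbwExpansion_mul_simpleRoot (δ : NegRoot (N + 1) → ℕ) {i : Fin N → ℕ} {q : Fin N}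
    (hi : ∀ p, q < p → i p = 0) :
    pbwExpansion δ i * rootVec (simpleRoot q) =
      ((i q : ℂ) + 1) • pbwExpansion δ (i + Pi.single q 1) := by
  classical
  -- Distribute the factor `i q + 1` over the entries of the column `q` of `a`.
  have hR : ((i q : ℂ) + 1) • pbwExpansion δ (i + Pi.single q 1) =
      ∑ x : NegRoot (N + 1) with x.1.2 = q.castSucc, ∑ a ∈ colSet (i + Pi.single q 1),
        (a x : ℂ) • expCoeff δ a • pbw (shiftExp δ a) := by
    rw [Finset.sum_comm, pbwExpansion, Finset.smul_sum]
    refine Finset.sum_congr rfl fun a ha => ?_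
    rw [← Finset.sum_smul]
    congr 1
    have := mem_colSet.mp ha q
    rw [Pi.add_apply, Pi.single_eq_same] at this
    exact_mod_cast this.symm
  have hR2 : ∀ x : NegRoot (N + 1), x.1.2 = q.castSucc →
      ∑ a ∈ colSet (i + Pi.single q 1), (a x : ℂ) • expCoeff δ a • pbw (shiftExp δ a) =
      ∑ a ∈ colSet i, (((a x : ℂ) + 1) * expCoeff δ (a + Pi.single x 1)) •
        pbw (shiftExp δ (a + Pi.single x 1)) := by
    intro x hx
    symm
    refine Finset.sum_of_injOn (fun a => a + Pi.single x 1)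
      (fun a _ b _ h => add_right_cancel h) ?_ ?_ ?_
    · intro a ha
      exact (add_single_mem_colSet hx).mpr ha
    · intro b hb hb'
      rcases Nat.eq_zero_or_pos (b x) with h | h
      · rw [h, Nat.cast_zero, zero_smul]
      · have hb2 : b - Pi.single x 1 + Pi.single x 1 = b := by
          refine tsub_add_cancel_of_le fun z => ?_
          by_cases hz : z = x
          · subst hz; simpa using Nat.succ_le_of_lt h
          · simp [hz]
        refine absurd ⟨b - Pi.single x 1, ?_, hb2⟩ hb'
        rw [← hb2] at hb
        exact (add_single_mem_colSet hx).mp hb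
    · intro a _
      simp [mul_smul]
  rw [hR, Finset.sum_congr rfl fun x hx => hR2 x (Finset.mem_filter.mp hx).2, Finset.sum_comm,
    pbwExpansion, Finset.sum_mul]
  refine Finset.sum_congr rfl fun a ha => ?_
  rw [sum_filter_col_eq, smul_mul_assoc, pbw_mul_simpleRoot, smul_add, Finset.smul_sum]
  congr 1
  · rw [expCoeff_add_simpleRoot]
    by_cases h0 : expCoeff δ a = 0
    · rw [h0, zero_smul, zero_smul]
    congr 2
    funext z
    have := prevVal_le_of_expCoeff_ne_zero h0 z
    simp only [shiftExp, prevVal_add_simpleRoot, Pi.add_apply]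
    omega
  · refine Finset.sum_congr rfl fun y hy => ?_
    have hy' : y.1.2 = q.succ := (Finset.mem_filter.mp hy).2
    have hy0 : (y.1.2 : ℕ) ≠ 0 := by simp [hy']
    -- The column `q + 1` of `a` vanishes, because `i` does after `q`.
    have hay : a y = 0 := by
      obtain ⟨p, hp⟩ := exists_castSucc_eq_col y
      have h1 := le_upperSum' a hp
      rw [mem_colSet.mp ha p, hi p] at h1
      · exact Nat.le_zero.mp h1
      · rw [Fin.lt_def]
        have := hp.symm.trans hy'
        rw [Fin.ext_iff] at this
        simp only [Fin.val_castSucc, Fin.val_succ] at this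
        omega
    have hsh : shiftExp δ a y = δ y - prevVal a y := by rw [shiftExp, hay, add_zero]
    rw [expCoeff_add_leftRoot δ a hy0, hsh]
    by_cases h0 : expCoeff δ a = 0
    · rw [h0, zero_smul, mul_zero, zero_smul]
    rw [mul_comm, mul_smul, Nat.cast_smul_eq_nsmul]
    congr 3
    funext z
    have := prevVal_le_of_expCoeff_ne_zero h0 z
    simp only [shiftExp, prevVal_add_leftRoot a hy0, Pi.add_apply, Pi.sub_apply]
    omega

/-- Multiplying the last nontrivial factor of an ordered product multiplies the product. -/
theorem prod_ofFn_mul {A : Type*} [Monoid A] {N : ℕ} (f g : Fin N → A) (q : Fin N) (c : A)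
    (hq : g q = f q * c) (hlt : ∀ p, p < q → g p = f p) (hf : ∀ p, q < p → f p = 1)
    (hg : ∀ p, q < p → g p = 1) : (List.ofFn g).prod = (List.ofFn f).prod * c := by
  induction N with
  | zero => exact q.elim0
  | succ N ih =>
    rw [List.ofFn_succ, List.ofFn_succ, List.prod_cons, List.prod_cons]
    induction q using Fin.cases with
    | zero =>
      have h : ∀ h : Fin (N + 1) → A, (∀ p, 0 < p → h p = 1) →
          (List.ofFn fun p : Fin N => h p.succ).prod = 1 := by
        intro h hh
        refine List.prod_eq_one fun x hx => ?_
        obtain ⟨p, rfl⟩ := List.mem_ofFn.mp hx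
        exact hh _ (Fin.succ_pos p)
      rw [h f hf, h g hg, mul_one, mul_one, hq]
    | succ q =>
      rw [hlt 0 (Fin.succ_pos q), mul_assoc]
      congr 1
      exact ih _ _ q hq (fun p hp => hlt _ (Fin.succ_lt_succ_iff.mpr hp))
        (fun p hp => hf _ (Fin.succ_lt_succ_iff.mpr hp))
        (fun p hp => hg _ (Fin.succ_lt_succ_iff.mpr hp))

theorem ePow_add_single {i : Fin N → ℕ} {q : Fin N} (hi : ∀ p, q < p → i p = 0) :
    ePow (i + Pi.single q 1) = ePow i * rootVec (simpleRoot q) := by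
  refine prod_ofFn_mul _ _ q _ ?_ ?_ ?_ ?_
  · rw [Pi.add_apply, Pi.single_eq_same, pow_succ]
    rfl
  · intro p hp
    simp [hp.ne]
  · intro p hp
    simp [hi p hp]
  · intro p hp
    simp [hi p hp, hp.ne']

/-- Multi-indices are built from `0` by raising an entry after which all entries vanish. -/
theorem multiIndex_induction {P : (Fin N → ℕ) → Prop} (h0 : P 0)
    (hs : ∀ i q, (∀ p, q < p → i p = 0) → P i → P (i + Pi.single q 1)) (i : Fin N → ℕ) : P i := by
  induction hk : ∑ p, i p generalizing i with
  | zero =>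
    have : i = 0 := funext fun p => by
      simpa using (Finset.sum_eq_zero_iff.mp hk) p (Finset.mem_univ p)
    rwa [this]
  | succ k ih =>
    have hne : (Finset.univ.filter fun p => i p ≠ 0).Nonempty := by
      by_contra h
      rw [Finset.not_nonempty_iff_eq_empty, Finset.filter_eq_empty_iff] at h
      have : ∑ p, i p = 0 := Finset.sum_eq_zero fun p hp => not_not.mp (h hp)
      omega
    obtain ⟨q, hq, hmax⟩ := Finset.exists_max_image _ id hne
    rw [Finset.mem_filter] at hq
    have hi : i - Pi.single q 1 + Pi.single q 1 = i := by
      refine tsub_add_cancel_of_le fun z => ?_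
      by_cases hz : z = q
      · subst hz; simpa using Nat.one_le_iff_ne_zero.mpr hq.2
      · simp [hz]
    rw [← hi]
    refine hs _ q (fun p hp => ?_) (ih _ ?_)
    · have : i p = 0 := by
        by_contra h
        exact (hmax p (by simpa using h)).not_gt hp
      simp [this]
    · have h2 : ∑ p, (i - Pi.single q 1 + Pi.single q 1 : Fin N → ℕ) p = k + 1 := by rw [hi, hk]
      simpa [Finset.sum_add_distrib] using h2

theorem pbw_mul_ePow (δ : NegRoot (N + 1) → ℕ) (i : Fin N → ℕ) :
    pbw δ * ePow i = (∏ p, ((i p).factorial : ℂ)) • pbwExpansion δ i := by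
  induction i using multiIndex_induction with
  | h0 =>
    have h1 : ePow (0 : Fin N → ℕ) = 1 := List.prod_eq_one fun x hx => by
      obtain ⟨p, rfl⟩ := List.mem_ofFn.mp hx
      simp
    have h2 : colSet (0 : Fin N → ℕ) = {0} := by
      ext a
      rw [mem_colSet, Finset.mem_singleton]
      constructor
      · intro h
        funext x
        obtain ⟨p, hp⟩ := exists_castSucc_eq_col x
        have := le_upperSum' a hp
        rw [h p] at this
        simpa using this
      · rintro rfl p
        simp [upperSum]
    rw [h1, mul_one, pbwExpansion, h2, Finset.sum_singleton]
    have h3 : shiftExp δ 0 = δ := by funext y; simp [shiftExp, prevVal]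
    rw [h3]
    simp [expCoeff, prevVal]
  | hs i q hi ih =>
    rw [ePow_add_single hi, ← mul_assoc, ih, smul_mul_assoc, pbwExpansion_mul_simpleRoot δ hi,
      smul_smul, prod_factorial_add_single]
    congr 1
    ring

/-- The row-wise partial sums of `γ`: the value at `(j, k)` is the sum of `γ (j, k')` over
`k' ≤ k`. -/
def cumSum {n : ℕ} (γ : NegRoot n → ℕ) (y : NegRoot n) : ℕ :=
  ∑ x : NegRoot n with x.1.1 = y.1.1 ∧ x.1.2 ≤ y.1.2, γ x

theorem cumSum_eq {n : ℕ} (γ : NegRoot n → ℕ) (y : NegRoot n) :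
    cumSum γ y = γ y + prevVal (cumSum γ) y := by
  rw [cumSum, ← Finset.add_sum_erase (a := y) _ _ (by simp)]
  congr 1
  rw [prevVal]
  split_ifs with h
  · refine Finset.sum_eq_zero fun x hx => ?_
    rw [Finset.mem_erase, Finset.mem_filter] at hx
    refine absurd (Subtype.ext (Prod.ext hx.2.2.1 (le_antisymm hx.2.2.2 ?_))) hx.1
    rw [Fin.le_def, h]
    exact Nat.zero_le _
  · rw [cumSum]
    refine Finset.sum_congr ?_ fun _ _ => rfl
    ext x
    obtain ⟨⟨a, b⟩, hab⟩ := x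
    obtain ⟨⟨c, d⟩, hcd⟩ := y
    simp only [leftRoot, Finset.mem_erase, Finset.mem_filter, Finset.mem_univ, true_and, ne_eq,
      Subtype.mk.injEq, Prod.mk.injEq, Fin.ext_iff, Fin.le_def] at h ⊢
    omega

theorem eq_cumSum {n : ℕ} {γ a : NegRoot n → ℕ} (h : ∀ y, a y = γ y + prevVal a y) :
    a = cumSum γ := by
  have key : ∀ (k : ℕ) (y : NegRoot n), (y.1.2 : ℕ) = k → a y = cumSum γ y := by
    intro k
    induction k with
    | zero =>
      intro y hy
      rw [h, cumSum_eq, prevVal, prevVal, if_pos hy, if_pos hy]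
    | succ k ih =>
      intro y hy
      rw [h, cumSum_eq, prevVal, prevVal, if_neg (by omega), if_neg (by omega),
        ih (leftRoot y) (by simp [leftRoot, hy])]
  exact funext fun y => key _ y rfl

/-- The diagonal coefficient of `E^β ↦ E^{β - γ} E_{2,1}^{i_1} E_{3,2}^{i_2} ⋯`, for the exponents
`i` that make the weights match. -/
theorem repr_pbw_mul_ePow (lam : Fin (N + 1) → ℂ) {β γ : NegRoot (N + 1) → ℕ} (hγ : γ ≤ β) :
    (pbwBasis lam).repr ((pbw (β - γ) * ePow fun p : Fin N => upperSum (cumSum γ) p.castSucc) •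
        hwVector lam) β =
      (∏ p : Fin N, ((upperSum (cumSum γ) p.castSucc).factorial : ℂ)) *
        expCoeff (β - γ) (cumSum γ) := by
  classical
  have hb : ∀ δ : NegRoot (N + 1) → ℕ, (pbwBasis lam).repr (pbw δ • hwVector lam) β =
      if δ = β then 1 else 0 := by
    intro δ
    rw [← pbwBasis_apply, Module.Basis.repr_self, Finsupp.single_apply]
  rw [pbw_mul_ePow, smul_assoc, map_smul, Finsupp.smul_apply, smul_eq_mul]
  congr 1
  rw [pbwExpansion, Finset.sum_smul, map_sum, Finsupp.finsetSum_apply,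
    Finset.sum_eq_single (cumSum γ)]
  · rw [smul_assoc, map_smul, Finsupp.smul_apply, hb, smul_eq_mul]
    by_cases h0 : expCoeff (β - γ) (cumSum γ) = 0
    · rw [h0, zero_mul]
    rw [if_pos, mul_one]
    -- Truncated subtraction in `shiftExp` is harmless where the coefficient is nonzero.
    funext y
    have h1 := prevVal_le_of_expCoeff_ne_zero h0 y
    have h2 := cumSum_eq γ y
    have h3 : γ y ≤ β y := hγ y
    simp only [shiftExp, Pi.sub_apply] at h1 ⊢
    rw [cumSum_eq γ y]
    omega
  · intro a _ ha
    rw [smul_assoc, map_smul, Finsupp.smul_apply, hb, smul_eq_mul]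
    by_cases h0 : expCoeff (β - γ) a = 0
    · rw [h0, zero_mul]
    rw [if_neg, mul_zero]
    intro h
    refine ha (eq_cumSum fun y => ?_)
    have h1 := prevVal_le_of_expCoeff_ne_zero h0 y
    have h2 := congrFun h y
    have h3 : γ y ≤ β y := hγ y
    simp only [shiftExp, Pi.sub_apply] at h1 h2
    omega
  · intro h
    exact absurd (mem_colSet.mpr fun p => rfl) h

/-- Both sides are `β! / (β - a)!` up to the same factors, where `a = cumSum γ`: choosing `γ` and then
`a - γ` elements in order is choosing `a` elements in order. -/
theorem prod_choose_mul_expCoeff {n : ℕ} (β γ : NegRoot n → ℕ) :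
    (∏ y, ((β y).choose (γ y) : ℂ)) * expCoeff (β - γ) (cumSum γ) =
      (∏ y, ((β y).choose (cumSum γ y) : ℂ)) / ∏ y, ((γ y).factorial : ℂ) := by
  rw [expCoeff, mul_div_assoc', div_eq_div_iff (prod_factorial_ne_zero _)
    (prod_factorial_ne_zero _), ← Finset.prod_mul_distrib, ← Finset.prod_mul_distrib,
    ← Finset.prod_mul_distrib]
  refine Finset.prod_congr rfl fun y _ => ?_
  have h : (β y).choose (γ y) * (γ y).factorial * (β y - γ y).descFactorial (prevVal (cumSum γ) y) =
      (β y).choose (cumSum γ y) * (cumSum γ y).factorial := by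
    rw [mul_comm ((β y).choose (γ y)), mul_comm ((β y).choose (cumSum γ y)),
      ← Nat.descFactorial_eq_factorial_mul_choose, ← Nat.descFactorial_eq_factorial_mul_choose,
      cumSum_eq γ y]
    rw [mul_comm]
    have := Nat.descFactorial_mul_descFactorial (n := β y) (m := γ y + prevVal (cumSum γ) y)
      (k := γ y) (Nat.le_add_right _ _)
    rwa [Nat.add_sub_cancel_left] at this
  rw [Pi.sub_apply]
  have h' := congrArg (Nat.cast : ℕ → ℂ) h
  push_cast at h'
  linear_combination h'

end Expansion

/-! ### The homomorphism defined by the singular vector -/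

section Exponents

variable {N : ℕ}

theorem xExp_apply (i : Fin N → ℕ) (k : Fin (N + 1)) :
    xExp i k = ((Fin.snoc i 0 : Fin (N + 1) → ℕ) k : ℤ) - ((Fin.cons 0 i : Fin (N + 1) → ℕ) k : ℤ) := by
  have h1 : ∑ p : Fin N, (i p : ℤ) * (if k = p.castSucc then 1 else 0) =
      ((Fin.snoc i 0 : Fin (N + 1) → ℕ) k : ℤ) := by
    induction k using Fin.lastCases with
    | last => simp [Fin.ext_iff, (Fin.is_lt _).ne']
    | cast p => simp
  have h2 : ∑ p : Fin N, (i p : ℤ) * (if k = p.succ then 1 else 0) =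
      ((Fin.cons 0 i : Fin (N + 1) → ℕ) k : ℤ) := by
    induction k using Fin.cases with
    | zero => simp [Fin.ext_iff]
    | succ p => simp
  rw [← h1, ← h2, ← Finset.sum_sub_distrib, xExp, Finset.sum_apply]
  refine Finset.sum_congr rfl fun p _ => ?_
  simp [Pi.single_apply, mul_sub]

theorem xExp_add (i j : Fin N → ℕ) : xExp (i + j) = xExp i + xExp j := by
  simp [xExp, add_smul, Finset.sum_add_distrib]

theorem xExp_single (q : Fin N) :
    xExp (Pi.single q 1) = Pi.single q.castSucc 1 - Pi.single q.succ 1 := by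
  rw [xExp, Finset.sum_eq_single q]
  · simp
  · intro p _ hp; simp [hp]
  · simp

/-- The partial sums of the exponents `x^{(i)}` are the entries of `i`. -/
theorem sum_xExp_le (i : Fin N → ℕ) (q : Fin N) :
    ∑ k : Fin (N + 1) with k ≤ q.castSucc, xExp i k = i q := by
  simp only [xExp, Finset.sum_apply]
  rw [Finset.sum_comm, Finset.sum_eq_single q]
  · simp only [Pi.smul_apply, Pi.sub_apply, Pi.single_apply, smul_eq_mul, mul_sub,
      Finset.sum_sub_distrib, ← Finset.mul_sum, Finset.sum_ite_eq']
    simp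
  · intro p _ hp
    simp only [Pi.smul_apply, Pi.sub_apply, Pi.single_apply, smul_eq_mul, mul_sub,
      Finset.sum_sub_distrib, ← Finset.mul_sum, Finset.sum_ite_eq', Finset.mem_filter,
      Finset.mem_univ, true_and]
    have : (p.castSucc ≤ q.castSucc) ↔ p.succ ≤ q.castSucc := by
      simp only [Fin.le_def, Fin.val_succ, Fin.val_castSucc, ne_eq, Fin.ext_iff] at hp ⊢
      omega
    simp only [this, sub_self]
  · simp

theorem xExp_injective : Function.Injective (xExp (N := N)) := by
  intro i j h
  funext q
  have := sum_xExp_le i q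
  rw [h, sum_xExp_le] at this
  exact_mod_cast this.symm

end Exponents

section Commutation

variable {N : ℕ}

/-- The product `E^{ε(i)}` is a weight vector for the adjoint action of the diagonal matrices. -/
theorem uE_diag_mul_ePow (k : Fin (N + 1)) (i : Fin N → ℕ) :
    uE k k * ePow i = ePow i * (uE k k - algebraMap ℂ _ (xExp i k)) := by
  induction i using multiIndex_induction with
  | h0 =>
    have h1 : ePow (0 : Fin N → ℕ) = 1 := List.prod_eq_one fun x hx => by
      obtain ⟨p, rfl⟩ := List.mem_ofFn.mp hx
      simp
    rw [h1]
    simp [xExp]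
  | hs i q hi ih =>
    have h : uE k k * rootVec (simpleRoot q) = rootVec (simpleRoot q) *
        (uE k k - algebraMap ℂ _ ((xExp (Pi.single q 1) k : ℤ) : ℂ)) := by
      have h := uE_mul_uE k k q.succ q.castSucc
      rw [rootVec, simpleRoot]
      simp only
      rw [h, mul_sub, ← Algebra.commutes, ← Algebra.smul_def, xExp_single,
        sub_eq_add_neg (uE q.succ q.castSucc * uE k k), ← neg_smul]
      congr 1
      rw [Pi.sub_apply, Pi.single_apply, Pi.single_apply]
      by_cases h1 : k = q.succ
      · subst h1
        have h2 : q.castSucc ≠ q.succ := Fin.castSucc_lt_succ.ne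
        simp [h2, h2.symm]
      · by_cases h2 : q.castSucc = k
        · subst h2; simp [h1]
        · simp [h1, h2, Ne.symm h2]
    rw [ePow_add_single hi, ← mul_assoc, ih, mul_assoc, sub_mul, h, Algebra.commutes, ← mul_sub,
      mul_assoc, xExp_add, Pi.add_apply]
    congr 2
    rw [Int.cast_add, map_add]
    abel

/-- Commutation of a simple positive root vector with the product `E^{ε(i)}`. -/
theorem uE_raise_mul_ePow (q : Fin N) (i : Fin N → ℕ) :
    uE q.castSucc q.succ * ePow i = ePow i * uE q.castSucc q.succ +
      (i q : ℂ) • (ePow (i - Pi.single q 1) * (uE q.castSucc q.castSucc - uE q.succ q.succ +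
        algebraMap ℂ _ ((Fin.snoc i 0 : Fin (N + 1) → ℕ) q.succ - i q + 1))) := by
  induction i using multiIndex_induction with
  | h0 =>
    have h1 : ePow (0 : Fin N → ℕ) = 1 := List.prod_eq_one fun x hx => by
      obtain ⟨p, rfl⟩ := List.mem_ofFn.mp hx
      simp
    rw [h1]
    simp
  | hs i p hi ih =>
    set H : Ugl (N + 1) := uE q.castSucc q.castSucc - uE q.succ q.succ with hH
    have hsnoc : ∀ (i j : Fin N → ℕ) (k : Fin (N + 1)), (Fin.snoc (i + j) 0 : Fin (N + 1) → ℕ) k =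
        (Fin.snoc i 0 : Fin (N + 1) → ℕ) k + (Fin.snoc j 0 : Fin (N + 1) → ℕ) k := by
      intro i j k
      induction k using Fin.lastCases <;> simp
    -- The value of the root `q` on the root `p`, in the form in which it arises from `H`.
    have hHF : H * rootVec (simpleRoot p) = rootVec (simpleRoot p) * H +
        ((if q.castSucc = p.succ then (1 : ℂ) else 0) - (if p.castSucc = q.castSucc then 1 else 0)
          - (if q.succ = p.succ then 1 else 0) + (if p.castSucc = q.succ then 1 else 0)) •
          rootVec (simpleRoot p) := by
      have h1 := uE_mul_uE q.castSucc q.castSucc p.succ p.castSucc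
      have h2 := uE_mul_uE q.succ q.succ p.succ p.castSucc
      rw [hH, rootVec, simpleRoot]
      simp only
      rw [sub_mul, h1, h2]
      have e1 : (if q.castSucc = p.succ then uE q.castSucc p.castSucc else 0) =
          (if q.castSucc = p.succ then (1 : ℂ) else 0) • uE p.succ p.castSucc := by
        split_ifs with h
        · rw [h, one_smul]
        · rw [zero_smul]
      have e2 : (if p.castSucc = q.castSucc then uE p.succ q.castSucc else 0) =
          (if p.castSucc = q.castSucc then (1 : ℂ) else 0) • uE p.succ p.castSucc := by
        split_ifs with h
        · rw [h, one_smul]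
        · rw [zero_smul]
      have e3 : (if q.succ = p.succ then uE q.succ p.castSucc else 0) =
          (if q.succ = p.succ then (1 : ℂ) else 0) • uE p.succ p.castSucc := by
        split_ifs with h
        · rw [h, one_smul]
        · rw [zero_smul]
      have e4 : (if p.castSucc = q.succ then uE p.succ q.succ else 0) =
          (if p.castSucc = q.succ then (1 : ℂ) else 0) • uE p.succ p.castSucc := by
        split_ifs with h
        · rw [h, one_smul]
        · rw [zero_smul]
      rw [e1, e2, e3, e4, mul_sub]
      module
    have hXF : uE q.castSucc q.succ * rootVec (simpleRoot p) =
        rootVec (simpleRoot p) * uE q.castSucc q.succ + if p = q then H else 0 := by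
      have h1 := uE_mul_uE q.castSucc q.succ p.succ p.castSucc
      rw [rootVec, simpleRoot]
      simp only
      rw [h1]
      congr 1
      by_cases h : p = q
      · subst h; simp [hH]
      · simp [h, Ne.symm h]
    rw [ePow_add_single hi, ← mul_assoc, ih, add_mul, mul_assoc, hXF, smul_mul_assoc, mul_assoc,
      add_mul, hHF, Algebra.commutes]
    rcases lt_trichotomy p q with h | h | h
    · simp [hi q h, h.ne, h.ne', mul_assoc]
    · subst h
      have hs0 : (Fin.snoc i 0 : Fin (N + 1) → ℕ) p.succ = 0 := by
        by_cases hl : p.succ = Fin.last N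
        · rw [hl, Fin.snoc_last]
        · obtain ⟨r, hr⟩ : ∃ r : Fin N, p.succ = r.castSucc := ⟨p.succ.castPred hl, by simp⟩
          rw [hr, Fin.snoc_castSucc]
          refine hi r ?_
          simp only [Fin.ext_iff, Fin.val_succ, Fin.val_castSucc] at hr
          rw [Fin.lt_def]
          omega
      have hs1 : (Fin.snoc (Pi.single p 1 : Fin N → ℕ) 0 : Fin (N + 1) → ℕ) p.succ = 0 := by
        by_cases hl : p.succ = Fin.last N
        · rw [hl, Fin.snoc_last]
        · obtain ⟨r, hr⟩ : ∃ r : Fin N, p.succ = r.castSucc := ⟨p.succ.castPred hl, by simp⟩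
          rw [hr, Fin.snoc_castSucc, Pi.single_eq_of_ne]
          rintro rfl
          exact Fin.castSucc_lt_succ.ne' hr
      have n1 : p.castSucc ≠ p.succ := Fin.castSucc_lt_succ.ne
      rw [if_neg n1, if_pos rfl, if_pos rfl, if_pos rfl, hsnoc, hs0, hs1,
        add_tsub_cancel_right]
      rcases Nat.eq_zero_or_pos (i p) with h0 | h0
      · simp only [h0, Pi.add_apply, Pi.single_eq_same]
        simp [mul_add, mul_assoc]
      · have hi' : ∀ r, p < r → (i - Pi.single p 1 : Fin N → ℕ) r = 0 := fun r hr => by simp [hi r hr]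
        have hadd : i - Pi.single p 1 + Pi.single p 1 = i := by
          refine tsub_add_cancel_of_le fun z => ?_
          by_cases hz : z = p
          · subst hz; simpa using Nat.succ_le_of_lt h0
          · simp [hz]
        have he := ePow_add_single hi'
        rw [hadd] at he
        simp only [mul_add, mul_smul_comm, ← mul_assoc, ← he, Algebra.algebraMap_eq_smul_one,
          mul_one, Pi.add_apply, Pi.single_eq_same]
        push_cast
        module
    · have hqp : (i + Pi.single p 1 : Fin N → ℕ) q = i q := by simp [h.ne]
      have hpq : p.castSucc ≠ q.castSucc := fun e => h.ne' (Fin.castSucc_injective _ e)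
      have hpq2 : q.succ ≠ p.succ := fun e => h.ne (Fin.succ_injective _ e)
      have hpq3 : q.castSucc ≠ p.succ := fun e => by
        simp only [Fin.ext_iff, Fin.val_succ, Fin.val_castSucc, Fin.lt_def] at e h
        omega
      have hs1 : (Fin.snoc (Pi.single p 1 : Fin N → ℕ) 0 : Fin (N + 1) → ℕ) q.succ =
          if p.castSucc = q.succ then 1 else 0 := by
        by_cases hl : q.succ = Fin.last N
        · rw [hl, Fin.snoc_last, if_neg (Fin.castSucc_lt_last p).ne]
        · obtain ⟨r, hr⟩ : ∃ r : Fin N, q.succ = r.castSucc := ⟨q.succ.castPred hl, by simp⟩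
          rw [hr, Fin.snoc_castSucc, Pi.single_apply]
          simp [eq_comm]
      have hsub : i + Pi.single p 1 - Pi.single q 1 = i - Pi.single q 1 + Pi.single p 1 := by
        funext z
        by_cases hz : z = q
        · subst hz; simp [h.ne]
        · simp [hz]
      have hi' : ∀ r, p < r → (i - Pi.single q 1 : Fin N → ℕ) r = 0 := fun r hr => by simp [hi r hr]
      rw [hqp, hsnoc, hs1, hsub, ePow_add_single hi', if_neg hpq3, if_neg hpq, if_neg hpq2,
        if_neg h.ne']
      simp only [mul_add, mul_smul_comm, ← mul_assoc, Algebra.algebraMap_eq_smul_one,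
          mul_one, add_zero]
      push_cast
      module

theorem uE_raise_hwVector {n : ℕ} (lam : Fin n → ℂ) {i j : Fin n} (h : i < j) :
    uE i j • hwVector lam = 0 := by
  rw [smul_hwVector_eq_mkQ]
  exact (Submodule.Quotient.mk_eq_zero _).mpr (Submodule.subset_span (Or.inl ⟨i, j, h, rfl⟩))

theorem uE_diag_hwVector {n : ℕ} (lam : Fin n → ℂ) (i : Fin n) :
    uE i i • hwVector lam = lam i • hwVector lam :=
  (mem_weightSpace lam lam _).mp (hwVector_mem lam) i

theorem uE_diag_ePow_hwVector (lam : Fin (N + 1) → ℂ) (k : Fin (N + 1)) (i : Fin N → ℕ) :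
    uE k k • ePow i • hwVector lam = (lam k - xExp i k) • ePow i • hwVector lam := by
  rw [← mul_smul, uE_diag_mul_ePow, mul_smul, sub_smul, uE_diag_hwVector, algebraMap_smul,
    ← sub_smul, smul_comm]

theorem uE_raise_ePow_hwVector (lam : Fin (N + 1) → ℂ) (q : Fin N) (i : Fin N → ℕ) :
    uE q.castSucc q.succ • ePow i • hwVector lam =
      ((i q : ℂ) * (lam q.castSucc - lam q.succ +
        ((Fin.snoc i 0 : Fin (N + 1) → ℕ) q.succ - i q + 1))) •
        ePow (i - Pi.single q 1) • hwVector lam := by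
  rw [← mul_smul, uE_raise_mul_ePow, add_smul, mul_smul, uE_raise_hwVector lam
    Fin.castSucc_lt_succ, smul_zero, zero_add, smul_assoc, mul_smul, add_smul, sub_smul,
    uE_diag_hwVector, uE_diag_hwVector, algebraMap_smul, ← sub_smul, ← add_smul, mul_smul]
  congr 1
  exact smul_comm _ _ _

end Commutation

section Laurent

variable {n : ℕ} (lam : Fin n → ℂ) (mu : ℂ)

/-- The action of `U(gl(n))` on Laurent series. -/
noncomputable def laurentRep : Ugl n →ₐ[ℂ] Module.End ℂ (Laurent lam mu) :=
  UniversalEnvelopingAlgebra.lift ℂ (LieModule.toEnd ℂ (gl n) (Laurent lam mu))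

theorem laurentRep_ι (A : gl n) (f : Laurent lam mu) :
    laurentRep lam mu (UniversalEnvelopingAlgebra.ι ℂ A) f = ⁅A, f⁆ := by
  rw [laurentRep, UniversalEnvelopingAlgebra.lift_ι_apply]
  rfl

variable {lam mu}

theorem hom_smul_hwVector (Psi : Verma lam →ₗ⁅ℂ, gl n⁆ Laurent lam mu) (a : Ugl n) (w : Verma lam) :
    Psi (a • w) = laurentRep lam mu a (Psi w) := by
  let B : Subalgebra ℂ (Ugl n) :=
    { carrier := {a | ∀ w, Psi (a • w) = laurentRep lam mu a (Psi w)}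
      mul_mem' := fun {a b} ha hb w => by
        rw [mul_smul, ha, hb, map_mul, Module.End.mul_apply]
      add_mem' := fun {a b} ha hb w => by
        rw [add_smul, map_add, ha, hb, map_add, LinearMap.add_apply]
      algebraMap_mem' := fun r w => by
        rw [algebraMap_smul, map_smul, AlgHom.commutes, Module.algebraMap_end_apply] }
  let f : gl n →ₗ⁅ℂ⁆ B :=
    { toFun := fun A => ⟨UniversalEnvelopingAlgebra.ι ℂ A, fun w => by
        rw [← lie_verma, LieModuleHom.map_lie, laurentRep_ι]⟩
      map_add' := fun A A' => Subtype.ext (map_add _ _ _)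
      map_smul' := fun r A => Subtype.ext (map_smul _ _ _)
      map_lie' := fun {A A'} => Subtype.ext (LieHom.map_lie _ _ _) }
  have hid : B.val.comp (UniversalEnvelopingAlgebra.lift ℂ f) = AlgHom.id ℂ (Ugl n) := by
    apply UniversalEnvelopingAlgebra.hom_ext
    ext A
    simp [f]
  have h1 := (UniversalEnvelopingAlgebra.lift ℂ f a).2
  have h2 : ((UniversalEnvelopingAlgebra.lift ℂ f a : B) : Ugl n) = a := DFunLike.congr_fun hid a
  rw [h2] at h1
  exact h1 w

theorem hom_ext_hwVector {Psi Phi : Verma lam →ₗ⁅ℂ, gl n⁆ Laurent lam mu}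
    (h : Psi (hwVector lam) = Phi (hwVector lam)) : Psi = Phi := by
  ext w : 1
  obtain ⟨a, rfl⟩ := exists_smul_hwVector lam w
  rw [hom_smul_hwVector, hom_smul_hwVector, h]

theorem exists_laurent_hom (u : Laurent lam mu) (h1 : ∀ i j : Fin n, i < j → ⁅E i j, u⁆ = 0)
    (h2 : ∀ i : Fin n, ⁅E i i, u⁆ = lam i • u) :
    ∃ Phi : Verma lam →ₗ⁅ℂ, gl n⁆ Laurent lam mu, Phi (hwVector lam) = u := by
  obtain ⟨g, hg⟩ := exists_verma_lift lam (laurentRep lam mu) u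
    (fun i j hij => by rw [uE, laurentRep_ι, h1 i j hij])
    (fun i => by rw [uE, laurentRep_ι, h2 i])
  refine ⟨{ g with map_lie' := ?_ }, ?_⟩
  · intro A w
    obtain ⟨a, rfl⟩ := exists_smul_hwVector lam w
    change g ⁅A, a • hwVector lam⁆ = ⁅A, g (a • hwVector lam)⁆
    rw [lie_verma, ← mul_smul, hg, hg, map_mul, Module.End.mul_apply, laurentRep_ι]
  · have := hg 1
    rwa [one_smul, map_one, Module.End.one_apply] at this

end Laurent

section Singular

variable {m : ℕ} (lam : Fin (m + 2) → ℂ) (mu : ℂ)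

/-- The coefficient of `E^{ε(i)} v_lam x^{(i)}` in the singular vector. -/
noncomputable def singCoeff (i : Fin (m + 1) → ℕ) : ℂ :=
  (-1) ^ (∑ p, i p) * (descPochhammer ℂ (i (Fin.last m))).eval mu /
    ((∏ p, ((i p).factorial : ℂ)) * (descPochhammer ℂ (i (Fin.last m))).eval
      (lam (Fin.last m).castSucc - lam (Fin.last (m + 1))))

theorem coeff_singularVector_xExp (i : Fin (m + 1) → ℕ) :
    coeff lam mu (xExp i) (singularVector lam mu) =
      singCoeff lam mu i • ePow i • hwVector lam := by
  change ∑ᶠ (j : Fin (m + 1) → ℕ) (_ : xExp j = xExp i),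
    singCoeff lam mu j • ePow j • hwVector lam = _
  rw [finsum_eq_single _ i]
  · rw [finsum_eq_if, if_pos rfl]
  · intro j hj
    rw [finsum_eq_if, if_neg fun h => hj (xExp_injective h)]

theorem coeff_singularVector_of_ne {e : Fin (m + 2) → ℤ} (h : ∀ i, xExp i ≠ e) :
    coeff lam mu e (singularVector lam mu) = 0 := by
  change ∑ᶠ (j : Fin (m + 1) → ℕ) (_ : xExp j = e), singCoeff lam mu j • ePow j • hwVector lam = _
  exact finsum_eq_zero_of_forall_eq_zero fun i => by rw [finsum_eq_if, if_neg (h i)]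

variable {lam mu} {sigma : ℂ}

theorem descPochhammer_eval_ne_zero {c : ℂ} (hc : ∀ k : ℕ, c ≠ k) (k : ℕ) :
    (descPochhammer ℂ k).eval c ≠ 0 := by
  induction k with
  | zero => simp
  | succ k ih =>
    rw [descPochhammer_succ_eval]
    exact mul_ne_zero ih (sub_ne_zero.mpr (hc k))

/-- The recursion between the coefficients of the singular vector that makes the simple positive
root vectors kill it. -/
theorem singCoeff_recursion
    (hmu : ∀ i : Fin m, lam i.castSucc.castSucc - lam i.succ.castSucc = mu)
    (hsigma : lam (Fin.last m).castSucc - lam (Fin.last (m + 1)) = sigma)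
    (hsigma_nat : ∀ k : ℕ, sigma ≠ k) (q : Fin (m + 1)) (i : Fin (m + 1) → ℕ) :
    singCoeff lam mu (i + Pi.single q 1) * (((i q : ℂ) + 1) * (lam q.castSucc - lam q.succ +
      ((Fin.snoc i 0 : Fin (m + 2) → ℕ) q.succ - i q))) +
      (((Fin.snoc i 0 : Fin (m + 2) → ℕ) q.succ : ℂ) - i q + mu) * singCoeff lam mu i = 0 := by
  have hf := prod_factorial_ne_zero i
  have hq : ((i q : ℂ) + 1) ≠ 0 := Nat.cast_add_one_ne_zero _
  have hsum : ∑ p, (i + Pi.single q 1 : Fin (m + 1) → ℕ) p = ∑ p, i p + 1 := by simp [Finset.sum_add_distrib]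
  rw [singCoeff, singCoeff, hsum, prod_factorial_add_single, pow_succ, hsigma]
  have hd := descPochhammer_eval_ne_zero hsigma_nat (i (Fin.last m))
  induction q using Fin.lastCases with
  | last =>
    have hs : sigma - (i (Fin.last m) : ℂ) ≠ 0 := sub_ne_zero.mpr (hsigma_nat _)
    rw [Pi.add_apply, Pi.single_eq_same, descPochhammer_succ_eval, descPochhammer_succ_eval,
      Fin.succ_last, Fin.snoc_last, hsigma]
    push_cast
    field_simp
    ring
  | cast q =>
    have hne : (Fin.last m) ≠ q.castSucc := (Fin.castSucc_lt_last q).ne'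
    rw [Pi.add_apply, Pi.single_eq_of_ne hne, add_zero, Fin.succ_castSucc, Fin.snoc_castSucc, hmu]
    field_simp
    ring

theorem raise_singularVector
    (hmu : ∀ i : Fin m, lam i.castSucc.castSucc - lam i.succ.castSucc = mu)
    (hsigma : lam (Fin.last m).castSucc - lam (Fin.last (m + 1)) = sigma)
    (hsigma_nat : ∀ k : ℕ, sigma ≠ k) (q : Fin (m + 1)) :
    ⁅E q.castSucc q.succ, singularVector lam mu⁆ = 0 := by
  refine Laurent.ext lam mu fun e => ?_
  have hne : q.castSucc ≠ q.succ := Fin.castSucc_lt_succ.ne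
  have hd : ∀ e : Fin (m + 2) → ℤ, e - Pi.single q.castSucc 1 + Pi.single q.succ 1 =
      e - xExp (Pi.single q 1) := fun e => by rw [xExp_single]; abel
  rw [coeff_lie_E, if_neg hne, zero_smul, sub_zero, hd, map_zero]
  by_cases h : ∃ i, xExp i = e
  · obtain ⟨i, rfl⟩ := h
    rw [coeff_singularVector_xExp, lie_smul, lie_verma]
    change singCoeff lam mu i • uE q.castSucc q.succ • ePow i • hwVector lam + _ = 0
    rw [uE_raise_ePow_hwVector]
    rcases Nat.eq_zero_or_pos (i q) with h0 | h0
    -- If `i q = 0`, the shifted exponent is not of the form `x^{(j)}`, as `j q` would be `-1`.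
    · rw [coeff_singularVector_of_ne]
      · simp [h0]
      · intro j hj
        have h1 := sum_xExp_le j q
        have h2 : xExp i = xExp (j + Pi.single q 1) := by rw [xExp_add, hj]; abel
        have h3 := congrFun (xExp_injective h2) q
        rw [h0, Pi.add_apply, Pi.single_eq_same] at h3
        omega
    · obtain ⟨j, rfl⟩ : ∃ j, i = j + Pi.single q 1 := by
        refine ⟨i - Pi.single q 1, (tsub_add_cancel_of_le fun z => ?_).symm⟩
        by_cases hz : z = q
        · subst hz; simpa using Nat.succ_le_of_lt h0
        · simp [hz]
      have hsn : (Fin.snoc (j + Pi.single q 1) 0 : Fin (m + 2) → ℕ) q.succ =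
          (Fin.snoc j 0 : Fin (m + 2) → ℕ) q.succ := by
        induction q using Fin.lastCases with
        | last => simp
        | cast q =>
          rw [Fin.succ_castSucc, Fin.snoc_castSucc, Fin.snoc_castSucc, Pi.add_apply,
            Pi.single_eq_of_ne Fin.castSucc_lt_succ.ne', add_zero]
      rw [xExp_add, add_sub_cancel_right, coeff_singularVector_xExp, add_tsub_cancel_right,
        smul_smul, smul_smul, ← add_smul, hsn]
      have hrec := singCoeff_recursion hmu hsigma hsigma_nat q j
      have hx : (xExp j q.succ : ℂ) = ((Fin.snoc j 0 : Fin (m + 2) → ℕ) q.succ : ℂ) - j q := by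
        rw [xExp_apply, Fin.cons_succ]
        push_cast
        rfl
      rw [hx, Pi.add_apply, Pi.single_eq_same]
      convert zero_smul ℂ _ using 2
      rw [← hrec]
      push_cast
      ring
  · rw [coeff_singularVector_of_ne lam mu (fun i hi => h ⟨i, hi⟩), lie_zero, zero_add,
      coeff_singularVector_of_ne, smul_zero]
    intro i hi
    exact h ⟨i + Pi.single q 1, by rw [xExp_add, hi]; abel⟩

theorem diag_singularVector (k : Fin (m + 2)) :
    ⁅E k k, singularVector lam mu⁆ = lam k • singularVector lam mu := by
  refine Laurent.ext lam mu fun e => ?_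
  rw [coeff_lie_E, if_pos rfl, sub_add_cancel, map_smul, ← sub_smul, add_sub_cancel_right]
  by_cases h : ∃ i, xExp i = e
  · obtain ⟨i, rfl⟩ := h
    rw [coeff_singularVector_xExp, lie_smul, lie_verma]
    change singCoeff lam mu i • uE k k • ePow i • hwVector lam + _ = _
    rw [uE_diag_ePow_hwVector, smul_smul, smul_smul, smul_smul, ← add_smul]
    congr 1
    ring
  · rw [coeff_singularVector_of_ne lam mu (fun i hi => h ⟨i, hi⟩)]
    simp

/-- The simple positive root vectors generate the others. -/
theorem upper_singularVector
    (hmu : ∀ i : Fin m, lam i.castSucc.castSucc - lam i.succ.castSucc = mu)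
    (hsigma : lam (Fin.last m).castSucc - lam (Fin.last (m + 1)) = sigma)
    (hsigma_nat : ∀ k : ℕ, sigma ≠ k) (i j : Fin (m + 2)) (hij : i < j) :
    ⁅E i j, singularVector lam mu⁆ = 0 := by
  obtain ⟨i, hi⟩ := i
  obtain ⟨j, hj⟩ := j
  simp only [Fin.mk_lt_mk] at hij
  induction j, hij using Nat.le_induction with
  | base => exact raise_singularVector hmu hsigma hsigma_nat ⟨i, by omega⟩
  | succ j hij ih =>
    have hj' : j < m + 2 := by omega
    have h1 := ih hj'
    have h2 := raise_singularVector hmu hsigma hsigma_nat ⟨j, by omega⟩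
    have h3 := E_lie_E (⟨i, hi⟩ : Fin (m + 2)) ⟨j, hj'⟩ ⟨j, hj'⟩ ⟨j + 1, hj⟩
    rw [if_pos rfl, if_neg (by simp; omega), sub_zero] at h3
    rw [← h3, lie_lie, h1]
    change ⁅_, ⁅E (Fin.castSucc ⟨j, by omega⟩) (Fin.succ ⟨j, by omega⟩), singularVector lam mu⁆⁆ - _ = _
    rw [h2, lie_zero, lie_zero, sub_zero]

theorem exists_singular_hom
    (hmu : ∀ i : Fin m, lam i.castSucc.castSucc - lam i.succ.castSucc = mu)
    (hsigma : lam (Fin.last m).castSucc - lam (Fin.last (m + 1)) = sigma)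
    (hsigma_nat : ∀ k : ℕ, sigma ≠ k) :
    ∃ Phi : Verma lam →ₗ⁅ℂ, gl (m + 2)⁆ Laurent lam mu,
      Phi (hwVector lam) = singularVector lam mu :=
  exists_laurent_hom _ (upper_singularVector hmu hsigma hsigma_nat) diag_singularVector

end Singular

/-! ### Expansion of the homomorphism on PBW vectors -/

section Binomial

variable {A ι : Type*} [Ring A] [DecidableEq ι]

/-- The families bounded by `β` and supported in the list `l`. -/
def listBox [Fintype ι] (l : List ι) (β : ι → ℕ) : Finset (ι → ℕ) :=
  Fintype.piFinset fun x => if x ∈ l then Finset.range (β x + 1) else {0}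

theorem mem_listBox [Fintype ι] {l : List ι} {β γ : ι → ℕ} :
    γ ∈ listBox l β ↔ ∀ x, γ x ≤ β x ∧ (x ∉ l → γ x = 0) := by
  rw [listBox, Fintype.mem_piFinset]
  refine forall_congr' fun x => ?_
  split_ifs with h
  · simp [h]
  · simp only [h, not_false_eq_true, forall_const, Finset.mem_singleton]
    exact ⟨fun h0 => ⟨h0 ▸ Nat.zero_le _, h0⟩, fun h0 => h0.2⟩

/-- The binomial theorem for an ordered product of powers of sums `c x + d x`, where all `c x`
commute with all `d y`. -/
theorem list_prod_add_pow [Fintype ι] (c d : ι → A) (h : ∀ x y, Commute (c x) (d y)) {l : List ι}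
    (hl : l.Nodup) (β : ι → ℕ) :
    (l.map fun x => (c x + d x) ^ β x).prod = ∑ γ ∈ listBox l β,
      (∏ x, (β x).choose (γ x)) •
        ((l.map fun x => d x ^ γ x).prod * (l.map fun x => c x ^ (β x - γ x)).prod) := by
  induction l with
  | nil =>
    have : listBox ([] : List ι) β = {0} := by
      ext γ
      rw [mem_listBox, Finset.mem_singleton, funext_iff]
      exact forall_congr' fun x =>
        ⟨fun h => h.2 List.not_mem_nil, fun h => ⟨by simp [h], fun _ => by simp [h]⟩⟩
    simp [this]
  | cons a l ih =>
    obtain ⟨ha, hl⟩ := List.nodup_cons.mp hl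
    rw [List.map_cons, List.prod_cons, ih hl, add_comm (c a), (h a a).symm.add_pow,
      Finset.sum_mul_sum, ← Finset.sum_product']
    refine Finset.sum_bij' (fun p _ => Function.update p.2 a p.1)
      (fun γ _ => (γ a, Function.update γ a 0)) ?_ ?_ ?_ ?_ ?_
    · rintro ⟨k, γ⟩ hp
      rw [Finset.mem_product, mem_listBox, Finset.mem_range] at hp
      rw [mem_listBox]
      intro x
      by_cases hx : x = a
      · subst hx
        simpa using Nat.lt_succ_iff.mp hp.1
      · simpa [hx] using hp.2 x
    · intro γ hγ
      rw [mem_listBox] at hγ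
      rw [Finset.mem_product, mem_listBox, Finset.mem_range]
      refine ⟨Nat.lt_succ_iff.mpr (hγ a).1, fun x => ?_⟩
      by_cases hx : x = a
      · subst hx; simp
      · simpa [hx] using hγ x
    · rintro ⟨k, γ⟩ hp
      rw [Finset.mem_product, mem_listBox] at hp
      have h0 : γ a = 0 := (hp.2 a).2 ha
      simp [← h0]
    · intro γ _
      simp
    · rintro ⟨k, γ⟩ hp
      rw [Finset.mem_product, mem_listBox] at hp
      have h0 : γ a = 0 := (hp.2 a).2 ha
      have hne : ∀ x ∈ l, x ≠ a := fun x hx => by rintro rfl; exact ha hx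
      have e1 : (l.map fun x => d x ^ (Function.update γ a k) x) = l.map fun x => d x ^ γ x :=
        List.map_congr_left fun x hx => by rw [Function.update_of_ne (hne x hx)]
      have e2 : (l.map fun x => c x ^ (β x - (Function.update γ a k) x)) =
          l.map fun x => c x ^ (β x - γ x) :=
        List.map_congr_left fun x hx => by rw [Function.update_of_ne (hne x hx)]
      have e3 : ∏ x, (β x).choose (Function.update γ a k x) =
          (β a).choose k * ∏ x, (β x).choose (γ x) := by
        rw [← Finset.mul_prod_erase Finset.univ _ (Finset.mem_univ a),
          ← Finset.mul_prod_erase Finset.univ (fun x => (β x).choose (γ x)) (Finset.mem_univ a),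
          Function.update_self, h0, Nat.choose_zero_right, one_mul]
        congr 1
        exact Finset.prod_congr rfl fun x hx => by
          rw [Function.update_of_ne (Finset.ne_of_mem_erase hx)]
      have hcomm : Commute (c a ^ (β a - k)) (l.map fun x => d x ^ γ x).prod := by
        refine Commute.list_prod_right _ _ fun y hy => ?_
        obtain ⟨x, _, rfl⟩ := List.mem_map.mp hy
        exact (h a x).pow_pow _ _
      simp only [List.map_cons, List.prod_cons, e1, e2, e3, Function.update_self]
      rw [mul_smul_comm, mul_comm ((β a).choose k), mul_smul, ← Nat.cast_comm, mul_assoc,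
        ← nsmul_eq_mul]
      congr 2
      rw [mul_assoc, ← mul_assoc (c a ^ (β a - k)), hcomm.eq]
      simp only [mul_assoc]

end Binomial

section PointPowers

variable {N : ℕ} (lam : Fin (N + 1) → ℂ) (mu : ℂ)

/-- The off-diagonal entries of the operators on monomials do not involve the correction `mu δ_{j,k}`. -/
theorem coeff_pointOp_root (x : NegRoot (N + 1)) (f : Laurent lam mu) (e : Fin (N + 1) → ℤ) :
    coeff lam mu e (pointOp lam mu x.1.1 x.1.2 f) = ((e x.1.2 : ℂ) + mu + 1) •
      coeff lam mu (e + (Pi.single x.1.2 1 - Pi.single x.1.1 1)) f := by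
  rw [coeff_pointOp, if_neg x.2.ne', zero_smul, sub_zero]
  have h : e - Pi.single x.1.1 1 + Pi.single x.1.2 1 =
      e + (Pi.single x.1.2 1 - Pi.single x.1.1 1) := by abel
  rw [h]
  congr 1
  simp [x.2.ne]
  ring

theorem coeff_pointOp_pow (x : NegRoot (N + 1)) (c : ℕ) (f : Laurent lam mu)
    (e : Fin (N + 1) → ℤ) :
    coeff lam mu e ((pointOp lam mu x.1.1 x.1.2 ^ c) f) =
      (ascPochhammer ℂ c).eval ((e x.1.2 : ℂ) + mu + 1) •
        coeff lam mu (e + c • (Pi.single x.1.2 1 - Pi.single x.1.1 1)) f := by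
  induction c generalizing e with
  | zero => simp
  | succ c ih =>
    rw [pow_succ', Module.End.mul_apply, coeff_pointOp_root, ih, smul_smul, add_assoc e,
      ← succ_nsmul', ascPochhammer_succ_left]
    congr 1
    simp [x.2.ne]
    left
    congr 1
    ring

/-- The exponent shift `∑ γ_{j,k} (ε_k - ε_j)`. -/
def weightShift {n : ℕ} (γ : NegRoot n → ℕ) : Fin n → ℤ :=
  ∑ x, γ x • (Pi.single x.1.2 1 - Pi.single x.1.1 1)

theorem weightShift_add {n : ℕ} (γ γ' : NegRoot n → ℕ) :
    weightShift (γ + γ') = weightShift γ + weightShift γ' := by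
  simp [weightShift, add_smul, Finset.sum_add_distrib]

theorem weightShift_single {n : ℕ} (x : NegRoot n) (c : ℕ) :
    weightShift (Pi.single x c) = c • (Pi.single x.1.2 1 - Pi.single x.1.1 1) := by
  rw [weightShift, Finset.sum_eq_single x]
  · simp
  · intro y _ hy; simp [hy]
  · simp

/-- The ordered product of the operators `(x_j ∂_{x_k})^γ_{j,k}` on monomials. In each variable all
differentiations are performed before all multiplications, so that the scalars combine to rising
factorials. -/
theorem coeff_list_pointOp {l : List (NegRoot (N + 1))} (hl : IsFinalSegment l)
    (γ : NegRoot (N + 1) → ℕ) (hγ : ∀ x, x ∉ l → γ x = 0) (f : Laurent lam mu)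
    (e : Fin (N + 1) → ℤ) :
    coeff lam mu e ((l.map fun x => pointOp lam mu x.1.1 x.1.2 ^ γ x).prod f) =
      (∏ s, (ascPochhammer ℂ (upperSum γ s)).eval ((e s : ℂ) + mu + 1 - lowerSum γ s)) •
        coeff lam mu (e + weightShift γ) f := by
  classical
  induction l generalizing γ e with
  | nil =>
    have : γ = 0 := funext fun x => hγ x List.not_mem_nil
    subst this
    simp [weightShift, upperSum]
  | cons a l ih =>
    obtain ⟨γ', c, rfl, hγ'⟩ : ∃ (γ' : NegRoot (N + 1) → ℕ) (c : ℕ), γ = γ' + Pi.single a c ∧ ∀ x, x ∉ l → γ' x = 0 := by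
      refine ⟨Function.update γ a 0, γ a, ?_, ?_⟩
      · funext x
        by_cases hx : x = a
        · subst hx; simp
        · simp [hx]
      · intro x hx
        by_cases hxa : x = a
        · subst hxa; simp
        · rw [Function.update_of_ne hxa]
          exact hγ x (by simp [hx, hxa])
    have e1 : (l.map fun x => pointOp lam mu x.1.1 x.1.2 ^ (γ' + Pi.single a c : NegRoot (N + 1) → ℕ) x) =
        l.map fun x => pointOp lam mu x.1.1 x.1.2 ^ γ' x :=
      List.map_congr_left fun x hx => by
        have : x ≠ a := by rintro rfl; exact hl.notMem hx
        simp [this]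
    have hlow : ∀ s, s < a.1.1 → lowerSum γ' s = 0 := by
      intro s hs
      refine Finset.sum_eq_zero fun x hx => hγ' x fun hxl => ?_
      have h1 := (hl.le x hxl).row_le
      rw [(Finset.mem_filter.mp hx).2] at h1
      exact absurd hs h1.not_gt
    have ha0 : γ' a = 0 := hγ' a hl.notMem
    rw [List.map_cons, List.prod_cons, e1, Module.End.mul_apply, coeff_pointOp_pow, ih hl.tail γ' hγ',
      smul_smul, weightShift_add, weightShift_single, Pi.add_apply, ha0, zero_add,
      Pi.single_eq_same, add_comm (weightShift γ'), ← add_assoc e]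
    congr 1
    symm
    refine prod_eq_mul_prod a.1.2 _ ?_ fun s hs => ?_
    · rw [upperSum_add, lowerSum_add, upperSum_single, lowerSum_single, if_pos rfl,
        if_neg a.2.ne', hlow _ a.2, add_comm _ c, ← ascPochhammer_mul]
      simp [a.2.ne]
      left
      congr 1
      ring
    · rw [upperSum_add, lowerSum_add, upperSum_single, lowerSum_single, if_neg (Ne.symm hs),
        add_zero]
      congr 1
      by_cases h : a.1.1 = s
      · subst h
        simp [hs]
        ring
      · simp [hs, h, Ne.symm h]

theorem coeff_list_coeffAct (l : List (NegRoot (N + 1))) (β : NegRoot (N + 1) → ℕ)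
    (f : Laurent lam mu) (e : Fin (N + 1) → ℤ) :
    coeff lam mu e ((l.map fun x => coeffAct lam mu (E x.1.1 x.1.2) ^ β x).prod f) =
      listPbw l β • coeff lam mu e f := by
  have hpow : ∀ (x : NegRoot (N + 1)) (c : ℕ) (f : Laurent lam mu),
      coeff lam mu e ((coeffAct lam mu (E x.1.1 x.1.2) ^ c) f) =
        rootVec x ^ c • coeff lam mu e f := by
    intro x c
    induction c with
    | zero => simp
    | succ c ih =>
      intro f
      rw [pow_succ', Module.End.mul_apply, coeff_coeffAct, ih, lie_verma, pow_succ', mul_smul]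
      rfl
  induction l with
  | nil => simp [listPbw]
  | cons a l ih =>
    rw [List.map_cons, List.prod_cons, Module.End.mul_apply, hpow, ih, listPbw_cons, mul_smul]

/-- The action of a PBW monomial on a Laurent series. -/
theorem coeff_laurentRep_pbw (β : NegRoot (N + 1) → ℕ) (f : Laurent lam mu) :
    coeff lam mu 0 (laurentRep lam mu (pbw β) f) = ∑ γ ∈ Finset.Iic β,
      ((∏ x, ((β x).choose (γ x) : ℂ)) *
        ∏ s, (ascPochhammer ℂ (upperSum γ s)).eval (mu + 1 - lowerSum γ s)) •
          pbw (β - γ) • coeff lam mu (weightShift γ) f := by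
  classical
  have h1 : laurentRep lam mu (pbw β) = ((rootList (N + 1)).map fun x =>
      (coeffAct lam mu (E x.1.1 x.1.2) + pointOp lam mu x.1.1 x.1.2) ^ β x).prod := by
    rw [pbw, listPbw, map_list_prod, List.map_map]
    congr 1
    refine List.map_congr_left fun x _ => ?_
    rw [Function.comp_apply, map_pow]
    congr 1
    refine LinearMap.ext fun f => ?_
    rw [rootVec, uE, laurentRep_ι]
    change coeffAct lam mu _ f + pointAct lam mu _ f = _
    rw [pointAct_E]
    rfl
  have h2 : listBox (rootList (N + 1)) β = Finset.Iic β := by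
    ext γ
    rw [mem_listBox, Finset.mem_Iic]
    exact forall_congr' fun x => and_iff_left fun h => absurd (mem_rootList x) h
  rw [h1, list_prod_add_pow _ _ (fun x y => coeffAct_pointOp lam mu _ _ _)
    isFinalSegment_rootList.nodup, h2, LinearMap.sum_apply, map_sum]
  refine Finset.sum_congr rfl fun γ _ => ?_
  rw [LinearMap.smul_apply, map_nsmul, Module.End.mul_apply,
    coeff_list_pointOp lam mu isFinalSegment_rootList γ (fun x h => absurd (mem_rootList x) h),
    coeff_list_coeffAct, ← Nat.cast_smul_eq_nsmul ℂ, smul_smul, zero_add]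
  push_cast
  simp only [Pi.zero_apply, Int.cast_zero, zero_add]
  rfl

end PointPowers

section CumSum

variable {N : ℕ}

theorem upperSum_cumSum {n : ℕ} (γ : NegRoot n → ℕ) (s : Fin n) :
    upperSum (cumSum γ) s = ∑ x : NegRoot n with x.1.2 ≤ s ∧ s < x.1.1, γ x := by
  have h : ∀ y : NegRoot n, cumSum γ y =
      ∑ x : NegRoot n, if x.1.1 = y.1.1 ∧ x.1.2 ≤ y.1.2 then γ x else 0 := fun y => by
    rw [cumSum, Finset.sum_filter]
  rw [upperSum, Finset.sum_congr rfl fun y _ => h y, Finset.sum_comm, Finset.sum_filter]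
  refine Finset.sum_congr rfl fun x _ => ?_
  split_ifs with hx
  · rw [Finset.sum_eq_single ⟨(x.1.1, s), hx.2⟩]
    · simp [hx.1]
    · intro y hy hne
      rw [if_neg]
      rintro ⟨h1, -⟩
      exact hne (Subtype.ext (Prod.ext h1.symm (Finset.mem_filter.mp hy).2))
    · simp
  · refine Finset.sum_eq_zero fun y hy => ?_
    rw [if_neg]
    rintro ⟨h1, h2⟩
    have hy2 := (Finset.mem_filter.mp hy).2
    exact hx ⟨hy2 ▸ h2, hy2 ▸ h1 ▸ y.2⟩

/-- The column sums of `cumSum γ`: the multiplicities of the simple roots in the weight of `γ`. -/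
def simpleMult (γ : NegRoot (N + 1) → ℕ) (p : Fin N) : ℕ := upperSum (cumSum γ) p.castSucc

/-- The only `x^{(i)}` that meets the exponent shift of `γ` is the one with `i = simpleMult γ`. -/
theorem xExp_simpleMult (γ : NegRoot (N + 1) → ℕ) : xExp (simpleMult γ) = weightShift γ := by
  have hind : ∀ x : NegRoot (N + 1),
      xExp (fun p : Fin N => if x.1.2 ≤ p.castSucc ∧ p.castSucc < x.1.1 then 1 else 0) =
        Pi.single x.1.2 1 - Pi.single x.1.1 1 := by
    intro x
    have hx := x.2
    funext t
    have h1 : (Fin.snoc (fun p : Fin N => if x.1.2 ≤ p.castSucc ∧ p.castSucc < x.1.1 then 1 else 0)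
        0 : Fin (N + 1) → ℕ) t = if x.1.2 ≤ t ∧ t < x.1.1 then 1 else 0 := by
      induction t using Fin.lastCases with
      | last => rw [Fin.snoc_last, if_neg fun h => (Fin.le_last _).not_gt h.2]
      | cast p => rw [Fin.snoc_castSucc]
    have h2 : (Fin.cons 0 (fun p : Fin N => if x.1.2 ≤ p.castSucc ∧ p.castSucc < x.1.1 then 1
        else 0) : Fin (N + 1) → ℕ) t = if x.1.2 < t ∧ t ≤ x.1.1 then 1 else 0 := by
      induction t using Fin.cases with
      | zero => rw [Fin.cons_zero, if_neg fun h => (Fin.zero_le _).not_gt h.1]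
      | succ p =>
        rw [Fin.cons_succ]
        simp only [Fin.le_castSucc_iff, Fin.castSucc_lt_iff_succ_le]
    rw [xExp_apply, h1, h2, Pi.sub_apply, Pi.single_apply, Pi.single_apply]
    simp only [Fin.lt_def, Fin.le_def, Fin.ext_iff] at hx ⊢
    split_ifs <;> omega
  have hsum : simpleMult γ = ∑ x : NegRoot (N + 1), γ x •
      fun p : Fin N => if x.1.2 ≤ p.castSucc ∧ p.castSucc < x.1.1 then 1 else 0 := by
    funext p
    rw [simpleMult, upperSum_cumSum, Finset.sum_filter, Finset.sum_apply]
    refine Finset.sum_congr rfl fun x _ => ?_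
    simp
  let X : (Fin N → ℕ) →+ (Fin (N + 1) → ℤ) :=
    { toFun := xExp, map_zero' := by simp [xExp], map_add' := xExp_add }
  change X (simpleMult γ) = _
  rw [hsum, map_sum, weightShift]
  refine Finset.sum_congr rfl fun x _ => ?_
  rw [map_nsmul]
  congr 1
  exact hind x

theorem sum_simpleMult (γ : NegRoot (N + 1) → ℕ) : ∑ p, simpleMult γ p = ∑ y, cumSum γ y := by
  have h := Finset.sum_fiberwise (Finset.univ : Finset (NegRoot (N + 1))) (fun x => x.1.2)
    (cumSum γ)
  rw [← h, Fin.sum_univ_castSucc]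
  have h0 : ∑ x : NegRoot (N + 1) with x.1.2 = Fin.last N, cumSum γ x = 0 := by
    refine Finset.sum_eq_zero fun x hx => ?_
    have h1 := x.2
    rw [(Finset.mem_filter.mp hx).2] at h1
    exact absurd h1 (Fin.le_last _).not_gt
  rw [h0, add_zero]
  rfl

theorem simpleMult_last (m : ℕ) (γ : NegRoot (m + 2) → ℕ) :
    simpleMult γ (Fin.last m) = lowerSum γ (Fin.last (m + 1)) := by
  rw [simpleMult, upperSum_cumSum, lowerSum]
  refine Finset.sum_congr ?_ fun _ _ => rfl
  ext x
  have h1 := x.2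
  have h2 := x.1.1.isLt
  simp only [Finset.mem_filter, Finset.mem_univ, true_and, Fin.le_def, Fin.lt_def, Fin.ext_iff,
    Fin.val_castSucc, Fin.val_last] at h1 h2 ⊢
  omega

theorem le_cumSum {n : ℕ} (γ : NegRoot n → ℕ) (y : NegRoot n) : γ y ≤ cumSum γ y := by
  rw [cumSum_eq]
  exact Nat.le_add_right _ _

end CumSum

section Diagonal

variable {m : ℕ} {lam : Fin (m + 2) → ℂ} {mu : ℂ}

theorem pathTerm_eq {N : ℕ} (tau : Fin (N + 1) → ℂ) (theta : ℂ) (x : NegRoot (N + 1) → ℂ)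
    (γ : NegRoot (N + 1) → ℕ) :
    pathTerm tau theta x γ = pathTerm tau theta 1 γ * ∏ p, x p ^ γ p := by
  simp [pathTerm]

/-- The diagonal coefficient of the `x^0`-part of the homomorphism at a PBW vector. -/
theorem repr_diagonal {sigma : ℂ}
    (hsigma : lam (Fin.last m).castSucc - lam (Fin.last (m + 1)) = sigma)
    (hsigma_nat : ∀ k : ℕ, sigma ≠ k)
    (Phi : Verma lam →ₗ⁅ℂ, gl (m + 2)⁆ Laurent lam mu)
    (hPhi : Phi (hwVector lam) = singularVector lam mu) (β : NegRoot (m + 2) → ℕ) :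
    (pbwBasis lam).repr (coeff lam mu 0 (Phi (pbwBasis lam β))) β =
      ∑ γ ∈ Finset.Iic β, (-1) ^ (∑ y, cumSum γ y) *
        pathTerm (fun s => if s = Fin.last (m + 1) then -mu else mu + 1) (-sigma) 1 γ *
          ∏ y, ((β y).choose (cumSum γ y) : ℂ) := by
  rw [pbwBasis_apply, hom_smul_hwVector, hPhi, coeff_laurentRep_pbw, map_sum,
    Finsupp.finsetSum_apply]
  refine Finset.sum_congr rfl fun γ hγ => ?_
  have hsing : singCoeff lam mu (simpleMult γ) * ∏ p, ((simpleMult γ p).factorial : ℂ) =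
      (-1) ^ (∑ y, cumSum γ y) *
        ((ascPochhammer ℂ (lowerSum γ (Fin.last (m + 1)))).eval (-mu) /
          (ascPochhammer ℂ (lowerSum γ (Fin.last (m + 1)))).eval (-sigma)) := by
    have hd := descPochhammer_eval_ne_zero hsigma_nat (lowerSum γ (Fin.last (m + 1)))
    have hf := prod_factorial_ne_zero (simpleMult γ)
    rw [singCoeff, sum_simpleMult, simpleMult_last, hsigma,
      ascPochhammer_eval_neg_eq_descPochhammer, ascPochhammer_eval_neg_eq_descPochhammer,
      mul_div_mul_left _ _ (pow_ne_zero _ (by norm_num : (-1 : ℂ) ≠ 0))]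
    field_simp
  have hasc : ∏ s, (ascPochhammer ℂ (upperSum γ s)).eval (mu + 1 - (lowerSum γ s : ℂ)) =
      ∏ s : Fin (m + 1), (ascPochhammer ℂ (upperSum γ s.castSucc)).eval
        (mu + 1 - (lowerSum γ s.castSucc : ℂ)) := by
    have h0 : upperSum γ (Fin.last (m + 1)) = 0 := by
      refine Finset.sum_eq_zero fun x hx => ?_
      have h1 := x.2
      rw [(Finset.mem_filter.mp hx).2] at h1
      exact absurd h1 (Fin.le_last _).not_gt
    rw [Fin.prod_univ_castSucc, h0]
    simp
  have hchoose := prod_choose_mul_expCoeff β γ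
  rw [← xExp_simpleMult, coeff_singularVector_xExp, smul_comm (pbw (β - γ)), ← mul_smul (pbw _),
    map_smul, map_smul, Finsupp.smul_apply, Finsupp.smul_apply, smul_eq_mul, smul_eq_mul]
  have hrep := repr_pbw_mul_ePow lam (Finset.mem_Iic.mp hγ)
  change _ = (∏ p, ((simpleMult γ p).factorial : ℂ)) * _ at hrep
  change _ * (_ * (pbwBasis lam).repr ((pbw (β - γ) * ePow (fun p => upperSum (cumSum γ) p.castSucc))
    • hwVector lam) β) = _
  rw [hrep, hasc]
  have hlast : ∀ s : Fin (m + 1), s.castSucc ≠ Fin.last (m + 1) := fun s => (Fin.castSucc_lt_last s).ne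
  simp only [pathTerm, hlast, if_true, if_false, Pi.one_apply, one_pow, Finset.prod_const_one,
    mul_one]
  have hf := prod_factorial_ne_zero γ
  rw [eq_div_iff hf] at hchoose
  set P := ∏ s : Fin (m + 1), (ascPochhammer ℂ (upperSum γ s.castSucc)).eval
        (mu + 1 - (lowerSum γ s.castSucc : ℂ))
  rw [← hchoose]
  calc _ = P * (singCoeff lam mu (simpleMult γ) * ∏ p, ((simpleMult γ p).factorial : ℂ)) *
        ((∏ x, ((β x).choose (γ x) : ℂ)) * expCoeff (β - γ) (cumSum γ)) := by ring
    _ = _ := by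
      rw [hsing, mul_comm (∏ p, ((γ p).factorial : ℂ)), ← div_div]
      field_simp

end Diagonal

/-! ### Traces over weight spaces -/

section Trace

variable {N : ℕ} (lam : Fin (N + 1) → ℂ)

/-- The weight of the PBW vector `E^β v_lam`. -/
noncomputable def pbwWeight (β : NegRoot (N + 1) → ℕ) : Fin (N + 1) → ℂ :=
  fun k => lam k - (weightShift β k : ℂ)

theorem uE_diag_mul_listPbw (k : Fin (N + 1)) (l : List (NegRoot (N + 1)))
    (β : NegRoot (N + 1) → ℕ) :
    uE k k * listPbw l β = listPbw l β * (uE k k -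
      algebraMap ℂ _ (((l.map fun x => (β x • (Pi.single x.1.2 1 - Pi.single x.1.1 1) :
        Fin (N + 1) → ℤ)).sum k : ℤ) : ℂ)) := by
  have hroot : ∀ x : NegRoot (N + 1), uE k k * rootVec x = rootVec x * (uE k k -
      algebraMap ℂ _ (((Pi.single x.1.2 1 - Pi.single x.1.1 1 : Fin (N + 1) → ℤ) k : ℤ) : ℂ)) := by
    intro x
    have h := uE_mul_uE k k x.1.1 x.1.2
    rw [rootVec, h, mul_sub, ← Algebra.commutes, ← Algebra.smul_def,
      sub_eq_add_neg (uE x.1.1 x.1.2 * uE k k), ← neg_smul]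
    congr 1
    rw [Pi.sub_apply, Pi.single_apply, Pi.single_apply]
    by_cases h1 : k = x.1.1
    · have h2 : x.1.2 ≠ k := h1 ▸ x.2.ne
      rw [if_pos h1, if_neg h2, if_neg h2.symm, if_pos h1, ← h1]
      simp
    · by_cases h2 : x.1.2 = k
      · rw [if_neg h1, if_pos h2, if_pos h2.symm, if_neg h1, ← h2]
        simp
      · simp [h1, h2, Ne.symm h2]
  have hpow : ∀ (x : NegRoot (N + 1)) (c : ℕ), uE k k * rootVec x ^ c = rootVec x ^ c * (uE k k -
      algebraMap ℂ _ (((c • (Pi.single x.1.2 1 - Pi.single x.1.1 1) :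
        Fin (N + 1) → ℤ) k : ℤ) : ℂ)) := by
    intro x c
    induction c with
    | zero => simp
    | succ c ih =>
      rw [pow_succ, ← mul_assoc, ih, mul_assoc, sub_mul, hroot, Algebra.commutes, ← mul_sub,
        mul_assoc, succ_nsmul, Pi.add_apply, Int.cast_add, map_add]
      congr 2
      abel
  induction l with
  | nil => simp [listPbw]
  | cons a l ih =>
    rw [listPbw_cons, ← mul_assoc, hpow, mul_assoc, sub_mul, ih, Algebra.commutes, ← mul_sub,
      mul_assoc, List.map_cons, List.sum_cons, Pi.add_apply, Int.cast_add, map_add]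
    congr 2
    abel

theorem pbwBasis_mem_weightSpace (β : NegRoot (N + 1) → ℕ) :
    pbwBasis lam β ∈ weightSpace lam (pbwWeight lam β) := by
  classical
  rw [mem_weightSpace]
  intro k
  rw [pbwBasis_apply, lie_verma]
  change uE k k • pbw β • hwVector lam = _
  have hsum : ((rootList (N + 1)).map fun x => (β x • (Pi.single x.1.2 1 - Pi.single x.1.1 1) :
        Fin (N + 1) → ℤ)).sum = weightShift β := by
    have huniv : (Finset.univ : Finset (NegRoot (N + 1))) = (rootList (N + 1)).toFinset := by
      ext x; simp [mem_rootList]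
    rw [weightShift, huniv, List.sum_toFinset _ isFinalSegment_rootList.nodup]
  rw [← mul_smul, pbw, uE_diag_mul_listPbw, hsum, mul_smul, sub_smul, uE_diag_hwVector,
    algebraMap_smul, ← sub_smul, smul_comm]
  rfl

variable {lam} in
theorem pbwBasis_mem_weightSpace' {β : NegRoot (N + 1) → ℕ} {nu : Fin (N + 1) → ℂ}
    (h : pbwWeight lam β = nu) : pbwBasis lam β ∈ weightSpace lam nu :=
  h ▸ pbwBasis_mem_weightSpace lam β

/-- Only finitely many PBW vectors have a given weight. -/
theorem finite_pbwWeight_fiber (nu : Fin (N + 1) → ℂ) :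
    Finite {β : NegRoot (N + 1) → ℕ // pbwWeight lam β = nu} := by
  -- The height of the weight bounds every exponent.
  have hheight : ∀ β : NegRoot (N + 1) → ℕ, ∑ k : Fin (N + 1), ((k : ℕ) : ℂ) * (lam k - pbwWeight lam β k) =
      -∑ x : NegRoot (N + 1), (β x : ℂ) * (((x.1.1 : ℕ) : ℂ) - ((x.1.2 : ℕ) : ℂ)) := by
    intro β
    simp only [pbwWeight, sub_sub_cancel, weightShift, Finset.sum_apply, Int.cast_sum,
      Finset.mul_sum]
    rw [Finset.sum_comm, ← Finset.sum_neg_distrib]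
    refine Finset.sum_congr rfl fun x _ => ?_
    simp only [Pi.smul_apply, Pi.sub_apply, Pi.single_apply, nsmul_eq_mul,
      Int.cast_natCast, Int.cast_sub, Int.cast_ite, Int.cast_zero, mul_sub, mul_ite,
      mul_one, mul_zero, Finset.sum_sub_distrib, Finset.sum_ite_eq', Finset.mem_univ, if_true]
    ring
  rcases isEmpty_or_nonempty {β : NegRoot (N + 1) → ℕ // pbwWeight lam β = nu} with h | ⟨⟨β₀, h₀⟩⟩
  · infer_instance
  have key : ∀ β : NegRoot (N + 1) → ℕ, pbwWeight lam β = nu →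
      ∑ x : NegRoot (N + 1), β x * ((x.1.1 : ℕ) - (x.1.2 : ℕ)) =
        ∑ x : NegRoot (N + 1), β₀ x * ((x.1.1 : ℕ) - (x.1.2 : ℕ)) := by
    intro β hβ
    have h1 := (hheight β).symm.trans ((congrArg (fun w : Fin (N + 1) → ℂ =>
      ∑ k : Fin (N + 1), ((k : ℕ) : ℂ) * (lam k - w k)) (hβ.trans h₀.symm)).trans (hheight β₀))
    have h2 : ∀ β : NegRoot (N + 1) → ℕ,
        ((∑ x : NegRoot (N + 1), β x * ((x.1.1 : ℕ) - (x.1.2 : ℕ)) : ℕ) : ℂ) =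
          ∑ x : NegRoot (N + 1), (β x : ℂ) * (((x.1.1 : ℕ) : ℂ) - ((x.1.2 : ℕ) : ℂ)) := by
      intro β
      rw [Nat.cast_sum]
      refine Finset.sum_congr rfl fun x _ => ?_
      rw [Nat.cast_mul, Nat.cast_sub (Fin.le_def.mp x.2.le)]
    rw [← h2, ← h2, neg_inj] at h1
    exact_mod_cast h1
  set B := ∑ x : NegRoot (N + 1), β₀ x * ((x.1.1 : ℕ) - (x.1.2 : ℕ))
  have hfin : (Set.Iic (fun _ : NegRoot (N + 1) => B)).Finite := Set.finite_Iic _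
  refine (hfin.subset (s := Set.Iic (fun _ : NegRoot (N + 1) => B))
    (t := {β | pbwWeight lam β = nu}) fun β hβ x => ?_).to_subtype
  rw [← key β hβ]
  refine le_trans ?_ (Finset.single_le_sum (f := fun x : NegRoot (N + 1) =>
    β x * ((x.1.1 : ℕ) - (x.1.2 : ℕ))) (fun _ _ => Nat.zero_le _) (Finset.mem_univ x))
  have : 1 ≤ (x.1.1 : ℕ) - (x.1.2 : ℕ) := by
    have := Fin.lt_def.mp x.2
    omega
  exact Nat.le_mul_of_pos_right _ this

variable {lam}

theorem weightDecomp_of_mem {nu : Fin (N + 1) → ℂ} {w : Verma lam} (hw : w ∈ weightSpace lam nu) :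
    weightDecomp lam w = DirectSum.lof ℂ _ (fun nu => weightSpace lam nu) nu ⟨w, hw⟩ := by
  rw [weightDecomp]
  exact (LinearEquiv.symm_apply_eq _).mpr
    (DirectSum.coeLinearMap_lof (weightSpace lam) nu ⟨w, hw⟩).symm

theorem torusOp_of_mem (z : Fin (N + 1) → ℂ) {nu : Fin (N + 1) → ℂ} {w : Verma lam}
    (hw : w ∈ weightSpace lam nu) : torusOp lam z w = (∏ k, z k ^ nu k) • w := by
  rw [torusOp, LinearMap.comp_apply, LinearEquiv.coe_coe, weightDecomp_of_mem hw,
    DirectSum.toModule_lof]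
  rfl

theorem weightProj_of_mem {nu : Fin (N + 1) → ℂ} {w : Verma lam} (hw : w ∈ weightSpace lam nu) :
    weightProj lam nu w = ⟨w, hw⟩ := by
  classical
  rw [weightProj, LinearMap.comp_apply, LinearEquiv.coe_coe, weightDecomp_of_mem hw]
  exact DirectSum.component.lof_self ℂ nu _

theorem weightProj_of_mem_of_ne {nu nu' : Fin (N + 1) → ℂ} (h : nu' ≠ nu) {w : Verma lam}
    (hw : w ∈ weightSpace lam nu') : weightProj lam nu w = 0 := by
  classical
  rw [weightProj, LinearMap.comp_apply, LinearEquiv.coe_coe, weightDecomp_of_mem hw]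
  exact (DirectSum.component.of ℂ _ _ _).trans (dif_neg h)

/-- The projection to a weight space keeps the coordinates with respect to the PBW vectors of that
weight. -/
theorem repr_weightProj {nu : Fin (N + 1) → ℂ} {β : NegRoot (N + 1) → ℕ}
    (hβ : pbwWeight lam β = nu) (w : Verma lam) :
    (pbwBasis lam).repr (weightProj lam nu w : Verma lam) β = (pbwBasis lam).repr w β := by
  have h : (Finsupp.lapply β ∘ₗ (pbwBasis lam).repr.toLinearMap) ∘ₗ
      ((weightSpace lam nu).subtype ∘ₗ weightProj lam nu) =
      Finsupp.lapply β ∘ₗ (pbwBasis lam).repr.toLinearMap := by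
    refine (pbwBasis lam).ext fun γ => ?_
    simp only [LinearMap.comp_apply, LinearEquiv.coe_coe, Submodule.subtype_apply,
      Finsupp.lapply_apply]
    by_cases hγ : pbwWeight lam γ = nu
    · subst hγ
      rw [weightProj_of_mem (pbwBasis_mem_weightSpace lam γ)]
    · rw [weightProj_of_mem_of_ne hγ (pbwBasis_mem_weightSpace lam γ)]
      have : γ ≠ β := by rintro rfl; exact hγ hβ
      simp [this]
  exact LinearMap.congr_fun h w

variable (lam) in
/-- The PBW basis of a weight space. -/
noncomputable def weightBasis (nu : Fin (N + 1) → ℂ) :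
    Module.Basis {β : NegRoot (N + 1) → ℕ // pbwWeight lam β = nu} ℂ (weightSpace lam nu) :=
  Module.Basis.mk
    (v := fun β => ⟨pbwBasis lam β, pbwBasis_mem_weightSpace' β.2⟩)
    (by
      refine LinearIndependent.of_comp (weightSpace lam nu).subtype ?_
      exact (pbwBasis lam).linearIndependent.comp _ Subtype.val_injective)
    (by
      rintro ⟨w, hw⟩ -
      have h : ∀ w : Verma lam, weightProj lam nu w ∈ Submodule.span ℂ (Set.range
          fun β : {β : NegRoot (N + 1) → ℕ // pbwWeight lam β = nu} =>
            (⟨pbwBasis lam β, pbwBasis_mem_weightSpace' β.2⟩ : weightSpace lam nu)) := by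
        intro w
        have hw := (pbwBasis lam).mem_span w
        induction hw using Submodule.span_induction with
        | mem x hx =>
          obtain ⟨γ, rfl⟩ := hx
          by_cases hγ : pbwWeight lam γ = nu
          · subst hγ
            rw [weightProj_of_mem (pbwBasis_mem_weightSpace lam γ)]
            exact Submodule.subset_span ⟨⟨γ, rfl⟩, rfl⟩
          · rw [weightProj_of_mem_of_ne hγ (pbwBasis_mem_weightSpace lam γ)]
            exact zero_mem _
        | zero => rw [map_zero]; exact zero_mem _
        | add x y _ _ hx hy => rw [map_add]; exact add_mem hx hy
        | smul c x _ hx => rw [map_smul]; exact Submodule.smul_mem _ _ hx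
      have := h w
      rwa [weightProj_of_mem hw] at this)

theorem weightBasis_apply (nu : Fin (N + 1) → ℂ)
    (β : {β : NegRoot (N + 1) → ℕ // pbwWeight lam β = nu}) :
    (weightBasis lam nu β : Verma lam) = pbwBasis lam β := by
  rw [weightBasis, Module.Basis.mk_apply]

theorem weightBasis_repr (nu : Fin (N + 1) → ℂ) (w : weightSpace lam nu)
    (β : {β : NegRoot (N + 1) → ℕ // pbwWeight lam β = nu}) :
    (weightBasis lam nu).repr w β = (pbwBasis lam).repr (w : Verma lam) β := by
  have h : Finsupp.lapply β ∘ₗ (weightBasis lam nu).repr.toLinearMap =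
      (Finsupp.lapply β.1 ∘ₗ (pbwBasis lam).repr.toLinearMap) ∘ₗ (weightSpace lam nu).subtype := by
    refine (weightBasis lam nu).ext fun γ => ?_
    simp [weightBasis_apply, Finsupp.single_apply, Subtype.ext_iff]
  exact LinearMap.congr_fun h w

/-- The trace of a diagonal block is the sum of the diagonal coefficients at the PBW vectors of the
given weight. -/
theorem hasSum_blockTrace (T : Verma lam →ₗ[ℂ] Verma lam) (nu : Fin (N + 1) → ℂ) :
    HasSum (fun β : {β : NegRoot (N + 1) → ℕ // pbwWeight lam β = nu} =>
      (pbwBasis lam).repr (T (pbwBasis lam β)) β) (blockTrace lam T nu) := by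
  classical
  have := finite_pbwWeight_fiber lam nu
  have := Fintype.ofFinite {β : NegRoot (N + 1) → ℕ // pbwWeight lam β = nu}
  rw [blockTrace, LinearMap.trace_eq_matrix_trace ℂ (weightBasis lam nu), Matrix.trace]
  convert hasSum_fintype _ using 1
  refine Finset.sum_congr rfl fun β _ => ?_
  rw [Matrix.diag_apply, LinearMap.toMatrix_apply, weightBasis_repr, LinearMap.comp_apply,
    LinearMap.comp_apply, Submodule.subtype_apply, weightBasis_apply, repr_weightProj β.2]

/-- The total trace as a sum over PBW vectors. -/
theorem hasSum_blockTrace_total (T : Verma lam →ₗ[ℂ] Verma lam) {S : ℂ}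
    (h : HasSum (fun β => (pbwBasis lam).repr (T (pbwBasis lam β)) β) S) :
    HasSum (blockTrace lam T) S := by
  have h1 := (Equiv.sigmaFiberEquiv (pbwWeight lam)).hasSum_iff.mpr h
  exact h1.sigma fun nu => hasSum_blockTrace T nu

/-- The `x^{e + mu}`-part of a homomorphism lowers weights by `e`. -/
theorem coeff_hom_mem_weightSpace {mu : ℂ} (Phi : Verma lam →ₗ⁅ℂ, gl (N + 1)⁆ Laurent lam mu)
    (e : Fin (N + 1) → ℤ) {nu : Fin (N + 1) → ℂ} {w : Verma lam} (hw : w ∈ weightSpace lam nu) :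
    coeff lam mu e (Phi w) ∈ weightSpace lam (fun k => nu k - e k) := by
  rw [mem_weightSpace] at hw ⊢
  intro k
  have h := congrArg (coeff lam mu e) (congrArg Phi (hw k))
  rw [LieModuleHom.map_lie, coeff_lie_E, if_pos rfl, sub_add_cancel, map_smul, map_smul,
    ← sub_smul, add_sub_cancel_right] at h
  rw [sub_smul]
  exact eq_sub_of_add_eq h

/-- A part of nonzero weight has no diagonal blocks. -/
theorem traceTerm_eq_zero {mu : ℂ} (Phi : Verma lam →ₗ⁅ℂ, gl (N + 1)⁆ Laurent lam mu)
    (z : Fin (N + 1) → ℂ) {e : Fin (N + 1) → ℤ} (he : e ≠ 0) (nu : Fin (N + 1) → ℂ) :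
    traceTerm (Phi : Verma lam →ₗ[ℂ] Laurent lam mu) z e nu = 0 := by
  rw [traceTerm, blockTrace]
  convert map_zero (LinearMap.trace ℂ (weightSpace lam nu))
  refine LinearMap.ext fun w => ?_
  simp only [LinearMap.comp_apply, Submodule.subtype_apply, LinearMap.zero_apply]
  rw [torusOp_of_mem z w.2, map_smul, map_smul, map_smul]
  have h := coeff_hom_mem_weightSpace Phi e w.2
  have hne : (fun k => nu k - (e k : ℂ)) ≠ nu := by
    intro h0
    refine he (funext fun k => ?_)
    have := congrFun h0 k
    simpa using this
  have h2 := weightProj_of_mem_of_ne hne h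
  exact (congrArg _ h2).trans (smul_zero _)

/-- The trace of the `x^0`-part as a sum over PBW vectors. -/
theorem hasSum_traceTerm {mu : ℂ} (Phi : Verma lam →ₗ⁅ℂ, gl (N + 1)⁆ Laurent lam mu)
    (z : Fin (N + 1) → ℂ) {S : ℂ}
    (h : HasSum (fun β => (∏ k, z k ^ pbwWeight lam β k) *
      (pbwBasis lam).repr (coeff lam mu 0 (Phi (pbwBasis lam β))) β) S) :
    HasSum (traceTerm (Phi : Verma lam →ₗ[ℂ] Laurent lam mu) z 0) S := by
  refine hasSum_blockTrace_total _ ?_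
  convert h using 1
  funext β
  rw [LinearMap.comp_apply, LinearMap.comp_apply,
    torusOp_of_mem z (pbwBasis_mem_weightSpace lam β), map_smul, map_smul, map_smul,
    Finsupp.smul_apply, smul_eq_mul]
  rfl

end Trace

/-! ### Summation -/

section Summation

theorem hasSum_fin_pi_prod {𝕜 : Type*} [NormedField 𝕜] [CompleteSpace 𝕜] :
    ∀ (n : ℕ) (f : Fin n → ℕ → 𝕜) (S : Fin n → 𝕜), (∀ i, Summable fun k => ‖f i k‖) →
      (∀ i, HasSum (f i) (S i)) → (Summable fun β : Fin n → ℕ => ‖∏ i, f i (β i)‖) ∧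
        HasSum (fun β : Fin n → ℕ => ∏ i, f i (β i)) (∏ i, S i) := by
  intro n
  induction n with
  | zero =>
    intro f S _ _
    simp only [Finset.univ_eq_empty, Finset.prod_empty]
    refine ⟨(hasSum_fintype _).summable, ?_⟩
    simp
  | succ n ih =>
    intro f S hf hS
    obtain ⟨h1, h2⟩ := ih (fun i => f i.succ) (fun i => S i.succ) (fun i => hf _) (fun i => hS _)
    have h3 := (hf 0).mul_norm h1
    have h4 := (hS 0).mul h2 h3.of_norm
    obtain ⟨e, he⟩ : ∃ e : (Fin (n + 1) → ℕ) ≃ ℕ × (Fin n → ℕ), ∀ β,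
        ∏ i, f i (β i) = f 0 (e β).1 * ∏ i, f i.succ ((e β).2 i) :=
      ⟨(Fin.consEquiv fun _ => ℕ).symm, fun β => Fin.prod_univ_succ _⟩
    simp only [he]
    rw [Fin.prod_univ_succ S]
    generalize hg : (fun x : ℕ × (Fin n → ℕ) => f 0 x.1 * ∏ i, f i.succ (x.2 i)) = g at h3 h4
    have hg' : ∀ x, f 0 x.1 * ∏ i, f i.succ (x.2 i) = g x := fun x => congrFun hg x
    simp only [hg'] at h3 ⊢
    exact ⟨(e.summable_iff (f := fun x => ‖g x‖)).mpr h3, (e.hasSum_iff (f := g)).mpr h4⟩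

/-- A product of absolutely convergent series, as a series over families of indices. -/
theorem hasSum_pi_prod {𝕜 : Type*} [NormedField 𝕜] [CompleteSpace 𝕜] {ι : Type*} [Fintype ι]
    (f : ι → ℕ → 𝕜) (S : ι → 𝕜) (hf : ∀ i, Summable fun k => ‖f i k‖)
    (hS : ∀ i, HasSum (f i) (S i)) :
    (Summable fun β : ι → ℕ => ‖∏ i, f i (β i)‖) ∧
      HasSum (fun β : ι → ℕ => ∏ i, f i (β i)) (∏ i, S i) := by
  obtain ⟨n, ⟨e⟩⟩ := Finite.exists_equiv_fin ι
  obtain ⟨h1, h2⟩ := hasSum_fin_pi_prod n (fun i => f (e.symm i)) (fun i => S (e.symm i))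
    (fun i => hf _) (fun i => hS _)
  obtain ⟨e', he⟩ : ∃ e' : (ι → ℕ) ≃ (Fin n → ℕ), ∀ β,
      ∏ i, f i (β i) = ∏ i, f (e.symm i) (e' β i) :=
    ⟨e.arrowCongr (Equiv.refl ℕ), fun β => (e.symm.prod_comp fun i => f i (β i)).symm⟩
  rw [e.symm.prod_comp S] at h2
  simp only [he]
  generalize hg : (fun b : Fin n → ℕ => ∏ i, f (e.symm i) (b i)) = g at h2
  have hg' : ∀ b, ∏ i, f (e.symm i) (b i) = g b := fun b => congrFun hg b
  simp only [hg'] at h1 ⊢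
  exact ⟨(e'.summable_iff (f := fun b => ‖g b‖)).mpr h1, (e'.hasSum_iff (f := g)).mpr h2⟩

/-- The binomial series of `1 / (1 - r) ^ (a + 1)`, shifted by `a`. -/
theorem hasSum_choose_mul_pow {𝕜 : Type*} [NormedField 𝕜] [CompleteSpace 𝕜] (a : ℕ) {r : 𝕜}
    (hr : ‖r‖ < 1) :
    HasSum (fun n : ℕ => (n.choose a : 𝕜) * r ^ n) (r ^ a / (1 - r) ^ (a + 1)) := by
  have h := (hasSum_choose_mul_geometric_of_norm_lt_one a hr).mul_left (r ^ a)
  have h2 : (fun n : ℕ => r ^ a * (((n + a).choose a : 𝕜) * r ^ n)) =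
      (fun n : ℕ => (n.choose a : 𝕜) * r ^ n) ∘ fun n => n + a := by
    funext n
    simp only [Function.comp_apply, pow_add]
    ring
  rw [h2, Function.Injective.hasSum_iff (add_left_injective a), mul_one_div] at h
  · exact h
  · intro n hn
    have : n < a := by
      by_contra! hge
      exact hn ⟨n - a, Nat.sub_add_cancel hge⟩
    rw [Nat.choose_eq_zero_of_lt this, Nat.cast_zero, zero_mul]

theorem hasSum_prod_choose {ι : Type*} [Fintype ι] (a : ι → ℕ) {q : ι → ℂ} (hq : ∀ i, ‖q i‖ < 1) :
    HasSum (fun β : ι → ℕ => ∏ i, (((β i).choose (a i) : ℂ) * q i ^ β i))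
      (∏ i, q i ^ a i / (1 - q i) ^ (a i + 1)) ∧
    HasSum (fun β : ι → ℕ => ‖∏ i, (((β i).choose (a i) : ℂ) * q i ^ β i)‖)
      (∏ i, ‖q i‖ ^ a i / (1 - ‖q i‖) ^ (a i + 1)) := by
  have hn : ∀ i, HasSum (fun n : ℕ => (n.choose (a i) : ℝ) * ‖q i‖ ^ n)
      (‖q i‖ ^ a i / (1 - ‖q i‖) ^ (a i + 1)) := fun i =>
    hasSum_choose_mul_pow (a i) (by simpa using hq i)
  constructor
  · refine (hasSum_pi_prod (fun i n => (n.choose (a i) : ℂ) * q i ^ n) _ (fun i => ?_)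
      fun i => hasSum_choose_mul_pow (a i) (hq i)).2
    simpa using (hn i).summable
  · have := (hasSum_pi_prod (fun i (n : ℕ) => (n.choose (a i) : ℝ) * ‖q i‖ ^ n) _
      (fun i => by simpa using (hn i).summable) hn).2
    simpa using this

/-- Interchange of the summations over PBW exponents `β` and over families `γ`. -/
theorem hasSum_interchange {ι : Type*} [Fintype ι] [DecidableEq ι] {q : ι → ℂ} (hq : ∀ i, ‖q i‖ < 1)
    (c : (ι → ℕ) → ℂ) (a : (ι → ℕ) → ι → ℕ) (ha : ∀ γ, γ ≤ a γ)
    (hc : Summable fun γ => ‖c γ‖ * ∏ i, ‖q i‖ ^ a γ i / (1 - ‖q i‖) ^ (a γ i + 1)) :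
    ∃ T : ℂ, HasSum (fun γ => c γ * ∏ i, q i ^ a γ i / (1 - q i) ^ (a γ i + 1)) T ∧
      HasSum (fun β : ι → ℕ => ∑ γ ∈ Finset.Iic β,
        c γ * ∏ i, (((β i).choose (a γ i) : ℂ) * q i ^ β i)) T := by
  set F : (ι → ℕ) × (ι → ℕ) → ℂ :=
    fun p => c p.1 * ∏ i, (((p.2 i).choose (a p.1 i) : ℂ) * q i ^ p.2 i) with hF
  have hrow : ∀ γ, HasSum (fun β => ‖F (γ, β)‖)
      (‖c γ‖ * ∏ i, ‖q i‖ ^ a γ i / (1 - ‖q i‖) ^ (a γ i + 1)) := by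
    intro γ
    simp only [hF, norm_mul]
    have := (hasSum_prod_choose (a γ) hq).2.mul_left ‖c γ‖
    simpa using this
  have hsum : Summable F := by
    refine Summable.of_norm ((summable_prod_of_nonneg fun p => norm_nonneg _).mpr
      ⟨fun γ => (hrow γ).summable, ?_⟩)
    simpa only [fun γ => (hrow γ).tsum_eq] using hc
  obtain ⟨T, hT⟩ := hsum
  refine ⟨T, hT.prod_fiberwise fun γ => (hasSum_prod_choose (a γ) hq).1.mul_left (c γ), ?_⟩
  have hT' : HasSum (F ∘ Prod.swap) T := (Equiv.prodComm _ _).hasSum_iff.mpr hT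
  refine hT'.prod_fiberwise fun β => ?_
  refine hasSum_sum_of_ne_finset_zero fun γ hγ => ?_
  have : ∃ i, β i < γ i := by
    simpa [Pi.le_def] using hγ
  obtain ⟨i, hi⟩ := this
  simp only [hF, Function.comp_apply, Prod.swap_prod_mk]
  rw [Finset.prod_eq_zero (Finset.mem_univ i), mul_zero]
  rw [Nat.choose_eq_zero_of_lt (hi.trans_le (ha γ i)), Nat.cast_zero, zero_mul]

end Summation

/-! ### Growth of the coefficients of the path hypergeometric series -/

section Growth

theorem norm_ascPochhammer_eval_le (k : ℕ) (c : ℂ) {b : ℝ} (hb : ‖c‖ + k ≤ b) :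
    ‖(ascPochhammer ℂ k).eval c‖ ≤ b ^ k := by
  induction k with
  | zero => simp
  | succ k ih =>
    have hb' : ‖c‖ + k ≤ b := by push_cast at hb; linarith
    rw [ascPochhammer_succ_eval, norm_mul, pow_succ]
    have h1 : ‖c + k‖ ≤ b := (norm_add_le _ _).trans (by simpa using hb')
    exact mul_le_mul (ih hb') h1 (norm_nonneg _) (pow_nonneg ((norm_nonneg _).trans h1) _)

/-- The ratio grows at most exponentially, since the quotients `(k - mu) / (k - sigma)` of consecutive
factors converge to `1`. A vanishing denominator only makes the left side `0`. -/
theorem exists_ascPochhammer_ratio_le {sigma : ℂ} (mu : ℂ) :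
    ∃ R : ℝ, 1 ≤ R ∧ ∀ k : ℕ,
      ‖(ascPochhammer ℂ k).eval (-mu) / (ascPochhammer ℂ k).eval (-sigma)‖ ≤ R ^ k := by
  have h := (tendsto_add_mul_div_add_mul_atTop_nhds (-mu) (-sigma) (1 : ℂ)
    (one_ne_zero (α := ℂ))).norm.bddAbove_range
  obtain ⟨R, hR⟩ := h
  refine ⟨max 1 R, le_max_left _ _, fun k => ?_⟩
  induction k with
  | zero => simp
  | succ k ih =>
    rw [ascPochhammer_succ_eval, ascPochhammer_succ_eval, mul_div_mul_comm, norm_mul, pow_succ]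
    refine mul_le_mul ih ?_ (norm_nonneg _) (by positivity)
    have := hR ⟨k, rfl⟩
    simp only [one_mul] at this
    exact this.trans (le_max_right _ _)

theorem sum_upperSum {N : ℕ} (γ : NegRoot (N + 1) → ℕ) :
    ∑ s : Fin N, upperSum γ s.castSucc = ∑ x, γ x := by
  have h := Finset.sum_fiberwise (Finset.univ : Finset (NegRoot (N + 1))) (fun x => x.1.2) γ
  rw [← h, Fin.sum_univ_castSucc]
  have h0 : ∑ x : NegRoot (N + 1) with x.1.2 = Fin.last N, γ x = 0 := by
    refine Finset.sum_eq_zero fun x hx => ?_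
    have h1 := x.2
    rw [(Finset.mem_filter.mp hx).2] at h1
    exact absurd h1 (Fin.le_last _).not_gt
  rw [h0, add_zero]
  rfl

theorem lowerSum_le {n : ℕ} (γ : NegRoot n → ℕ) (s : Fin n) : lowerSum γ s ≤ ∑ x, γ x :=
  Finset.sum_le_sum_of_subset (Finset.filter_subset _ _)

theorem upperSum_le {n : ℕ} (γ : NegRoot n → ℕ) (s : Fin n) : upperSum γ s ≤ ∑ x, γ x :=
  Finset.sum_le_sum_of_subset (Finset.filter_subset _ _)

/-- The coefficients of the path hypergeometric series grow at most exponentially: the numerator is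
at most `(c + 2 M) ^ M` up to an exponential factor, where `M` is the total degree, and dividing by
the factorials leaves a product of terms `t ^ k / k! ≤ exp t` with `t = c + 2 M`. -/
theorem exists_pathTerm_le (m : ℕ) (mu sigma : ℂ) :
    ∃ A B : ℝ, 0 < A ∧ 0 < B ∧ ∀ γ : NegRoot (m + 2) → ℕ,
      ‖pathTerm (fun s => if s = Fin.last (m + 1) then -mu else mu + 1) (-sigma) 1 γ‖ ≤
        A * ∏ x, B ^ γ x := by
  obtain ⟨R, hR1, hR⟩ := exists_ascPochhammer_ratio_le (sigma := sigma) mu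
  set K : ℕ := Fintype.card (NegRoot (m + 2))
  set c : ℝ := ‖mu + 1‖
  have hc : 0 ≤ c := norm_nonneg _
  refine ⟨Real.exp (K * c), R * Real.exp (K * 2), Real.exp_pos _, by positivity, fun γ => ?_⟩
  set M : ℕ := ∑ x, γ x with hM
  have hlast : ∀ s : Fin (m + 1), s.castSucc ≠ Fin.last (m + 1) :=
    fun s => (Fin.castSucc_lt_last s).ne
  simp only [pathTerm, hlast, if_true, if_false, Pi.one_apply, one_pow, Finset.prod_const_one,
    mul_one]
  have h1 : ‖∏ s : Fin (m + 1), (ascPochhammer ℂ (upperSum γ s.castSucc)).eval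
      (mu + 1 - (lowerSum γ s.castSucc : ℂ))‖ ≤ (c + 2 * M) ^ M := by
    rw [norm_prod]
    calc _ ≤ ∏ s : Fin (m + 1), (c + 2 * M) ^ upperSum γ s.castSucc := by
          refine Finset.prod_le_prod (fun _ _ => norm_nonneg _) fun s _ => ?_
          refine norm_ascPochhammer_eval_le _ _ ?_
          have e1 : ‖mu + 1 - (lowerSum γ s.castSucc : ℂ)‖ ≤ c + lowerSum γ s.castSucc :=
            (norm_sub_le _ _).trans (by simp [c])
          have e2 : (lowerSum γ s.castSucc : ℝ) ≤ M := by exact_mod_cast lowerSum_le γ _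
          have e3 : (upperSum γ s.castSucc : ℝ) ≤ M := by exact_mod_cast upperSum_le γ _
          linarith
      _ = _ := by rw [Finset.prod_pow_eq_pow_sum, sum_upperSum]
  have h2 : (c + 2 * M) ^ M / ∏ x, ((γ x).factorial : ℝ) ≤ Real.exp (K * (c + 2 * M)) := by
    rw [hM, ← Finset.prod_pow_eq_pow_sum, ← Finset.prod_div_distrib]
    calc _ ≤ ∏ x : NegRoot (m + 2), Real.exp (c + 2 * M) :=
          Finset.prod_le_prod (fun _ _ => by positivity)
            fun x _ => Real.pow_div_factorial_le_exp _ (by positivity) _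
      _ = _ := by rw [Finset.prod_const, ← Real.exp_nat_mul, Finset.card_univ]
  have h3 := hR (lowerSum γ (Fin.last (m + 1)))
  have h4 : R ^ lowerSum γ (Fin.last (m + 1)) ≤ R ^ M := pow_le_pow_right₀ hR1 (lowerSum_le γ _)
  have hfac : ‖∏ x, ((γ x).factorial : ℂ)‖ = ∏ x, ((γ x).factorial : ℝ) := by simp
  rw [mul_div_mul_comm, norm_mul, norm_div, hfac]
  calc _ ≤ (c + 2 * M) ^ M / (∏ x, ((γ x).factorial : ℝ)) * R ^ M := by
        refine mul_le_mul ?_ (h3.trans h4) (norm_nonneg _) (by positivity)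
        gcongr
    _ ≤ Real.exp (K * (c + 2 * M)) * R ^ M := by gcongr
    _ = Real.exp (K * c) * ∏ x, (R * Real.exp (K * 2)) ^ γ x := by
        rw [Finset.prod_pow_eq_pow_sum, ← hM, mul_pow, ← Real.exp_nat_mul,
          mul_comm (R ^ M), ← mul_assoc, ← Real.exp_add]
        congr 2
        ring

end Growth

/-! ### The summed series in terms of `z` -/

section Evaluation

variable {N : ℕ} (z : Fin (N + 1) → ℂ)

/-- The ratio `z_j / z_k` of a negative root `(j, k)`. -/
noncomputable def rootRatio {n : ℕ} (z : Fin n → ℂ) (y : NegRoot n) : ℂ := z y.1.1 / z y.1.2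

variable {z}

theorem prod_cpow_pbwWeight (lam : Fin (N + 1) → ℂ) (hz : ∀ k, z k ≠ 0)
    (β : NegRoot (N + 1) → ℕ) :
    ∏ k, z k ^ pbwWeight lam β k = (∏ k, z k ^ lam k) * ∏ y, rootRatio z y ^ β y := by
  have h1 : ∀ k, z k ^ pbwWeight lam β k = z k ^ lam k * (z k ^ weightShift β k)⁻¹ := by
    intro k
    rw [pbwWeight, Complex.cpow_sub _ _ (hz k), Complex.cpow_intCast, div_eq_mul_inv]
  have h2 : ∀ x : NegRoot (N + 1), ∀ c : ℕ,
      ∏ k, z k ^ (c • (Pi.single x.1.2 1 - Pi.single x.1.1 1) : Fin (N + 1) → ℤ) k =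
        (rootRatio z x ^ c)⁻¹ := by
    intro x c
    simp only [Pi.smul_apply, Pi.sub_apply, nsmul_eq_mul, mul_comm (c : ℤ), zpow_mul, zpow_natCast]
    rw [Finset.prod_pow]
    have h3 : ∏ k, z k ^ ((Pi.single x.1.2 1 : Fin (N + 1) → ℤ) k -
        (Pi.single x.1.1 1 : Fin (N + 1) → ℤ) k) = z x.1.2 / z x.1.1 := by
      have h4 : ∀ j : Fin (N + 1), ∏ k, z k ^ (Pi.single j 1 : Fin (N + 1) → ℤ) k = z j := by
        intro j
        rw [Finset.prod_eq_single j]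
        · simp
        · intro k _ hk; simp [hk]
        · simp
      simp only [zpow_sub₀ (hz _)]
      rw [Finset.prod_div_distrib, h4, h4]
    rw [h3, rootRatio, ← inv_pow, inv_div]
  rw [Finset.prod_congr rfl fun k _ => h1 k, Finset.prod_mul_distrib, Finset.prod_inv_distrib]
  congr 1
  rw [inv_eq_iff_eq_inv, ← Finset.prod_inv_distrib]
  have h5 : ∀ k, z k ^ weightShift β k = ∏ x : NegRoot (N + 1),
      z k ^ (β x • (Pi.single x.1.2 1 - Pi.single x.1.1 1) : Fin (N + 1) → ℤ) k := by
    intro k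
    rw [weightShift, Finset.sum_apply]
    induction (Finset.univ : Finset (NegRoot (N + 1))) using Finset.induction_on with
    | empty => simp
    | insert a s ha ih => rw [Finset.sum_insert ha, Finset.prod_insert ha, zpow_add₀ (hz k), ih]
  rw [Finset.prod_congr rfl fun k _ => h5 k, Finset.prod_comm]
  exact Finset.prod_congr rfl fun x _ => h2 x (β x)

/-- The arguments `ξ` collect the row-wise geometric factors. -/
theorem prod_pow_cumSum {n : ℕ} {z : Fin n → ℂ} (γ : NegRoot n → ℕ) :
    ∏ y : NegRoot n, (z y.1.1 / (z y.1.1 - z y.1.2)) ^ cumSum γ y = ∏ x, xi z x ^ γ x := by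
  have h1 : ∀ x : NegRoot n, xi z x = ∏ y : NegRoot n with x.1.1 = y.1.1 ∧ x.1.2 ≤ y.1.2,
      z y.1.1 / (z y.1.1 - z y.1.2) := by
    intro x
    rw [xi]
    symm
    refine Finset.prod_bij (fun y _ => y.1.2) ?_ ?_ ?_ ?_
    · intro y hy
      have h := (Finset.mem_filter.mp hy).2
      rw [Finset.mem_Ico, h.1]
      exact ⟨h.2, y.2⟩
    · intro y hy y' hy' h
      have h1 := (Finset.mem_filter.mp hy).2
      have h2 := (Finset.mem_filter.mp hy').2
      exact Subtype.ext (Prod.ext (h1.1.symm.trans h2.1) h)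
    · intro s hs
      rw [Finset.mem_Ico] at hs
      exact ⟨⟨(x.1.1, s), hs.2⟩, by simp [hs.1], rfl⟩
    · intro y hy
      rw [(Finset.mem_filter.mp hy).2.1]
  simp only [h1, cumSum, ← Finset.prod_pow_eq_pow_sum, ← Finset.prod_pow]
  simp only [Finset.prod_filter]
  rw [Finset.prod_comm]

/-- The sign turns `q / (1 - q)` into `z_j / (z_j - z_k)` for `q = z_j / z_k`. -/
theorem sign_mul_prod_geometric (hz : ∀ k, z k ≠ 0) (γ : NegRoot (N + 1) → ℕ) :
    (-1) ^ (∑ y, cumSum γ y) * ∏ y, rootRatio z y ^ cumSum γ y /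
      (1 - rootRatio z y) ^ (cumSum γ y + 1) =
      (∏ y : NegRoot (N + 1), (1 - rootRatio z y)⁻¹) * ∏ x, xi z x ^ γ x := by
  rw [← prod_pow_cumSum, ← Finset.prod_pow_eq_pow_sum, ← Finset.prod_mul_distrib,
    ← Finset.prod_mul_distrib]
  refine Finset.prod_congr rfl fun y _ => ?_
  have h1 : z y.1.1 / (z y.1.1 - z y.1.2) = -rootRatio z y / (1 - rootRatio z y) := by
    have hk := hz y.1.2
    rw [rootRatio, one_sub_div hk, ← neg_div, div_div_div_cancel_right₀ hk, ← neg_sub (z y.1.2),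
      div_neg, neg_div]
  rw [h1]
  generalize 1 - rootRatio z y = w
  rw [div_pow, neg_pow, pow_succ, div_eq_mul_inv, div_eq_mul_inv, mul_inv]
  ring

/-- The product of the geometric series over all negative roots. -/
theorem prod_cpow_mul_prod_inv (lam : Fin (N + 1) → ℂ) (hz : ∀ k, z k ≠ 0) :
    (∏ k, z k ^ lam k) * ∏ y : NegRoot (N + 1), (1 - rootRatio z y)⁻¹ =
      (∏ r : Fin (N + 1), z r ^ (lam r + ((N + 1 : ℕ) : ℂ) - ((r : ℕ) + 1))) /
        ∏ p : NegRoot (N + 1), (z p.1.2 - z p.1.1) := by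
  have h1 : ∀ y : NegRoot (N + 1), (1 - rootRatio z y)⁻¹ = z y.1.2 / (z y.1.2 - z y.1.1) := by
    intro y
    rw [rootRatio, one_sub_div (hz _), inv_div]
  have h2 : ∏ y : NegRoot (N + 1), z y.1.2 = ∏ r : Fin (N + 1), z r ^ (N - (r : ℕ)) := by
    rw [← Finset.prod_fiberwise (Finset.univ : Finset (NegRoot (N + 1))) (fun y => y.1.2)]
    refine Finset.prod_congr rfl fun r _ => ?_
    rw [Finset.prod_congr rfl fun y hy => congrArg z (Finset.mem_filter.mp hy).2,
      Finset.prod_const]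
    congr 1
    have : N - (r : ℕ) = (Finset.Ioi r).card := by simp
    rw [this]
    refine Finset.card_bij (fun y _ => y.1.1) ?_ ?_ ?_
    · intro y hy
      rw [Finset.mem_Ioi, ← (Finset.mem_filter.mp hy).2]
      exact y.2
    · intro y hy y' hy' h
      exact Subtype.ext (Prod.ext h
        ((Finset.mem_filter.mp hy).2.trans (Finset.mem_filter.mp hy').2.symm))
    · intro s hs
      exact ⟨⟨(s, r), Finset.mem_Ioi.mp hs⟩, by simp, rfl⟩
  rw [Finset.prod_congr rfl fun y _ => h1 y, Finset.prod_div_distrib, h2, mul_div_assoc',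
    ← Finset.prod_mul_distrib]
  congr 1
  refine Finset.prod_congr rfl fun r _ => ?_
  have h3 : lam r + ((N + 1 : ℕ) : ℂ) - ((r : ℕ) + 1) = lam r + ((N - (r : ℕ) : ℕ) : ℂ) := by
    rw [Nat.cast_sub (Nat.lt_succ_iff.mp r.isLt)]
    push_cast
    ring
  rw [h3, Complex.cpow_add _ _ (hz r), Complex.cpow_natCast]

/-- The ratios of a rapidly decreasing tuple are small. -/
theorem norm_rootRatio_lt {ε : ℝ} (hε : ε ≤ 1) (hz : ∀ k, z k ≠ 0)
    (h : ∀ k : Fin N, ‖z k.succ‖ < ε * ‖z k.castSucc‖) (y : NegRoot (N + 1)) :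
    ‖rootRatio z y‖ < ε := by
  obtain ⟨⟨⟨j, hj⟩, ⟨k, hk⟩⟩, hy⟩ := y
  simp only [Fin.mk_lt_mk] at hy
  rw [rootRatio, norm_div, div_lt_iff₀ (norm_pos_iff.mpr (hz _))]
  simp only
  induction j, hy using Nat.le_induction with
  | base => exact h ⟨k, by omega⟩
  | succ j hkj ih =>
    have h1 := ih (by omega) (Fin.mk_lt_mk.mpr hkj)
    have h2 := h ⟨j, by omega⟩
    simp only [Fin.succ_mk, Fin.castSucc_mk] at h2
    refine h2.trans (lt_of_le_of_lt ?_ h1)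
    have hε0 : 0 ≤ ε := by
      by_contra! hneg
      exact absurd (h2.trans_le (mul_nonpos_of_nonpos_of_nonneg hneg.le (norm_nonneg _)))
        (norm_nonneg _).not_gt
    exact mul_le_of_le_one_left (norm_nonneg _) hε

/-- Smallness of the ratios makes the double series converge absolutely. -/
theorem summable_geometric_bound {n : ℕ} {A B ε : ℝ} (hA : 0 < A) (hB : 0 < B) (hε0 : 0 < ε)
    (hε : ε ≤ 1 / 2) (hεB : 2 * ε * B < 1) (c : (NegRoot n → ℕ) → ℂ)
    (hc : ∀ γ, ‖c γ‖ ≤ A * ∏ x, B ^ γ x) {q : NegRoot n → ℂ} (hq : ∀ y, ‖q y‖ < ε) :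
    Summable fun γ => ‖c γ‖ * ∏ y, ‖q y‖ ^ cumSum γ y / (1 - ‖q y‖) ^ (cumSum γ y + 1) := by
  have hgeo : Summable fun γ : NegRoot n → ℕ => ∏ x, (2 * ε * B) ^ γ x := by
    have h0 : 0 ≤ 2 * ε * B := by positivity
    exact (hasSum_pi_prod (fun (_ : NegRoot n) k => (2 * ε * B) ^ k) _
      (fun _ => by simpa [abs_of_pos hε0, abs_of_pos hB] using summable_geometric_of_lt_one h0 hεB)
      fun _ => hasSum_geometric_of_lt_one h0 hεB).2.summable
  refine Summable.of_nonneg_of_le (fun γ => ?_) (fun γ => ?_)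
    (hgeo.mul_left (A * ∏ _y : NegRoot n, 2))
  · refine mul_nonneg (norm_nonneg _) (Finset.prod_nonneg fun y _ => ?_)
    have : 0 ≤ 1 - ‖q y‖ := by have := hq y; linarith
    positivity
  · have h1 : ∏ y, ‖q y‖ ^ cumSum γ y / (1 - ‖q y‖) ^ (cumSum γ y + 1) ≤
        ∏ y : NegRoot n, ((2 * ε) ^ γ y * 2) := by
      refine Finset.prod_le_prod (fun y _ => ?_) fun y _ => ?_
      · have : 0 ≤ 1 - ‖q y‖ := by have := hq y; linarith
        positivity
      · have hy := hq y
        have hpos : 1 / 2 ≤ 1 - ‖q y‖ := by linarith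
        have hpos' : 0 < 1 - ‖q y‖ := by linarith
        have e1 : ‖q y‖ / (1 - ‖q y‖) ≤ 2 * ε := by
          rw [div_le_iff₀ hpos']
          nlinarith [norm_nonneg (q y)]
        have e2 : 1 / (1 - ‖q y‖) ≤ 2 := by
          rw [div_le_iff₀ hpos']
          linarith
        calc ‖q y‖ ^ cumSum γ y / (1 - ‖q y‖) ^ (cumSum γ y + 1) =
              (‖q y‖ / (1 - ‖q y‖)) ^ cumSum γ y * (1 / (1 - ‖q y‖)) := by
                rw [div_pow, div_mul_div_comm, mul_one, pow_succ]
          _ ≤ (2 * ε) ^ cumSum γ y * 2 := by gcongr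
          _ ≤ (2 * ε) ^ γ y * 2 :=
            mul_le_mul_of_nonneg_right
              (pow_le_pow_of_le_one (by positivity) (by linarith) (le_cumSum γ y)) (by norm_num)
    calc _ ≤ (A * ∏ x, B ^ γ x) * ∏ y : NegRoot n, ((2 * ε) ^ γ y * 2) :=
          mul_le_mul (hc γ) h1 (Finset.prod_nonneg fun y _ => by
            have : 0 ≤ 1 - ‖q y‖ := by have := hq y; linarith
            positivity) (by positivity)
      _ = _ := by
        simp only [mul_pow, Finset.prod_mul_distrib]
        ring

end Evaluation

end EtingofTrace

theorem theorem3p3 (m : ℕ) (lam : Fin (m + 2) → ℂ) (mu sigma : ℂ)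
    (hmu : ∀ i : Fin m, lam i.castSucc.castSucc - lam i.succ.castSucc = mu)
    (hsigma : lam (Fin.last m).castSucc - lam (Fin.last (m + 1)) = sigma)
    (hsigma_nat : ∀ k : ℕ, sigma ≠ k) :
    ∃ Phi : Verma lam →ₗ⁅ℂ, gl (m + 2)⁆ Laurent lam mu,
      Phi (hwVector lam) = singularVector lam mu ∧
      (∀ Psi : Verma lam →ₗ⁅ℂ, gl (m + 2)⁆ Laurent lam mu,
        Psi (hwVector lam) = singularVector lam mu → Psi = Phi) ∧
      ∃ ε : ℝ, 0 < ε ∧ ∀ z : Fin (m + 2) → ℂ, (∀ k, z k ≠ 0) →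
        (∀ k : Fin (m + 1), ‖z k.succ‖ < ε * ‖z k.castSucc‖) →
        (∀ p : NegRoot (m + 2), z p.1.2 ≠ z p.1.1) ∧
        (∀ e, Summable (traceTerm (Phi : Verma lam →ₗ[ℂ] Laurent lam mu) z e)) ∧
        Summable (pathTerm (fun s => if s = Fin.last (m + 1) then -mu else mu + 1) (-sigma)
          (xi z)) ∧
        etingofTrace (Phi : Verma lam →ₗ[ℂ] Laurent lam mu) z =
          Pi.single 0
            ((∏ r : Fin (m + 2), z r ^ (lam r + ((m + 2 : ℕ) : ℂ) - ((r : ℕ) + 1))) /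
              (∏ p : NegRoot (m + 2), (z p.1.2 - z p.1.1)) *
              pathX (fun s => if s = Fin.last (m + 1) then -mu else mu + 1) (-sigma) (xi z)) := by
  obtain ⟨Phi, hPhi⟩ := exists_singular_hom hmu hsigma hsigma_nat
  refine ⟨Phi, hPhi, fun Psi hPsi => hom_ext_hwVector (hPsi.trans hPhi.symm), ?_⟩
  obtain ⟨A, B, hA, hB, hAB⟩ := exists_pathTerm_le m mu sigma
  set tau : Fin (m + 2) → ℂ := fun s => if s = Fin.last (m + 1) then -mu else mu + 1
  refine ⟨min (1 / 2) (1 / (4 * B)), by positivity, fun z hz hzε => ?_⟩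
  set ε := min (1 / 2) (1 / (4 * B)) with hε
  have hε0 : 0 < ε := by positivity
  have hε2 : ε ≤ 1 / 2 := min_le_left _ _
  have hεB : 2 * ε * B < 1 := by
    have h1 : ε ≤ 1 / (4 * B) := min_le_right _ _
    rw [le_div_iff₀ (by positivity)] at h1
    linarith
  have hq : ∀ y, ‖rootRatio z y‖ < ε := norm_rootRatio_lt (by linarith) hz hzε
  have hq1 : ∀ y, ‖rootRatio z y‖ < 1 := fun y => (hq y).trans_le (by linarith)
  have hne : ∀ p : NegRoot (m + 2), z p.1.2 ≠ z p.1.1 := by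
    intro p h
    have := hq1 p
    rw [rootRatio, h, div_self (hz _), norm_one] at this
    exact lt_irrefl _ this
  set c : (NegRoot (m + 2) → ℕ) → ℂ :=
    fun γ => (-1) ^ (∑ y, cumSum γ y) * pathTerm tau (-sigma) 1 γ with hc
  have hcb : ∀ γ, ‖c γ‖ ≤ A * ∏ x, B ^ γ x := fun γ => by simpa [hc] using hAB γ
  obtain ⟨T, hT1, hT2⟩ := hasSum_interchange hq1 c cumSum (fun γ => le_cumSum γ)
    (summable_geometric_bound hA hB hε0 hε2 hεB c hcb hq)
  -- The series over `γ` is the path hypergeometric series.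
  have hγ : ∀ γ, c γ * ∏ y, rootRatio z y ^ cumSum γ y / (1 - rootRatio z y) ^ (cumSum γ y + 1) =
      (∏ y : NegRoot (m + 2), (1 - rootRatio z y)⁻¹) * pathTerm tau (-sigma) (xi z) γ := by
    intro γ
    have := sign_mul_prod_geometric hz γ
    rw [pathTerm_eq tau (-sigma) (xi z) γ]
    linear_combination pathTerm tau (-sigma) 1 γ * this
  simp only [hγ] at hT1
  have hconst : ∏ y : NegRoot (m + 2), (1 - rootRatio z y)⁻¹ ≠ 0 := by
    refine Finset.prod_ne_zero_iff.mpr fun y _ => inv_ne_zero (sub_ne_zero.mpr fun h => ?_)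
    have := hq1 y
    rw [← h, norm_one] at this
    exact lt_irrefl _ this
  have hpath : Summable (pathTerm tau (-sigma) (xi z)) :=
    (summable_mul_left_iff hconst).mp hT1.summable
  have hTval : T = (∏ y : NegRoot (m + 2), (1 - rootRatio z y)⁻¹) *
      pathX tau (-sigma) (xi z) := hT1.unique (hpath.hasSum.mul_left _)
  -- The series over `β` is the trace.
  have htrace : HasSum (traceTerm (Phi : Verma lam →ₗ[ℂ] Laurent lam mu) z 0)
      ((∏ k, z k ^ lam k) * T) := by
    refine hasSum_traceTerm Phi z ?_
    refine HasSum.congr_fun (hT2.mul_left (∏ k, z k ^ lam k)) fun β => ?_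
    rw [prod_cpow_pbwWeight lam hz, repr_diagonal hsigma hsigma_nat Phi hPhi, mul_assoc,
      Finset.mul_sum]
    congr 1
    refine Finset.sum_congr rfl fun γ _ => ?_
    rw [Finset.prod_mul_distrib]
    ring
  have hzero : ∀ e : Fin (m + 2) → ℤ, e ≠ 0 →
      traceTerm (Phi : Verma lam →ₗ[ℂ] Laurent lam mu) z e = 0 := fun e he =>
    funext fun nu => traceTerm_eq_zero Phi z he nu
  refine ⟨hne, fun e => ?_, hpath, ?_⟩
  · by_cases he : e = 0
    · subst he
      exact htrace.summable
    · rw [hzero e he]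
      exact summable_zero
  · funext e
    by_cases he : e = 0
    · subst he
      rw [Pi.single_eq_same, etingofTrace, htrace.tsum_eq, hTval, ← mul_assoc,
        prod_cpow_mul_prod_inv lam hz]
    · rw [Pi.single_eq_of_ne he, etingofTrace, hzero e he]
      exact tsum_zero
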